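/- Let $\mathcal G$ be a metric graph with finite vertex set $\mathcal V$ and finite edge set $\mathcal E$: each edge $e$ is an interval $I_e=[0,\ell_e]$ with $0<\ell_e<\infty$ (internal edge) or $I_e=[0,+\infty)$ (external edge, attached to a vertex at $0$), whose endpoints are glued at the vertices. Assume that $\mathcal G$ is connected and has at least one external edge. Write $\|\Psi\|_p^p=\sum_{e}\int_{I_e}|\psi_e|^p\,dx$ for $\Psi=(\psi_e)_{e\in\mathcal E}$, $1\le p<\infty$, write $\|\cdot\|=\|\cdot\|_2$, and let $H^1(\mathcal G)$ be the space of continuous functions $\Psi:\mathcal G\to\mathbb C$ with $\psi_e\in H^1(I_e)$ for all $e$. Let $0<\mu\le 2$, let $\alpha_v\in\mathbb R$ for $v\in\mathcal V$, and let $W$ be a real potential on $\mathcal G$ with $W=W_+-W_-$, $W_\pm\ge 0$, $W_+\in L^1(\mathcal G)+L^\infty(\mathcal G)$ and $W_-\in L^r(\mathcal G)$ for some $r\in[1,1+1/\mu]$. For $\Psi\in H^1(\mathcal G)$ put $$E^{lin}[\Psi]=\|\Psi'\|^2+(\Psi,W\Psi)+\sum_{v\in\mathcal V}\alpha_v|\Psi(v)|^2,\qquad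 E[\Psi]=E^{lin}[\Psi]-\frac1{\mu+1}\|\Psi\|_{2\mu+2}^{2\mu+2},$$ $$-E_0=\inf\{E^{lin}[\Psi] : \Psi\in H^1(\mathcal G),\ \|\Psi\|^2=1\},\qquad -\nu_\mu(m)=\inf\{E[\Psi] : \Psi\in H^1(\mathcal G),\ \|\Psi\|^2=m\}\in[-\infty,+\infty).$$ Assume $E_0>0$. Then $-\nu_\mu(m)\le -mE_0$ for all $m>0$. Moreover, let $$m_\mu^*=\begin{cases}(E_0/\gamma_\mu)^{\frac1\mu-\frac12}&\text{if }0<\mu<2,\\ \sqrt3/K_{6,2}(\mathcal G)^3&\text{if }\mu=2,\end{cases}$$ where $$\gamma_\mu=\frac{2-\mu}{2+\mu}\left(2\,\frac{(\mu+1)^{1/\mu}}{\mu}\int_0^1(1-t^2)^{\frac1\mu-1}\,dt\right)^{-\frac{2\mu}{2-\mu}}$$ (so that $-\gamma_\mu m^{1+\frac{2\mu}{2-\mu}}$ is the infimum of $\|\psi'\|_{L^2(\mathbb R)}^2-\frac1{\mu+1}\|\psi\|_{L^{2\mu+2}(\mathbb R)}^{2\mu+2}$ over $\psi\in H^1(\mathbb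 R)$ with $\|\psi\|^2_{L^2(\mathbb R)}=m$), and where $K_{6,2}(\mathcal G)$ is the smallest constant $K\ge 0$ such that $\|\Psi\|_6\le K\|\Psi'\|^{1/3}\|\Psi\|^{2/3}$ for all $\Psi\in H^1(\mathcal G)$. Then $m_\mu^*>0$, and for every $0<m<m_\mu^*$ a ground state of mass $m$ exists: there is $\hat\Psi\in H^1(\mathcal G)$ with $\|\hat\Psi\|^2=m$ and $E[\hat\Psi]=-\nu_\mu(m)$. -/

import Mathlib

open scoped ContDiff

noncomputable section

/-- A metric graph with vertex set `V`. The elements of `I` are the internal edges: `i : I` is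
identified with the segment `[0, len i]`, glued at `0` to the vertex `src i` and at `len i` to the
vertex `tgt i`. The elements of `X` are the external edges: `x : X` is identified with the
half-line `[0, ∞)`, glued at `0` to the vertex `base x`. Loops and multiple edges are allowed.
The graph is finite when the types `V`, `I`, `X` are. -/
structure MetricGraph (V I X : Type*) where
  len : I → ℝ
  len_pos : ∀ i, 0 < len i
  src : I → V
  tgt : I → V
  base : X → V

namespace MetricGraph

/-- The interval `I_e` with which the edge `e` is identified. -/
def dom {V I X : Type*} (G : MetricGraph V I X) : I ⊕ X → Set ℝ
  | Sum.inl i => Set.Icc 0 (G.len i)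
  | Sum.inr _ => Set.Ici 0

/-- Connectedness. Every edge is a path from each of its points to a vertex, so any two points of
the graph are joined by a path if and only if any two vertices are, and two distinct vertices are
joined by a path if and only if they are joined by a chain of internal edges. -/
def Connected {V I X : Type*} (G : MetricGraph V I X) : Prop :=
  (SimpleGraph.fromRel fun v w : V => ∃ i, G.src i = v ∧ G.tgt i = w).Connected

/-- Lebesgue measure on the edge `e`. -/
def edgeMeasure {V I X : Type*} (G : MetricGraph V I X) (e : I ⊕ X) :
    MeasureTheory.Measure ℝ :=
  MeasureTheory.volume.restrict (G.dom e)

/-- `‖Ψ‖_p ^ p`, the sum over the edges of `∫_{I_e} |ψ_e|^p`, for a function given by its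
components on the edges and `1 ≤ p < ∞`. -/
def normPow {V I X : Type*} [Fintype I] [Fintype X] (G : MetricGraph V I X) (p : ℝ)
    (ψ : I ⊕ X → ℝ → ℂ) : ℝ :=
  ∑ e, ∫ x, ‖ψ e x‖ ^ p ∂(G.edgeMeasure e)

/-- The norm `‖Ψ‖_p` of `L^p(𝒢)`, `1 ≤ p < ∞`. -/
def lpNorm {V I X : Type*} [Fintype I] [Fintype X] (G : MetricGraph V I X) (p : ℝ)
    (ψ : I ⊕ X → ℝ → ℂ) : ℝ :=
  G.normPow p ψ ^ (1 / p)

/-- `g` is the weak derivative of `f` on the interior of `s`. -/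
def IsWeakDeriv (s : Set ℝ) (f g : ℝ → ℂ) : Prop :=
  ∀ φ : ℝ → ℝ, ContDiff ℝ ∞ φ → HasCompactSupport φ → tsupport φ ⊆ interior s →
    ∫ x in s, ((deriv φ x : ℝ) : ℂ) * f x = -∫ x in s, (φ x : ℂ) * g x

/-- An element `Ψ` of `H¹(𝒢)`: on each edge a continuous function `val e` in `L²(I_e)` (only its
values on `I_e` matter) with weak derivative `der e` in `L²(I_e)`, such that the values at
endpoints glued to the same vertex `v` coincide; `vert v` is that common value `Ψ(v)`. The
derivative is determined almost everywhere by the function and is carried along as data. -/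
structure H1 {V I X : Type*} (G : MetricGraph V I X) where
  val : I ⊕ X → ℝ → ℂ
  der : I ⊕ X → ℝ → ℂ
  vert : V → ℂ
  continuousOn : ∀ e, ContinuousOn (val e) (G.dom e)
  memLp_val : ∀ e, MeasureTheory.MemLp (val e) 2 (G.edgeMeasure e)
  memLp_der : ∀ e, MeasureTheory.MemLp (der e) 2 (G.edgeMeasure e)
  isWeakDeriv : ∀ e, IsWeakDeriv (G.dom e) (val e) (der e)
  val_src : ∀ i, val (Sum.inl i) 0 = vert (G.src i)
  val_tgt : ∀ i, val (Sum.inl i) (G.len i) = vert (G.tgt i)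
  val_base : ∀ x, val (Sum.inr x) 0 = vert (G.base x)

/-- The mass `‖Ψ‖²`. -/
def mass {V I X : Type*} [Fintype I] [Fintype X] (G : MetricGraph V I X) (Ψ : G.H1) : ℝ :=
  G.normPow 2 Ψ.val

/-- The quadratic form `E^lin[Ψ] = ‖Ψ'‖² + (Ψ, WΨ) + ∑_v α_v |Ψ(v)|²`. -/
def linEnergy {V I X : Type*} [Fintype V] [Fintype I] [Fintype X] (G : MetricGraph V I X)
    (α : V → ℝ) (W : I ⊕ X → ℝ → ℝ) (Ψ : G.H1) : ℝ :=
  G.normPow 2 Ψ.der + ∑ e, ∫ x, W e x * ‖Ψ.val e x‖ ^ 2 ∂(G.edgeMeasure e)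
    + ∑ v, α v * ‖Ψ.vert v‖ ^ 2

/-- The NLS energy `E[Ψ] = E^lin[Ψ] - ‖Ψ‖_{2μ+2}^{2μ+2} / (μ+1)`. -/
def energy {V I X : Type*} [Fintype V] [Fintype I] [Fintype X] (G : MetricGraph V I X)
    (α : V → ℝ) (W : I ⊕ X → ℝ → ℝ) (μ : ℝ) (Ψ : G.H1) : ℝ :=
  G.linEnergy α W Ψ - 1 / (μ + 1) * G.normPow (2 * μ + 2) Ψ.val

/-- `-ν_μ(m)`, the infimum of the energy at mass `m`; it may be `-∞`. -/
def energyInf {V I X : Type*} [Fintype V] [Fintype I] [Fintype X] (G : MetricGraph V I X)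
    (α : V → ℝ) (W : I ⊕ X → ℝ → ℝ) (μ m : ℝ) : EReal :=
  ⨅ Ψ : {Ψ : G.H1 // G.mass Ψ = m}, (G.energy α W μ Ψ.1 : EReal)

/-- A ground state of mass `m`: a function in `H¹(𝒢)` of mass `m` at which the infimum of the
energy at mass `m` is attained. -/
def IsGroundState {V I X : Type*} [Fintype V] [Fintype I] [Fintype X] (G : MetricGraph V I X)
    (α : V → ℝ) (W : I ⊕ X → ℝ → ℝ) (μ m : ℝ) (Ψ : G.H1) : Prop :=
  G.mass Ψ = m ∧ (G.energy α W μ Ψ : EReal) = G.energyInf α W μ m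

/-- `E₀`, where `-E₀` is the infimum of `E^lin` at mass `1`. -/
def E0 {V I X : Type*} [Fintype V] [Fintype I] [Fintype X] (G : MetricGraph V I X)
    (α : V → ℝ) (W : I ⊕ X → ℝ → ℝ) : EReal :=
  -⨅ Ψ : {Ψ : G.H1 // G.mass Ψ = 1}, (G.linEnergy α W Ψ.1 : EReal)

/-- The assumption on the potential: `W = W₊ - W₋` with `W₊, W₋ ≥ 0`, `W₊ ∈ L¹(𝒢) + L^∞(𝒢)`, and
`W₋ ∈ L^r(𝒢)` for some `r ∈ [1, 1 + 1/μ]`. -/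
def IsAdmissiblePotential {V I X : Type*} (G : MetricGraph V I X) (μ : ℝ)
    (W : I ⊕ X → ℝ → ℝ) : Prop :=
  ∃ Wp Wm : I ⊕ X → ℝ → ℝ,
    (∀ e, ∀ᵐ x ∂(G.edgeMeasure e), W e x = Wp e x - Wm e x ∧ 0 ≤ Wp e x ∧ 0 ≤ Wm e x) ∧
    (∃ W1 Winf : I ⊕ X → ℝ → ℝ, (∀ e, Wp e = W1 e + Winf e) ∧
      (∀ e, MeasureTheory.MemLp (W1 e) 1 (G.edgeMeasure e)) ∧
      (∀ e, MeasureTheory.MemLp (Winf e) ⊤ (G.edgeMeasure e))) ∧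
    ∃ r : ℝ, 1 ≤ r ∧ r ≤ 1 + 1 / μ ∧
      ∀ e, MeasureTheory.MemLp (Wm e) (ENNReal.ofReal r) (G.edgeMeasure e)

/-- The best constant `K_{6,2}(𝒢)` in the Gagliardo–Nirenberg inequality
`‖Ψ‖_6 ≤ K ‖Ψ'‖^{1/3} ‖Ψ‖^{2/3}` on `H¹(𝒢)`. -/
def K62 {V I X : Type*} [Fintype I] [Fintype X] (G : MetricGraph V I X) : ℝ :=
  sInf {K : ℝ | 0 ≤ K ∧ ∀ Ψ : G.H1,
    G.lpNorm 6 Ψ.val ≤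
      K * G.lpNorm 2 Ψ.der ^ (1 / 3 : ℝ) * G.lpNorm 2 Ψ.val ^ (2 / 3 : ℝ)}

/-- The constant `γ_μ`, `0 < μ < 2`. The infimum of the free energy
`‖ψ'‖² - ‖ψ‖_{2μ+2}^{2μ+2} / (μ+1)` over the `ψ ∈ H¹(ℝ)` of mass `m` is
`-γ_μ m^{1 + 2μ/(2-μ)}`. -/
def gammaConst (μ : ℝ) : ℝ :=
  (2 - μ) / (2 + μ) *
    (2 * ((μ + 1) ^ (1 / μ) / μ) * ∫ t in (0 : ℝ)..1, (1 - t ^ 2) ^ (1 / μ - 1)) ^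
      (-(2 * μ / (2 - μ)))

/-- The threshold mass `m*_μ`: the first value in the subcritical case `0 < μ < 2`, the second in
the critical case `μ = 2`. -/
def massThreshold {V I X : Type*} [Fintype V] [Fintype I] [Fintype X] (G : MetricGraph V I X)
    (α : V → ℝ) (W : I ⊕ X → ℝ → ℝ) (μ : ℝ) : ℝ :=
  if μ < 2 then ((G.E0 α W).toReal / gammaConst μ) ^ (1 / μ - 1 / 2)
  else √3 / G.K62 ^ 3

end MetricGraph

end

/-! The proof is the direct method, with a single weak limit. A minimising sequence of mass m is
bounded in H¹ (`exists_kinetic_le`): for μ < 2 the supremum bound `exists_norm_sq_le` makes the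
nonlinear term grow like a power of ‖Ψ'‖ smaller than 2, and for μ = 2 the mass is so small that the
constant K_{6,2} leaves a positive fraction of the kinetic energy. A subsequence u_n then converges
pointwise to some Ψ of mass M ≤ m, with weakly convergent derivatives (`exists_tendstoWeakly`).

What must be excluded is mass escaping along the external edges. The energy splits as E[u_n] ≥ E[Ψ]
+ F[u_n - Ψ] - o(1), where F keeps only the kinetic and the nonlinear term
(`TendstoWeakly.exists_energy_ge`). The difference u_n - Ψ tends to zero pointwise, so it leaves the
compact core, and on the half-lines F is at least -E' times the mass for some E' < E₀; this is what
m < m* provides (`exists_free_energy_ge`). Hence E[Ψ] - E'(m - M) ≤ -ν(m). Scaling Ψ up to mass m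
gives E[Ψ] ≥ -(M/m) ν(m), because the nonlinear term is focusing, and rescaled near-minimisers of
E^lin give -ν(m) ≤ -m E₀. Together (m - M)(E₀ - E') ≤ 0, so M = m and Ψ is a minimiser.

The half-line estimate for μ < 2 needs no rearrangement. Let c be the frequency of the soliton whose
amplitude is sup |f|. Completing the square bounds |f'|² + c|f|² - |f|^{2μ+2}/(μ+1) from below by
the variation of a fixed function, the action, along |f|. Going up from the endpoint to the supremum
and down to zero at infinity collects the action of a whole soliton, up to a term in f(0)
(`H1.exists_action_le`). That action is an explicit power of c, and Young's inequality in c produces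
exactly γ_μ. -/

namespace MetricGraph
-- Weak derivatives on an interval: fundamental theorem and chain rule for the modulus.
section OneDimensional

open MeasureTheory Set Filter Topology intervalIntegral

/-- Such points, 0 and 1 included, are global extrema: the minimum 0 is attained on the left, the
maximum 1 on the right. -/
theorem deriv_smoothTransition_eq_zero {t : ℝ} (ht : t ∉ Ioo (0 : ℝ) 1) :
    deriv Real.smoothTransition t = 0 := by
  by_cases h0 : t ≤ 0
  · apply IsLocalMin.deriv_eq_zero
    filter_upwards with y
    rw [Real.smoothTransition.zero_of_nonpos h0]
    exact Real.smoothTransition.nonneg y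
  · have h1 : 1 ≤ t := by
      by_contra h
      exact ht ⟨not_le.1 h0, not_le.1 h⟩
    apply IsLocalMax.deriv_eq_zero
    filter_upwards with y
    rw [Real.smoothTransition.one_of_one_le h1]
    exact Real.smoothTransition.le_one y

theorem continuous_deriv_smoothTransition : Continuous (deriv Real.smoothTransition) :=
  (Real.smoothTransition.contDiff (n := 1)).continuous_deriv (le_refl _)

theorem integral_deriv_smoothTransition :
    ∫ t in (0 : ℝ)..1, deriv Real.smoothTransition t = 1 := by
  rw [integral_deriv_eq_sub]
  · simp
  · intro x _
    exact (Real.smoothTransition.contDiff (n := 1)).differentiable (by norm_num) x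
  · exact continuous_deriv_smoothTransition.intervalIntegrable _ _

/-- Averages against a rescaled smooth transition become point evaluations. -/
theorem tendsto_integral_deriv_smoothTransition {F : ℝ → ℂ} (hF : Continuous F) (c d : ℝ) :
    Tendsto (fun δ : ℝ => ∫ x, ((deriv Real.smoothTransition ((x - c) / δ + d) / δ : ℝ) : ℂ) * F x)
      (𝓝[>] 0) (𝓝 (F c)) := by
  have key : ∀ δ : ℝ, 0 < δ →
      ∫ x, ((deriv Real.smoothTransition ((x - c) / δ + d) / δ : ℝ) : ℂ) * F x
        = ∫ t in (0 : ℝ)..1, ((deriv Real.smoothTransition t : ℝ) : ℂ) * F (c + δ * (t - d)) := by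
    intro δ hδ
    set h : ℝ → ℂ := fun t => ((deriv Real.smoothTransition t : ℝ) : ℂ) * F (c + δ * (t - d))
      with hh
    have e1 : ∀ x, ((deriv Real.smoothTransition ((x - c) / δ + d) / δ : ℝ) : ℂ) * F x
        = (δ : ℂ)⁻¹ * h (((x - (c - δ * d)) / δ)) := by
      intro x
      have : (x - (c - δ * d)) / δ = (x - c) / δ + d := by field_simp; ring
      simp only [hh, this]
      have : c + δ * ((x - c) / δ + d - d) = x := by field_simp; ring
      rw [this]
      push_cast
      ring
    simp_rw [e1]
    rw [MeasureTheory.integral_const_mul]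
    rw [integral_sub_right_eq_self (fun x => h (x / δ)) (c - δ * d), Measure.integral_comp_div]
    rw [abs_of_pos hδ, integral_of_le zero_le_one,
      setIntegral_eq_integral_of_forall_compl_eq_zero]
    · rw [Complex.real_smul, ← mul_assoc, inv_mul_cancel₀, one_mul]
      exact_mod_cast hδ.ne'
    · intro x hx
      change ((deriv Real.smoothTransition x : ℝ) : ℂ) * F (c + δ * (x - d)) = 0
      rw [deriv_smoothTransition_eq_zero (fun hx' => hx ⟨hx'.1, hx'.2.le⟩)]
      simp
  -- After the substitution the integral makes sense at δ = 0 as well and depends continuously on δ,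
  -- so the limit is its value there.
  have hcont : Continuous fun δ : ℝ =>
      ∫ t in (0 : ℝ)..1, ((deriv Real.smoothTransition t : ℝ) : ℂ) * F (c + δ * (t - d)) := by
    apply continuous_parametric_intervalIntegral_of_continuous'
    have := continuous_deriv_smoothTransition
    simp only [Function.uncurry_def]
    fun_prop
  have h0 := (hcont.tendsto 0).mono_left (nhdsWithin_le_nhds (s := Ioi 0))
  have e0 : ∫ t in (0 : ℝ)..1, ((deriv Real.smoothTransition t : ℝ) : ℂ) * F (c + (0 : ℝ) * (t - d))
      = F c := by
    simp_rw [zero_mul, add_zero]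
    rw [intervalIntegral.integral_mul_const, intervalIntegral.integral_ofReal,
      integral_deriv_smoothTransition]
    simp
  rw [e0] at h0
  refine h0.congr' ?_
  filter_upwards [self_mem_nhdsWithin] with δ hδ
  exact (key δ hδ).symm

/-- Test with smooth trapezoids increasing to the indicator of `(a, b)`: their derivatives are
approximate unit masses, positive at `a` and negative at `b`. -/
theorem isWeakDeriv_integral_eq_sub {s : Set ℝ} {f g : ℝ → ℂ} (hw : IsWeakDeriv s f g) {a b : ℝ}
    (hab : a ≤ b) (hs : Icc a b ⊆ s) (hf : ContinuousOn f (Icc a b))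
    (hg : IntegrableOn g (Icc a b)) : ∫ x in a..b, g x = f b - f a := by
  rcases hab.eq_or_lt with rfl | hlt
  · simp
  set F : ℝ → ℂ := IccExtend hab (domRestrict (Icc a b) f) with hFdef
  have hF : Continuous F := (continuousOn_iff_continuous_domRestrict.1 hf).Icc_extend'
  have hFf : ∀ x ∈ Icc a b, F x = f x := fun x hx => by
    rw [hFdef, IccExtend_of_mem _ _ hx]; rfl
  set θ := Real.smoothTransition
  -- The shifts place the ramps on `[a + δ, a + 2δ]` and `[b - 2δ, b - δ]`, so the support stays
  -- strictly inside; `4δ ≤ b - a` keeps the ramps in order.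
  set φ : ℝ → ℝ → ℝ := fun δ x => θ ((x - a) / δ + -1) - θ ((x - b) / δ + 2) with hφ
  have hφs : ∀ δ, ContDiff ℝ ∞ (φ δ) := by
    intro δ
    have hθ : ContDiff ℝ ∞ θ := Real.smoothTransition.contDiff
    simp only [hφ]
    apply ContDiff.sub
    · exact hθ.comp (by fun_prop)
    · exact hθ.comp (by fun_prop)
  have hφd : ∀ δ x, deriv (φ δ) x =
      deriv θ ((x - a) / δ + -1) / δ - deriv θ ((x - b) / δ + 2) / δ := by
    intro δ x
    have hθ : ∀ y, HasDerivAt θ (deriv θ y) y := fun y =>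
      ((Real.smoothTransition.contDiff (n := 1)).differentiable (by norm_num) y).hasDerivAt
    have l1 : HasDerivAt (fun x : ℝ => (x - a) / δ + -1) (1 / δ) x :=
      (((hasDerivAt_id x).sub_const a).div_const δ).add_const _
    have l2 : HasDerivAt (fun x : ℝ => (x - b) / δ + 2) (1 / δ) x :=
      (((hasDerivAt_id x).sub_const b).div_const δ).add_const _
    have := ((hθ _).comp x l1).sub ((hθ _).comp x l2)
    simp only [mul_one_div] at this
    exact this.deriv
  have hzero : ∀ δ, 0 < δ → 4 * δ ≤ b - a → ∀ x, x ∉ Icc (a + δ) (b - δ) → φ δ x = 0 := by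
    intro δ hδ h4 x hx
    simp only [mem_Icc, not_and_or, not_le] at hx
    rcases hx with hx | hx
    · have h1 : (x - a) / δ + -1 ≤ 0 := by
        have : (x - a) / δ ≤ 1 := by rw [div_le_one hδ]; linarith
        linarith
      have h2 : (x - b) / δ + 2 ≤ 0 := by
        have : (x - b) / δ ≤ -2 := by rw [div_le_iff₀ hδ]; linarith
        linarith
      simp only [hφ, θ, Real.smoothTransition.zero_of_nonpos h1,
        Real.smoothTransition.zero_of_nonpos h2, sub_zero]
    · have h1 : 1 ≤ (x - a) / δ + -1 := by
        have : 2 ≤ (x - a) / δ := by rw [le_div_iff₀ hδ]; linarith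
        linarith
      have h2 : 1 ≤ (x - b) / δ + 2 := by
        have : -1 ≤ (x - b) / δ := by rw [le_div_iff₀ hδ]; linarith
        linarith
      simp only [hφ, θ, Real.smoothTransition.one_of_one_le h1,
        Real.smoothTransition.one_of_one_le h2, sub_self]
  have hsupp : ∀ δ, 0 < δ → 4 * δ ≤ b - a → tsupport (φ δ) ⊆ Icc (a + δ) (b - δ) := by
    intro δ hδ h4
    apply closure_minimal _ isClosed_Icc
    intro x hx
    by_contra h
    exact hx (hzero δ hδ h4 x h)
  have hint : Ioo a b ⊆ interior s := by
    rw [← interior_Icc]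
    exact interior_mono hs
  have hsub : ∀ δ, 0 < δ → Icc (a + δ) (b - δ) ⊆ Ioo a b := fun δ hδ x hx =>
    ⟨by linarith [hx.1], by linarith [hx.2]⟩
  have hsmall : ∀ᶠ δ : ℝ in 𝓝[>] 0, 0 < δ ∧ 4 * δ ≤ b - a := by
    filter_upwards [self_mem_nhdsWithin, Ioo_mem_nhdsGT (show (0 : ℝ) < (b - a) / 4 by linarith)]
      with δ h1 h2
    exact ⟨h1, by linarith [h2.2]⟩
  have hlhs : Tendsto (fun δ => ∫ x in s, ((deriv (φ δ) x : ℝ) : ℂ) * f x) (𝓝[>] 0)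
      (𝓝 (F a - F b)) := by
    refine ((tendsto_integral_deriv_smoothTransition hF a (-1)).sub
      (tendsto_integral_deriv_smoothTransition hF b 2)).congr' ?_
    filter_upwards [hsmall] with δ hδ
    have hd0 : ∀ x, x ∉ Icc (a + δ) (b - δ) → deriv (φ δ) x = 0 := by
      intro x hx
      by_contra h
      exact hx (hsupp δ hδ.1 hδ.2 (support_deriv_subset h))
    have hI : ∀ c d, Integrable fun x => ((deriv θ ((x - c) / δ + d) / δ : ℝ) : ℂ) * F x := by
      intro c d
      apply Continuous.integrable_of_hasCompactSupport
      · have := continuous_deriv_smoothTransition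
        fun_prop
      · apply HasCompactSupport.of_support_subset_isCompact
          (isCompact_Icc (a := c - δ * d) (b := c + δ * (1 - d)))
        intro x hx
        have : (x - c) / δ + d ∈ Ioo (0 : ℝ) 1 := by
          by_contra h
          apply hx
          simp [θ, deriv_smoothTransition_eq_zero h]
        obtain ⟨h1, h2⟩ := this
        have h1' : -d * δ < x - c := by rw [← lt_div_iff₀ hδ.1]; linarith
        have h2' : x - c < (1 - d) * δ := by rw [← div_lt_iff₀ hδ.1]; linarith
        constructor <;> linarith
    rw [← MeasureTheory.integral_sub (hI _ _) (hI _ _),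
      setIntegral_eq_integral_of_forall_compl_eq_zero]
    · apply MeasureTheory.integral_congr_ae
      filter_upwards with x
      have : ((deriv (φ δ) x : ℝ) : ℂ) * f x = ((deriv (φ δ) x : ℝ) : ℂ) * F x := by
        by_cases hx : x ∈ Icc (a + δ) (b - δ)
        · rw [hFf x (Ioo_subset_Icc_self (hsub δ hδ.1 hx))]
        · simp [hd0 x hx]
      rw [this, hφd]
      push_cast
      ring
    · intro x hx
      rw [hd0 x, Complex.ofReal_zero, zero_mul]
      intro h
      exact hx (hs (Ioo_subset_Icc_self (hsub δ hδ.1 h)))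
  have hrhs : Tendsto (fun δ => -∫ x in s, (φ δ x : ℂ) * g x) (𝓝[>] 0)
      (𝓝 (-∫ x in a..b, g x)) := by
    apply Tendsto.neg
    rw [integral_of_le hab]
    have : Tendsto (fun δ => ∫ x in Ioc a b, (φ δ x : ℂ) * g x) (𝓝[>] 0)
        (𝓝 (∫ x in Ioc a b, g x)) := by
      have hgI := hg.mono_set Ioc_subset_Icc_self
      apply MeasureTheory.tendsto_integral_filter_of_dominated_convergence (fun x => ‖g x‖)
      · filter_upwards with δ
        exact (Complex.continuous_ofReal.comp (hφs δ).continuous).aestronglyMeasurable.mul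
          hgI.aestronglyMeasurable
      · filter_upwards with δ
        filter_upwards with x
        rw [norm_mul, Complex.norm_real]
        apply mul_le_of_le_one_left (norm_nonneg _)
        rw [Real.norm_eq_abs, abs_le]
        have a1 := Real.smoothTransition.nonneg ((x - a) / δ + -1)
        have a2 := Real.smoothTransition.nonneg ((x - b) / δ + 2)
        have a3 := Real.smoothTransition.le_one ((x - a) / δ + -1)
        have a4 := Real.smoothTransition.le_one ((x - b) / δ + 2)
        constructor <;> simp only [hφ, θ] <;> linarith
      · exact hgI.norm
      · have hb : ∀ᵐ x ∂(volume.restrict (Ioc a b)), x ≠ b :=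
          ae_restrict_of_ae (by simp [ae_iff, measure_singleton])
        filter_upwards [ae_restrict_mem measurableSet_Ioc, hb] with x hx hxb
        have hx2 : x < b := lt_of_le_of_ne hx.2 hxb
        apply tendsto_const_nhds.congr'
        filter_upwards [self_mem_nhdsWithin,
          Ioo_mem_nhdsGT (show (0 : ℝ) < (x - a) / 2 by linarith [hx.1]),
          Ioo_mem_nhdsGT (show (0 : ℝ) < (b - x) / 2 by linarith)] with δ hδ h1 h2
        have hδ' : 0 < δ := hδ
        have h1 : 1 ≤ (x - a) / δ + -1 := by
          have : 2 ≤ (x - a) / δ := by rw [le_div_iff₀ hδ']; linarith [h1.2]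
          linarith
        have h2 : (x - b) / δ + 2 ≤ 0 := by
          have : (x - b) / δ ≤ -2 := by rw [div_le_iff₀ hδ']; linarith [h2.2]
          linarith
        simp [hφ, θ, Real.smoothTransition.one_of_one_le h1,
          Real.smoothTransition.zero_of_nonpos h2]
    refine this.congr' ?_
    filter_upwards [hsmall] with δ hδ
    rw [setIntegral_eq_integral_of_forall_compl_eq_zero,
      setIntegral_eq_integral_of_forall_compl_eq_zero]
    · intro x hx
      rw [hzero δ hδ.1 hδ.2 x, Complex.ofReal_zero, zero_mul]
      intro h
      exact hx (hs (Ioo_subset_Icc_self (hsub δ hδ.1 h)))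
    · intro x hx
      rw [hzero δ hδ.1 hδ.2 x, Complex.ofReal_zero, zero_mul]
      intro h
      exact hx (Ioo_subset_Ioc_self (hsub δ hδ.1 h))
  have hEq : (fun δ => ∫ x in s, ((deriv (φ δ) x : ℝ) : ℂ) * f x) =ᶠ[𝓝[>] 0]
      fun δ => -∫ x in s, (φ δ x : ℂ) * g x := by
    filter_upwards [hsmall] with δ hδ
    apply hw (φ δ) (hφs δ)
    · exact HasCompactSupport.of_support_subset_isCompact isCompact_Icc
        (subset_closure.trans (hsupp δ hδ.1 hδ.2))
    · exact (hsupp δ hδ.1 hδ.2).trans ((hsub δ hδ.1).trans hint)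
  have := tendsto_nhds_unique (hlhs.congr' hEq) hrhs
  rw [hFf a (left_mem_Icc.2 hab), hFf b (right_mem_Icc.2 hab)] at this
  linear_combination this

/-- Absolute continuity only sees sums of increments over disjoint intervals, so it passes to any
function with dominated increments. -/
theorem AbsolutelyContinuousOnInterval.of_dist_le {X Y : Type*} [PseudoMetricSpace X]
    [PseudoMetricSpace Y] {h : ℝ → X} {p : ℝ → Y} {a b K : ℝ}
    (hp : AbsolutelyContinuousOnInterval p a b)
    (hle : ∀ x ∈ uIcc a b, ∀ y ∈ uIcc a b, dist (h x) (h y) ≤ K * dist (p x) (p y)) :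
    AbsolutelyContinuousOnInterval h a b := by
  unfold AbsolutelyContinuousOnInterval at hp ⊢
  apply squeeze_zero' ?_ ?_ (by simpa using hp.const_mul K)
  · exact Eventually.of_forall fun _ => Finset.sum_nonneg fun i hi => dist_nonneg
  rw [eventually_inf_principal]
  filter_upwards with ⟨n, J⟩ hnJ
  simp only [Finset.mul_sum]
  apply Finset.sum_le_sum
  intro i hi
  simp only [AbsolutelyContinuousOnInterval.disjWithin, mem_ofPred_eq] at hnJ
  exact hle _ (hnJ.left i hi).left _ (hnJ.left i hi).right

/-- The chain rule for `G ∘ ‖f‖` in integrated form, `f` being the primitive of `g`. -/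
theorem abs_comp_norm_sub_le {f g : ℝ → ℂ} {G G' : ℝ → ℝ} (hG : ∀ s, HasDerivAt G (G' s) s)
    (hG' : Continuous G') {a b : ℝ} (hab : a ≤ b) (hg : IntervalIntegrable g volume a b)
    (hfg : ∀ x ∈ Icc a b, ∀ y ∈ Icc a b, x ≤ y → ∫ t in x..y, g t = f y - f x) :
    |G ‖f b‖ - G ‖f a‖| ≤ ∫ x in a..b, |G' ‖f x‖| * ‖g x‖ := by
  have hsub : ∀ x ∈ Icc a b, ∀ y ∈ Icc a b, IntervalIntegrable g volume x y := by
    intro x hx y hy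
    exact hg.mono_set (by rw [uIcc_of_le hab]; exact uIcc_subset_Icc hx hy)
  -- The increments of `P` dominate those of `f`, hence those of `‖f‖` and, up to a constant, those
  -- of `G ∘ ‖f‖`.
  set P : ℝ → ℝ := fun x => ∫ t in a..x, ‖g t‖
  have hP : AbsolutelyContinuousOnInterval P a b :=
    hg.norm.absolutelyContinuousOnInterval_intervalIntegral (by simp)
  have hfP : ∀ x ∈ Icc a b, ∀ y ∈ Icc a b, dist (f x) (f y) ≤ dist (P x) (P y) := by
    have aux : ∀ x ∈ Icc a b, ∀ y ∈ Icc a b, x ≤ y → dist (f x) (f y) ≤ dist (P x) (P y) := by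
      intro x hx y hy hxy
      rw [dist_comm, dist_eq_norm, ← hfg x hx y hy hxy, dist_comm, Real.dist_eq]
      have ha : a ∈ Icc a b := left_mem_Icc.2 hab
      simp only [P]
      rw [integral_interval_sub_left (hsub a ha y hy).norm (hsub a ha x hx).norm]
      exact (intervalIntegral.norm_integral_le_integral_norm hxy).trans (le_abs_self _)
    intro x hx y hy
    rcases le_total x y with h | h
    · exact aux x hx y hy h
    · rw [dist_comm, dist_comm (P x)]
      exact aux y hy x hx h
  have hfc : ContinuousOn f (Icc a b) := by
    have hPc := hP.continuousOn
    rw [uIcc_of_le hab] at hPc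
    intro x hx
    rw [ContinuousWithinAt, tendsto_iff_dist_tendsto_zero]
    have := (tendsto_iff_dist_tendsto_zero.1 (hPc x hx))
    apply squeeze_zero' (Eventually.of_forall fun _ => dist_nonneg) _ this
    filter_upwards [self_mem_nhdsWithin] with y hy
    exact hfP y hy x hx
  -- `G` is only locally Lipschitz; boundedness of `f` confines the argument to `[0, M]`.
  obtain ⟨M, hM⟩ := isCompact_Icc.exists_bound_of_continuousOn hfc
  obtain ⟨K, hK⟩ := (isCompact_Icc (a := (0 : ℝ)) (b := M)).exists_bound_of_continuousOn
    hG'.continuousOn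
  have hGL : ∀ s ∈ Icc 0 M, ∀ t ∈ Icc 0 M, dist (G s) (G t) ≤ K * dist s t := by
    intro s hs t ht
    rw [dist_eq_norm, dist_eq_norm]
    exact (convex_Icc (0 : ℝ) M).norm_image_sub_le_of_norm_hasDerivWithin_le
      (fun x _ => (hG x).hasDerivWithinAt) hK ht hs
  have hnM : ∀ x ∈ Icc a b, ‖f x‖ ∈ Icc 0 M := fun x hx => ⟨norm_nonneg _, hM x hx⟩
  have hud : ∀ x ∈ uIcc a b, ∀ y ∈ uIcc a b, dist ‖f x‖ ‖f y‖ ≤ 1 * dist (P x) (P y) := by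
    rw [uIcc_of_le hab]
    intro x hx y hy
    rw [one_mul]
    exact (dist_norm_norm_le _ _).trans ((dist_eq_norm _ _).symm.le.trans (hfP x hx y hy))
  have hu : AbsolutelyContinuousOnInterval (fun x => ‖f x‖) a b :=
    AbsolutelyContinuousOnInterval.of_dist_le hP hud
  have hH : AbsolutelyContinuousOnInterval (fun x => G ‖f x‖) a b := by
    refine AbsolutelyContinuousOnInterval.of_dist_le (K := K) hu ?_
    rw [uIcc_of_le hab]
    intro x hx y hy
    exact hGL _ (hnM x hx) _ (hnM y hy)
  rw [← hH.integral_deriv_eq_sub]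
  refine (abs_integral_le_integral_abs hab).trans ?_
  have hRI : IntervalIntegrable (fun x => |G' ‖f x‖| * ‖g x‖) volume a b := by
    apply hg.norm.continuousOn_mul
    rw [uIcc_of_le hab]
    exact (hG'.comp_continuousOn hfc.norm).abs
  apply integral_mono_ae_restrict hab hH.intervalIntegrable_deriv.abs hRI
  have h₁ : ∀ᵐ x ∂(volume : Measure ℝ), x ≠ a := by simp [ae_iff, measure_singleton]
  have h₂ : ∀ᵐ x ∂(volume : Measure ℝ), x ≠ b := by simp [ae_iff, measure_singleton]
  have hgd := hg.ae_hasDerivAt_integral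
  have hudiff := hu.ae_differentiableAt
  rw [uIcc_of_le hab] at hgd hudiff
  rw [EventuallyLE, ae_restrict_iff' measurableSet_Icc]
  filter_upwards [h₁, h₂, hgd, hudiff] with x hxa hxb hxg hxu hx
  have hx' : Icc a b ∈ 𝓝 x := Icc_mem_nhds (lt_of_le_of_ne hx.1 hxa.symm) (lt_of_le_of_ne hx.2 hxb)
  have hu' := (hxu hx).hasDerivAt
  have hf' : HasDerivAt f (g x) x := by
    have := (hxg hx a (left_mem_Icc.2 hab)).const_add (f a)
    refine this.congr_of_eventuallyEq ?_
    filter_upwards [hx'] with y hy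
    rw [hfg a (left_mem_Icc.2 hab) y hy hy.1]
    ring
  -- Comparing difference quotients avoids differentiating the norm, which fails at zeros of `f`;
  -- that `‖f‖` is differentiable here comes from absolute continuity.
  have hle : |deriv (fun x => ‖f x‖) x| ≤ ‖g x‖ := by
    have t1 := (hasDerivAt_iff_tendsto_slope.1 hu').norm
    have t2 := (hasDerivAt_iff_tendsto_slope.1 hf').norm
    rw [← Real.norm_eq_abs]
    refine le_of_tendsto_of_tendsto' t1 t2 fun y => ?_
    simp only [slope, vsub_eq_sub, norm_smul]
    gcongr
    exact abs_norm_sub_norm_le _ _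
  have := ((hG ‖f x‖).comp x hu').deriv
  simp only [Function.comp_def] at this
  rw [this, abs_mul]
  gcongr

end OneDimensional
end MetricGraph

/-! ### Supremum bounds on the graph. -/

namespace MetricGraph
section Sobolev

open MeasureTheory Set Filter Topology

variable {V I X : Type*} {G : MetricGraph V I X}

theorem measurableSet_dom (G : MetricGraph V I X) (e : I ⊕ X) : MeasurableSet (G.dom e) := by
  cases e
  · exact measurableSet_Icc
  · exact measurableSet_Ici

theorem zero_mem_dom (G : MetricGraph V I X) (e : I ⊕ X) : (0 : ℝ) ∈ G.dom e := by
  cases e with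
  | inl i => exact ⟨le_rfl, (G.len_pos i).le⟩
  | inr x => exact le_refl (0 : ℝ)

theorem nonneg_of_mem_dom {e : I ⊕ X} {x : ℝ} (hx : x ∈ G.dom e) : 0 ≤ x := by
  cases e with
  | inl i => exact hx.1
  | inr _ => exact hx

theorem Icc_subset_dom {e : I ⊕ X} {x y : ℝ} (hx : x ∈ G.dom e) (hy : y ∈ G.dom e) :
    Icc x y ⊆ G.dom e := by
  cases e with
  | inl i => exact fun z hz => ⟨hx.1.trans hz.1, hz.2.trans hy.2⟩
  | inr _ => exact fun z hz => le_trans (show (0 : ℝ) ≤ x from hx) hz.1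

instance (G : MetricGraph V I X) (e : I ⊕ X) : SigmaFinite (G.edgeMeasure e) := by
  unfold edgeMeasure; infer_instance

theorem ae_mem_dom (G : MetricGraph V I X) (e : I ⊕ X) : ∀ᵐ x ∂(G.edgeMeasure e), x ∈ G.dom e :=
  ae_restrict_mem (G.measurableSet_dom e)

theorem integrableOn_Icc_of_memLp {e : I ⊕ X} {f : ℝ → ℂ} (hf : MemLp f 2 (G.edgeMeasure e))
    {x y : ℝ} (hx : x ∈ G.dom e) (hy : y ∈ G.dom e) : IntegrableOn f (Icc x y) := by
  have : MemLp f 2 (volume.restrict (Icc x y)) :=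
    hf.mono_measure (Measure.restrict_mono (Icc_subset_dom hx hy) le_rfl)
  exact this.integrable one_le_two

theorem integrable_norm_mul_norm {ν : Measure ℝ} {f g : ℝ → ℂ} (hf : MemLp f 2 ν)
    (hg : MemLp g 2 ν) : Integrable (fun x => ‖f x‖ * ‖g x‖) ν :=
  hf.norm.integrable_mul hg.norm

theorem integrable_norm_rpow_two {ν : Measure ℝ} {f : ℝ → ℂ} (hf : MemLp f 2 ν) :
    Integrable (fun x => ‖f x‖ ^ (2 : ℝ)) ν := by
  have := hf.integrable_norm_rpow (by norm_num) (by norm_num)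
  simpa using this

theorem integrable_norm_sq {ν : Measure ℝ} {f : ℝ → ℂ} (hf : MemLp f 2 ν) :
    Integrable (fun x => ‖f x‖ ^ 2) ν := by
  simpa using integrable_norm_rpow_two hf

theorem H1.integral_der (Ψ : G.H1) {e : I ⊕ X} {x y : ℝ} (hx : x ∈ G.dom e) (hy : y ∈ G.dom e)
    (hxy : x ≤ y) : ∫ t in x..y, Ψ.der e t = Ψ.val e y - Ψ.val e x :=
  isWeakDeriv_integral_eq_sub (Ψ.isWeakDeriv e) hxy (Icc_subset_dom hx hy)
    ((Ψ.continuousOn e).mono (Icc_subset_dom hx hy))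
    (integrableOn_Icc_of_memLp (Ψ.memLp_der e) hx hy)

theorem H1.abs_comp_norm_val_sub_le (Ψ : G.H1) {e : I ⊕ X} {G₁ G₁' : ℝ → ℝ}
    (hG : ∀ s, HasDerivAt G₁ (G₁' s) s) (hG' : Continuous G₁') {x y : ℝ} (hx : x ∈ G.dom e)
    (hy : y ∈ G.dom e) (hxy : x ≤ y) :
    |G₁ ‖Ψ.val e y‖ - G₁ ‖Ψ.val e x‖| ≤ ∫ t in x..y, |G₁' ‖Ψ.val e t‖| * ‖Ψ.der e t‖ := by
  apply abs_comp_norm_sub_le hG hG' hxy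
  · rw [intervalIntegrable_iff_integrableOn_Icc_of_le hxy]
    exact integrableOn_Icc_of_memLp (Ψ.memLp_der e) hx hy
  · intro a ha b hb hab
    exact Ψ.integral_der (Icc_subset_dom hx hy ha) (Icc_subset_dom hx hy hb) hab

/-- Otherwise a positive constant would be integrable near infinity. This replaces decay of H¹
functions at infinity: arbitrarily remote points with small value suffice. -/
theorem exists_norm_lt_of_memLp {f : ℝ → ℂ} (hf : MemLp f 2 (volume.restrict (Ici (0 : ℝ))))
    {ε : ℝ} (hε : 0 < ε) (R : ℝ) : ∃ x, R ≤ x ∧ 0 ≤ x ∧ ‖f x‖ < ε := by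
  by_contra! h
  have h1 : MemLp f 2 (volume.restrict (Ici (max R 0))) :=
    hf.mono_measure (Measure.restrict_mono (Ici_subset_Ici.2 (le_max_right _ _)) le_rfl)
  have h2 := integrable_norm_sq h1
  have h3 : IntegrableOn (fun _ : ℝ => ε ^ 2) (Ici (max R 0)) := by
    refine h2.mono' aestronglyMeasurable_const ?_
    filter_upwards [ae_restrict_mem measurableSet_Ici] with x hx
    have := h x ((le_max_left _ _).trans hx) ((le_max_right _ _).trans hx)
    rw [Real.norm_of_nonneg (by positivity)]
    gcongr
  rw [integrableOn_const_iff (by simp)] at h3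
  simp only [Real.volume_Ici, lt_self_iff_false, or_false] at h3
  simp [hε.ne'] at h3

variable [Fintype I] [Fintype X]

/-- The kinetic energy `‖Ψ'‖²`. -/
noncomputable def kinetic (G : MetricGraph V I X) (Ψ : G.H1) : ℝ := G.normPow 2 Ψ.der

theorem integral_norm_rpow_nonneg (ν : Measure ℝ) (p : ℝ) (f : ℝ → ℂ) :
    0 ≤ ∫ x, ‖f x‖ ^ p ∂ν := integral_nonneg fun _ => by positivity

theorem normPow_nonneg (G : MetricGraph V I X) (p : ℝ) (ψ : I ⊕ X → ℝ → ℂ) :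
    0 ≤ G.normPow p ψ := Finset.sum_nonneg fun _ _ => integral_norm_rpow_nonneg _ _ _

theorem integral_le_normPow (G : MetricGraph V I X) (p : ℝ) (ψ : I ⊕ X → ℝ → ℂ) (e : I ⊕ X) :
    ∫ x, ‖ψ e x‖ ^ p ∂(G.edgeMeasure e) ≤ G.normPow p ψ :=
  Finset.single_le_sum (f := fun e => ∫ x, ‖ψ e x‖ ^ p ∂(G.edgeMeasure e))
    (fun _ _ => integral_norm_rpow_nonneg _ _ _) (Finset.mem_univ e)

theorem mass_nonneg (Ψ : G.H1) : 0 ≤ G.mass Ψ := G.normPow_nonneg _ _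

theorem kinetic_nonneg (Ψ : G.H1) : 0 ≤ G.kinetic Ψ := G.normPow_nonneg _ _

theorem normPow_two (G : MetricGraph V I X) (ψ : I ⊕ X → ℝ → ℂ) :
    G.normPow 2 ψ = ∑ e, ∫ x, ‖ψ e x‖ ^ 2 ∂(G.edgeMeasure e) := by
  simp [normPow]

theorem integral_mul_norm_le_sqrt {ν : Measure ℝ} {f g : ℝ → ℂ} (hf : MemLp f 2 ν)
    (hg : MemLp g 2 ν) : ∫ x, ‖f x‖ * ‖g x‖ ∂ν ≤
      √(∫ x, ‖f x‖ ^ (2 : ℝ) ∂ν) * √(∫ x, ‖g x‖ ^ (2 : ℝ) ∂ν) := by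
  rw [Real.sqrt_eq_rpow, Real.sqrt_eq_rpow]
  exact integral_mul_norm_le_Lp_mul_Lq Real.HolderConjugate.two_two (by simpa using hf)
    (by simpa using hg)

theorem H1.integral_val_mul_der_le (Ψ : G.H1) (e : I ⊕ X) :
    ∫ x, ‖Ψ.val e x‖ * ‖Ψ.der e x‖ ∂(G.edgeMeasure e) ≤ √(G.mass Ψ) * √(G.kinetic Ψ) := by
  refine (integral_mul_norm_le_sqrt (Ψ.memLp_val e) (Ψ.memLp_der e)).trans ?_
  gcongr
  · exact G.integral_le_normPow _ _ _
  · exact G.integral_le_normPow _ _ _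

/-- The variation of `‖Ψ‖²` along an edge is at most the integral of `2‖Ψ‖‖Ψ'‖`, then
Cauchy–Schwarz. The constant does not depend on the length of the edge. -/
theorem H1.norm_sq_val_le_add (Ψ : G.H1) {e : I ⊕ X} {x y : ℝ} (hx : x ∈ G.dom e)
    (hy : y ∈ G.dom e) :
    ‖Ψ.val e x‖ ^ 2 ≤ ‖Ψ.val e y‖ ^ 2 + 2 * (√(G.mass Ψ) * √(G.kinetic Ψ)) := by
  have aux : ∀ x ∈ G.dom e, ∀ y ∈ G.dom e, x ≤ y →
      |‖Ψ.val e y‖ ^ 2 - ‖Ψ.val e x‖ ^ 2| ≤ 2 * (√(G.mass Ψ) * √(G.kinetic Ψ)) := by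
    intro x hx y hy hxy
    have hd : ∀ s : ℝ, HasDerivAt (fun s : ℝ => s ^ 2) (2 * s) s := fun s => by
      simpa using hasDerivAt_pow 2 s
    refine (Ψ.abs_comp_norm_val_sub_le hd (by fun_prop) hx hy hxy).trans ?_
    have e1 : ∀ t, |2 * ‖Ψ.val e t‖| * ‖Ψ.der e t‖ = 2 * (‖Ψ.val e t‖ * ‖Ψ.der e t‖) := by
      intro t
      rw [abs_of_nonneg (by positivity), mul_assoc]
    simp_rw [e1]
    rw [intervalIntegral.integral_const_mul, intervalIntegral.integral_of_le hxy]
    gcongr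
    refine le_trans ?_ (Ψ.integral_val_mul_der_le e)
    refine setIntegral_mono_set
      (integrable_norm_mul_norm (Ψ.memLp_val e) (Ψ.memLp_der e)) ?_ ?_
    · filter_upwards with t
      positivity
    · exact (Ioc_subset_Icc_self.trans (Icc_subset_dom hx hy)).eventuallyLE
  rcases le_total x y with h | h
  · linarith [(abs_le.1 (aux x hx y hy h)).1]
  · linarith [(abs_le.1 (aux y hy x hx h)).2]

theorem H1.norm_sq_val_external_le (Ψ : G.H1) (e : X) {x : ℝ} (hx : 0 ≤ x) :
    ‖Ψ.val (Sum.inr e) x‖ ^ 2 ≤ 2 * (√(G.mass Ψ) * √(G.kinetic Ψ)) := by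
  apply le_of_forall_pos_le_add
  intro ε hε
  obtain ⟨y, -, hy, hlt⟩ := exists_norm_lt_of_memLp (Ψ.memLp_val (Sum.inr e))
    (Real.sqrt_pos.2 hε) 0
  have h1 := Ψ.norm_sq_val_le_add (e := Sum.inr e) (x := x) (y := y) hx hy
  have h2 : ‖Ψ.val (Sum.inr e) y‖ ^ 2 ≤ ε := by
    rw [← Real.sq_sqrt hε.le]
    gcongr
  linarith

/-- The Gagliardo–Nirenberg inequality for the supremum on a connected graph with an external
edge. -/
theorem exists_norm_sq_le [Fintype V] [Nonempty X] (hG : G.Connected) : ∃ C : ℝ, 0 ≤ C ∧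
    ∀ Ψ : G.H1, (∀ v, ‖Ψ.vert v‖ ^ 2 ≤ C * (√(G.mass Ψ) * √(G.kinetic Ψ))) ∧
      ∀ e, ∀ x ∈ G.dom e, ‖Ψ.val e x‖ ^ 2 ≤ C * (√(G.mass Ψ) * √(G.kinetic Ψ)) := by
  obtain ⟨x₀⟩ := ‹Nonempty X›
  have hv : ∀ v, ∃ C : ℝ, 0 ≤ C ∧ ∀ Ψ : G.H1,
      ‖Ψ.vert v‖ ^ 2 ≤ C * (√(G.mass Ψ) * √(G.kinetic Ψ)) := by
    intro v
    have hr := hG.preconnected (G.base x₀) v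
    rw [SimpleGraph.reachable_iff_reflTransGen] at hr
    -- Walk from the foot of an external edge, where the value is controlled by decay, along a chain
    -- of internal edges; each edge adds 2 to the constant.
    induction hr with
    | refl =>
      refine ⟨2, zero_le_two, fun Ψ => ?_⟩
      rw [← Ψ.val_base]
      exact Ψ.norm_sq_val_external_le x₀ le_rfl
    | tail _ hadj ih =>
      obtain ⟨C, hC, h⟩ := ih
      refine ⟨C + 2, by positivity, fun Ψ => ?_⟩
      rw [SimpleGraph.fromRel_adj] at hadj
      have hC := h Ψ
      rcases hadj.2 with ⟨i, h1, h2⟩ | ⟨i, h1, h2⟩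
      · have := Ψ.norm_sq_val_le_add (e := Sum.inl i) (x := G.len i) (y := 0)
          ⟨(G.len_pos i).le, le_rfl⟩ ⟨le_rfl, (G.len_pos i).le⟩
        rw [Ψ.val_src, Ψ.val_tgt, h1, h2] at this
        linarith
      · have := Ψ.norm_sq_val_le_add (e := Sum.inl i) (x := 0) (y := G.len i)
          ⟨le_rfl, (G.len_pos i).le⟩ ⟨(G.len_pos i).le, le_rfl⟩
        rw [Ψ.val_src, Ψ.val_tgt, h1, h2] at this
        linarith
  choose c hc h using hv
  have hcs : ∀ v, c v ≤ ∑ v, c v := fun v =>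
    Finset.single_le_sum (fun v _ => hc v) (Finset.mem_univ v)
  have hs : 0 ≤ ∑ v, c v := Finset.sum_nonneg fun v _ => hc v
  refine ⟨∑ v, c v + 2, by positivity, fun Ψ => ?_⟩
  have hp : 0 ≤ √(G.mass Ψ) * √(G.kinetic Ψ) := by positivity
  have h1 : ∀ v, ‖Ψ.vert v‖ ^ 2 ≤ (∑ v, c v) * (√(G.mass Ψ) * √(G.kinetic Ψ)) := fun v =>
    (h v Ψ).trans (mul_le_mul_of_nonneg_right (hcs v) hp)
  refine ⟨fun v => by linarith [h1 v], fun e x hx => ?_⟩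
  cases e with
  | inl i =>
    have := Ψ.norm_sq_val_le_add (e := Sum.inl i) hx (y := 0) (G.zero_mem_dom _)
    rw [Ψ.val_src] at this
    linarith [h1 (G.src i)]
  | inr e =>
    have := Ψ.norm_sq_val_external_le e (x := x) hx
    nlinarith

end Sobolev
end MetricGraph

/-! ### The potential as a form-bounded perturbation. -/

namespace MetricGraph
section Potential

open MeasureTheory Set Filter Topology

variable {V I X : Type*} {G : MetricGraph V I X}

theorem MemLp.exists_ae_norm_le {ν : Measure ℝ} {f : ℝ → ℝ} (hf : MemLp f ⊤ ν) :
    ∃ b : ℝ, 0 ≤ b ∧ ∀ᵐ x ∂ν, ‖f x‖ ≤ b := by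
  refine ⟨(eLpNormEssSup f ν).toReal, ENNReal.toReal_nonneg, ?_⟩
  have hlt : eLpNormEssSup f ν < ⊤ := by
    rw [← eLpNorm_exponent_top]
    exact hf.2
  filter_upwards [ae_le_eLpNormEssSup (f := f) (μ := ν)] with x hx
  have := ENNReal.toReal_mono hlt.ne hx
  simpa using this

/-- `w` is a nonnegative weight bounded by the sum of an integrable function and the constant
`b`. -/
structure IsWeight (ν : Measure ℝ) (w A : ℝ → ℝ) (b : ℝ) : Prop where
  aestronglyMeasurable : AEStronglyMeasurable w ν
  integrable : Integrable A ν
  nonneg : ∀ᵐ x ∂ν, 0 ≤ w x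
  bound_nonneg : ∀ x, 0 ≤ A x
  const_nonneg : 0 ≤ b
  le : ∀ᵐ x ∂ν, w x ≤ A x + b

/-- The bounded part of `W₋` can be made arbitrarily small, since a function in L^r exceeds any ε >
0 only by an integrable amount. For `W₊` no smallness is available, and none is needed: it acts
favourably in lower bounds. -/
theorem IsAdmissiblePotential.exists_isWeight [Fintype I] [Fintype X] {μ : ℝ}
    {W : I ⊕ X → ℝ → ℝ} (hW : G.IsAdmissiblePotential μ W) :
    ∃ Wp Wm : I ⊕ X → ℝ → ℝ,
      (∀ e, ∀ᵐ x ∂(G.edgeMeasure e), W e x = Wp e x - Wm e x) ∧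
      (∃ (A : I ⊕ X → ℝ → ℝ) (b : ℝ), ∀ e, IsWeight (G.edgeMeasure e) (Wp e) (A e) b) ∧
      ∀ ε > 0, ∃ A : I ⊕ X → ℝ → ℝ, ∀ e, IsWeight (G.edgeMeasure e) (Wm e) (A e) ε := by
  obtain ⟨Wp, Wm, hd, ⟨W1, Wi, hsum, hW1, hWi⟩, r, hr1, -, hm⟩ := hW
  refine ⟨Wp, Wm, fun e => (hd e).mono fun x hx => hx.1, ?_, ?_⟩
  · choose b hb0 hb using fun e => MemLp.exists_ae_norm_le (hWi e)
    refine ⟨fun e x => ‖W1 e x‖, ∑ e, b e, fun e => ⟨?_, ?_, ?_, ?_, ?_, ?_⟩⟩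
    · rw [hsum e]
      exact (hW1 e).aestronglyMeasurable.add (hWi e).aestronglyMeasurable
    · exact (memLp_one_iff_integrable.1 (hW1 e)).norm
    · exact (hd e).mono fun x hx => hx.2.1
    · exact fun x => norm_nonneg _
    · exact Finset.sum_nonneg fun e _ => hb0 e
    · filter_upwards [hb e] with x hx
      rw [hsum e]
      have h1 : b e ≤ ∑ e, b e :=
        Finset.single_le_sum (fun e _ => hb0 e) (Finset.mem_univ e)
      exact add_le_add (Real.le_norm_self _) ((Real.le_norm_self _).trans (hx.trans h1))
  · intro ε hε
    -- Where `Wm > ε`, write `Wm = Wm ^ (1 - r) * Wm ^ r` and use that `1 - r ≤ 0`.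
    refine ⟨fun e x => ε ^ (1 - r) * ‖Wm e x‖ ^ r, fun e => ⟨(hm e).aestronglyMeasurable, ?_,
      (hd e).mono fun x hx => hx.2.2, fun x => mul_nonneg (Real.rpow_nonneg hε.le _) (Real.rpow_nonneg (norm_nonneg _) _),
      hε.le, ?_⟩⟩
    · have hr0 : 0 ≤ r := by linarith
      have := (hm e).integrable_norm_rpow (by simp; linarith) (by simp)
      rw [ENNReal.toReal_ofReal hr0] at this
      exact this.const_mul _
    · filter_upwards [hd e] with x hx
      have h0 := hx.2.2
      rw [Real.norm_of_nonneg h0]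
      rcases le_or_gt (Wm e x) ε with h | h
      · have : 0 ≤ ε ^ (1 - r) * Wm e x ^ r := by positivity
        linarith
      · have hpos : 0 < Wm e x := hε.trans h
        have h2 : Wm e x ^ (1 - r) ≤ ε ^ (1 - r) :=
          Real.rpow_le_rpow_of_nonpos hε h.le (by linarith)
        have h3 : Wm e x = Wm e x ^ (1 - r) * Wm e x ^ r := by
          rw [← Real.rpow_add hpos]
          simp
        have h4 : Wm e x ^ (1 - r) * Wm e x ^ r ≤ ε ^ (1 - r) * Wm e x ^ r := by gcongr
        linarith

theorem IsWeight.integrable_mul {ν : Measure ℝ} {w A : ℝ → ℝ} {b : ℝ} (hw : IsWeight ν w A b)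
    {h : ℝ → ℝ} (hi : Integrable h ν) {B : ℝ} (hB : ∀ᵐ x ∂ν, ‖h x‖ ≤ B) :
    Integrable (fun x => w x * h x) ν := by
  refine ((hw.integrable.mul_const B).add (hi.norm.const_mul b)).mono'
    (hw.aestronglyMeasurable.mul hi.aestronglyMeasurable) ?_
  filter_upwards [hw.nonneg, hw.le, hB] with x h1 h2 h3
  rw [norm_mul, Real.norm_of_nonneg h1]
  have h4 : w x * ‖h x‖ ≤ (A x + b) * ‖h x‖ := by gcongr
  have h5 : A x * ‖h x‖ ≤ A x * B := mul_le_mul_of_nonneg_left h3 (hw.bound_nonneg x)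
  simp only [Pi.add_apply]
  linarith

theorem IsWeight.integral_mul_le {ν : Measure ℝ} {w A : ℝ → ℝ} {b : ℝ} (hw : IsWeight ν w A b)
    {h : ℝ → ℝ} (hi : Integrable h ν) {B : ℝ} (hB : ∀ᵐ x ∂ν, 0 ≤ h x ∧ h x ≤ B) :
    ∫ x, w x * h x ∂ν ≤ B * ∫ x, A x ∂ν + b * ∫ x, h x ∂ν := by
  rw [← integral_const_mul, ← integral_const_mul, ← integral_add (hw.integrable.const_mul B)
    (hi.const_mul b)]
  refine integral_mono_ae (hw.integrable_mul hi (B := B) ?_)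
    ((hw.integrable.const_mul B).add (hi.const_mul b)) ?_
  · filter_upwards [hB] with x hx
    rw [Real.norm_of_nonneg hx.1]
    exact hx.2
  · filter_upwards [hw.le, hB] with x h2 h3
    have h4 : w x * h x ≤ (A x + b) * h x := mul_le_mul_of_nonneg_right h2 h3.1
    have h5 : A x * h x ≤ A x * B := mul_le_mul_of_nonneg_left h3.2 (hw.bound_nonneg x)
    linarith

theorem H1.ae_norm_sq_le (Ψ : G.H1) {e : I ⊕ X} {B : ℝ}
    (hB : ∀ x ∈ G.dom e, ‖Ψ.val e x‖ ^ 2 ≤ B) :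
    ∀ᵐ x ∂(G.edgeMeasure e), 0 ≤ ‖Ψ.val e x‖ ^ 2 ∧ ‖Ψ.val e x‖ ^ 2 ≤ B := by
  filter_upwards [G.ae_mem_dom e] with x hx
  exact ⟨by positivity, hB x hx⟩

theorem rpow_two_mul_add_two {μ : ℝ} (hμ : 0 < μ) {s : ℝ} (hs : 0 ≤ s) :
    s ^ (2 * μ + 2) = (s ^ 2) ^ μ * s ^ 2 := by
  rw [Real.rpow_add_of_nonneg hs (by positivity) (by norm_num), Real.rpow_mul hs]
  simp

theorem H1.exists_bound [Fintype I] [Fintype X] (Ψ : G.H1) [Fintype V] [Nonempty X] (hG : G.Connected) :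
    ∃ B : ℝ, 0 ≤ B ∧ ∀ e, ∀ x ∈ G.dom e, ‖Ψ.val e x‖ ^ 2 ≤ B := by
  obtain ⟨C, hC, h⟩ := exists_norm_sq_le hG
  exact ⟨_, by positivity, (h Ψ).2⟩

theorem H1.integrable_rpow (Ψ : G.H1) {μ : ℝ} (hμ : 0 < μ) {B : ℝ} {e : I ⊕ X}
    (hB : ∀ x ∈ G.dom e, ‖Ψ.val e x‖ ^ 2 ≤ B) :
    Integrable (fun x => ‖Ψ.val e x‖ ^ (2 * μ + 2)) (G.edgeMeasure e) := by
  refine ((integrable_norm_sq (Ψ.memLp_val e)).const_mul (B ^ μ)).mono' ?_ ?_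
  · exact ((Ψ.memLp_val e).aestronglyMeasurable.norm.aemeasurable.pow_const _).aestronglyMeasurable
  · filter_upwards [Ψ.ae_norm_sq_le hB] with x hx
    rw [Real.norm_of_nonneg (by positivity), rpow_two_mul_add_two hμ (norm_nonneg _)]
    gcongr
    exact hx.2

variable [Fintype I] [Fintype X]

theorem H1.normPow_le (Ψ : G.H1) {μ : ℝ} (hμ : 0 < μ) {B : ℝ}
    (hB : ∀ e, ∀ x ∈ G.dom e, ‖Ψ.val e x‖ ^ 2 ≤ B) :
    G.normPow (2 * μ + 2) Ψ.val ≤ B ^ μ * G.mass Ψ := by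
  rw [mass, normPow_two, normPow, Finset.mul_sum]
  refine Finset.sum_le_sum fun e _ => ?_
  rw [← integral_const_mul]
  refine integral_mono_ae (Ψ.integrable_rpow hμ (hB e))
    ((integrable_norm_sq (Ψ.memLp_val e)).const_mul _) ?_
  filter_upwards [Ψ.ae_norm_sq_le (hB e)] with x hx
  rw [rpow_two_mul_add_two hμ (norm_nonneg _)]
  gcongr
  exact hx.2

theorem H1.integrable_weight (Ψ : G.H1) [Fintype V] [Nonempty X] (hG : G.Connected) {e : I ⊕ X}
    {w A : ℝ → ℝ} {b : ℝ} (hw : IsWeight (G.edgeMeasure e) w A b) :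
    Integrable (fun x => w x * ‖Ψ.val e x‖ ^ 2) (G.edgeMeasure e) := by
  obtain ⟨B, hB0, hB⟩ := Ψ.exists_bound hG
  apply hw.integrable_mul (integrable_norm_sq (Ψ.memLp_val e)) (B := B)
  filter_upwards [Ψ.ae_norm_sq_le (hB e)] with x hx
  rw [Real.norm_of_nonneg hx.1]
  exact hx.2

theorem H1.integral_potential (Ψ : G.H1) [Fintype V] [Nonempty X] (hG : G.Connected)
    {e : I ⊕ X} {W Wp Wm A A' : ℝ → ℝ} {b b' : ℝ}
    (hW : ∀ᵐ x ∂(G.edgeMeasure e), W x = Wp x - Wm x)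
    (hp : IsWeight (G.edgeMeasure e) Wp A b) (hm : IsWeight (G.edgeMeasure e) Wm A' b') :
    ∫ x, W x * ‖Ψ.val e x‖ ^ 2 ∂(G.edgeMeasure e) =
      ∫ x, Wp x * ‖Ψ.val e x‖ ^ 2 ∂(G.edgeMeasure e) -
        ∫ x, Wm x * ‖Ψ.val e x‖ ^ 2 ∂(G.edgeMeasure e) := by
  rw [← integral_sub (Ψ.integrable_weight hG hp) (Ψ.integrable_weight hG hm)]
  apply integral_congr_ae
  filter_upwards [hW] with x hx
  rw [hx]
  ring

variable [Fintype V]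

/-- Form boundedness of the potential and of the vertex terms. -/
theorem exists_le_linEnergy [Nonempty X] (hG : G.Connected) {μ : ℝ} (α : V → ℝ)
    {W : I ⊕ X → ℝ → ℝ} (hW : G.IsAdmissiblePotential μ W) :
    ∃ C : ℝ, 0 ≤ C ∧ ∀ Ψ : G.H1,
      G.kinetic Ψ - C * (√(G.mass Ψ) * √(G.kinetic Ψ)) - G.mass Ψ ≤ G.linEnergy α W Ψ := by
  obtain ⟨C, hC, hsup⟩ := exists_norm_sq_le hG
  obtain ⟨Wp, Wm, hWe, ⟨Ap, bp, hp⟩, hm⟩ := IsAdmissiblePotential.exists_isWeight hW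
  -- The choice ε = 1 is what yields the term `- G.mass Ψ` of the bound.
  obtain ⟨A, hA⟩ := hm 1 one_pos
  have hAn : ∀ e, 0 ≤ ∫ x, A e x ∂(G.edgeMeasure e) := fun e =>
    integral_nonneg (hA e).bound_nonneg
  refine ⟨C * ∑ e, ∫ x, A e x ∂(G.edgeMeasure e) + C * ∑ v, |α v|, ?_, fun Ψ => ?_⟩
  · have h1 : 0 ≤ ∑ e, ∫ x, A e x ∂(G.edgeMeasure e) := Finset.sum_nonneg fun e _ => hAn e
    have h2 : 0 ≤ ∑ v, |α v| := Finset.sum_nonneg fun v _ => abs_nonneg _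
    positivity
  obtain ⟨hv, he⟩ := hsup Ψ
  set s := √(G.mass Ψ) * √(G.kinetic Ψ)
  have hpot : -(C * s * ∑ e, ∫ x, A e x ∂(G.edgeMeasure e) + G.mass Ψ) ≤
      ∑ e, ∫ x, W e x * ‖Ψ.val e x‖ ^ 2 ∂(G.edgeMeasure e) := by
    rw [mass, normPow_two, Finset.mul_sum, ← Finset.sum_add_distrib, ← Finset.sum_neg_distrib]
    refine Finset.sum_le_sum fun e _ => ?_
    rw [Ψ.integral_potential hG (hWe e) (hp e) (hA e)]
    have h1 := (hA e).integral_mul_le (integrable_norm_sq (Ψ.memLp_val e))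
      (Ψ.ae_norm_sq_le (he e))
    have h2 : 0 ≤ ∫ x, Wp e x * ‖Ψ.val e x‖ ^ 2 ∂(G.edgeMeasure e) := by
      apply integral_nonneg_of_ae
      filter_upwards [(hp e).nonneg] with x hx
      simp only [Pi.zero_apply]
      positivity
    linarith
  have hver : -(C * s * ∑ v, |α v|) ≤ ∑ v, α v * ‖Ψ.vert v‖ ^ 2 := by
    rw [Finset.mul_sum, ← Finset.sum_neg_distrib]
    refine Finset.sum_le_sum fun v _ => ?_
    have h1 : |α v| * ‖Ψ.vert v‖ ^ 2 ≤ |α v| * (C * s) :=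
      mul_le_mul_of_nonneg_left (hv v) (abs_nonneg _)
    have h2 : -|α v| * ‖Ψ.vert v‖ ^ 2 ≤ α v * ‖Ψ.vert v‖ ^ 2 :=
      mul_le_mul_of_nonneg_right (neg_abs_le _) (by positivity)
    linarith
  unfold linEnergy
  change _ ≤ G.kinetic Ψ + _ + _
  linarith

end Potential

/-! ### Scaling and differences in H¹. -/

section Operations

open MeasureTheory Set Filter Topology

variable {V I X : Type*} {G : MetricGraph V I X}

theorem integrable_test_mul {s : Set ℝ} {φ : ℝ → ℝ} (hφ : Continuous φ) (hc : HasCompactSupport φ)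
    {f : ℝ → ℂ} (hf : MemLp f 2 (volume.restrict s)) :
    IntegrableOn (fun x => (φ x : ℂ) * f x) s := by
  have h1 : MemLp (fun x => (φ x : ℂ)) 2 (volume.restrict s) :=
    (Complex.continuous_ofReal.comp hφ).memLp_of_hasCompactSupport
      (hc.comp_left (g := ((↑) : ℝ → ℂ)) Complex.ofReal_zero)
  exact h1.integrable_mul hf

/-- Multiplication of an element of `H¹(𝒢)` by a real number. -/
noncomputable def H1.smul (c : ℝ) (Ψ : G.H1) : G.H1 where
  val e x := (c : ℂ) * Ψ.val e x
  der e x := (c : ℂ) * Ψ.der e x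
  vert v := (c : ℂ) * Ψ.vert v
  continuousOn e := continuousOn_const.mul (Ψ.continuousOn e)
  memLp_val e := (Ψ.memLp_val e).const_mul _
  memLp_der e := (Ψ.memLp_der e).const_mul _
  isWeakDeriv e := by
    intro φ h1 h2 h3
    simp_rw [mul_left_comm _ (c : ℂ)]
    rw [integral_const_mul, integral_const_mul, Ψ.isWeakDeriv e φ h1 h2 h3, mul_neg]
  val_src i := by rw [Ψ.val_src]
  val_tgt i := by rw [Ψ.val_tgt]
  val_base x := by rw [Ψ.val_base]

/-- The difference of two elements of `H¹(𝒢)`. -/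
noncomputable def H1.sub (Ψ Φ : G.H1) : G.H1 where
  val e x := Ψ.val e x - Φ.val e x
  der e x := Ψ.der e x - Φ.der e x
  vert v := Ψ.vert v - Φ.vert v
  continuousOn e := (Ψ.continuousOn e).sub (Φ.continuousOn e)
  memLp_val e := (Ψ.memLp_val e).sub (Φ.memLp_val e)
  memLp_der e := (Ψ.memLp_der e).sub (Φ.memLp_der e)
  isWeakDeriv e := by
    intro φ h1 h2 h3
    have hd : Continuous (deriv φ) := h1.continuous_deriv (by simp)
    simp_rw [mul_sub]
    rw [integral_sub (integrable_test_mul hd h2.deriv (Ψ.memLp_val e))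
        (integrable_test_mul hd h2.deriv (Φ.memLp_val e)),
      integral_sub (integrable_test_mul h1.continuous h2 (Ψ.memLp_der e))
        (integrable_test_mul h1.continuous h2 (Φ.memLp_der e)),
      Ψ.isWeakDeriv e φ h1 h2 h3, Φ.isWeakDeriv e φ h1 h2 h3]
    ring
  val_src i := by rw [Ψ.val_src, Φ.val_src]
  val_tgt i := by rw [Ψ.val_tgt, Φ.val_tgt]
  val_base x := by rw [Ψ.val_base, Φ.val_base]

variable [Fintype I] [Fintype X]

theorem normPow_const_mul (G : MetricGraph V I X) (p : ℝ) {c : ℝ} (hc : 0 ≤ c)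
    (ψ : I ⊕ X → ℝ → ℂ) :
    G.normPow p (fun e x => (c : ℂ) * ψ e x) = c ^ p * G.normPow p ψ := by
  simp only [normPow, norm_mul, Complex.norm_real, Real.norm_of_nonneg hc,
    Real.mul_rpow hc (norm_nonneg _), integral_const_mul, Finset.mul_sum]

theorem mass_smul {c : ℝ} (hc : 0 ≤ c) (Ψ : G.H1) : G.mass (Ψ.smul c) = c ^ 2 * G.mass Ψ := by
  rw [← Real.rpow_two]
  exact G.normPow_const_mul 2 hc Ψ.val

variable [Fintype V]

theorem linEnergy_smul (α : V → ℝ) (W : I ⊕ X → ℝ → ℝ) {c : ℝ} (hc : 0 ≤ c) (Ψ : G.H1) :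
    G.linEnergy α W (Ψ.smul c) = c ^ 2 * G.linEnergy α W Ψ := by
  have h1 : G.normPow 2 (Ψ.smul c).der = c ^ 2 * G.normPow 2 Ψ.der := by
    rw [← Real.rpow_two]
    exact G.normPow_const_mul 2 hc Ψ.der
  have h2 : ∀ e, ∫ x, W e x * ‖(Ψ.smul c).val e x‖ ^ 2 ∂(G.edgeMeasure e) =
      c ^ 2 * ∫ x, W e x * ‖Ψ.val e x‖ ^ 2 ∂(G.edgeMeasure e) := by
    intro e
    rw [← integral_const_mul]
    congr 1
    ext x
    simp only [H1.smul, norm_mul, Complex.norm_real, Real.norm_of_nonneg hc]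
    ring
  have h3 : ∀ v, α v * ‖(Ψ.smul c).vert v‖ ^ 2 = c ^ 2 * (α v * ‖Ψ.vert v‖ ^ 2) := by
    intro v
    simp only [H1.smul, norm_mul, Complex.norm_real, Real.norm_of_nonneg hc]
    ring
  simp only [linEnergy, h1, h2, h3, ← Finset.mul_sum]
  ring

/-- The linear part is exactly quadratic, and the focusing term grows at least as fast. This plays
the role of strict subadditivity in concentration compactness. -/
theorem energy_smul_le (α : V → ℝ) (W : I ⊕ X → ℝ → ℝ) {μ : ℝ} (hμ : 0 < μ) {c : ℝ} (hc : 1 ≤ c)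
    (Ψ : G.H1) : G.energy α W μ (Ψ.smul c) ≤ c ^ 2 * G.energy α W μ Ψ := by
  have hc0 : 0 ≤ c := by linarith
  have h1 : G.normPow (2 * μ + 2) (Ψ.smul c).val =
      c ^ (2 * μ + 2) * G.normPow (2 * μ + 2) Ψ.val := G.normPow_const_mul _ hc0 Ψ.val
  have h2 : c ^ 2 ≤ c ^ (2 * μ + 2) := by
    rw [← Real.rpow_two]
    exact Real.rpow_le_rpow_of_exponent_le hc (by linarith)
  have h3 := G.normPow_nonneg (2 * μ + 2) Ψ.val
  have h4 : c ^ 2 * (1 / (μ + 1) * G.normPow (2 * μ + 2) Ψ.val) ≤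
      c ^ (2 * μ + 2) * (1 / (μ + 1) * G.normPow (2 * μ + 2) Ψ.val) := by gcongr
  rw [energy, energy, linEnergy_smul α W hc0, h1]
  linarith

theorem energy_le_linEnergy (α : V → ℝ) (W : I ⊕ X → ℝ → ℝ) {μ : ℝ} (hμ : 0 < μ) (Ψ : G.H1) :
    G.energy α W μ Ψ ≤ G.linEnergy α W Ψ := by
  have h3 := G.normPow_nonneg (2 * μ + 2) Ψ.val
  have : 0 ≤ 1 / (μ + 1) * G.normPow (2 * μ + 2) Ψ.val := by positivity
  rw [energy]
  linarith

end Operations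
end MetricGraph

/-! ### The soliton action and the sharp half-line estimate. -/

namespace MetricGraph
section Soliton

open MeasureTheory Set Filter Topology

/-- The mass of the soliton of frequency one. -/
noncomputable def solitonMass (μ : ℝ) : ℝ :=
  2 * ((μ + 1) ^ (1 / μ) / μ) * ∫ t in (0 : ℝ)..1, (1 - t ^ 2) ^ (1 / μ - 1)

/-- The exponent may be negative; the factorisation `(1 - t) * (1 + t)` isolates the integrable
singularity at 1. -/
theorem intervalIntegrable_one_sub_sq_rpow {k : ℝ} (hk : -1 < k) :
    IntervalIntegrable (fun t : ℝ => (1 - t ^ 2) ^ k) volume 0 1 := by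
  have h1 : IntervalIntegrable (fun t : ℝ => (1 - t) ^ k) volume 0 1 := by
    have := (intervalIntegral.intervalIntegrable_rpow' (a := 1) (b := 0) hk).comp_sub_left 1
    simpa using this
  have h2 : ContinuousOn (fun t : ℝ => (1 + t) ^ k) (uIcc 0 1) := by
    rw [uIcc_of_le zero_le_one]
    exact ContinuousOn.rpow_const (by fun_prop) fun t ht => Or.inl (by linarith [ht.1])
  refine (h1.mul_continuousOn h2).congr ?_
  rw [uIoc_of_le zero_le_one]
  intro t ht
  dsimp only
  rw [← Real.mul_rpow (by linarith [ht.2]) (by linarith [ht.1])]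
  congr 1
  ring

theorem neg_one_lt_exponent {μ : ℝ} (hμ : 0 < μ) : -1 < 1 / μ - 1 := by
  have : 0 < 1 / μ := by positivity
  linarith

theorem solitonMass_pos {μ : ℝ} (hμ : 0 < μ) : 0 < solitonMass μ := by
  have : 0 < ∫ t in (0 : ℝ)..1, (1 - t ^ 2) ^ (1 / μ - 1) := by
    apply intervalIntegral.intervalIntegral_pos_of_pos_on
      (intervalIntegrable_one_sub_sq_rpow (neg_one_lt_exponent hμ)) _ zero_lt_one
    intro t ht
    have : 0 < 1 - t ^ 2 := by nlinarith [ht.1, ht.2]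
    positivity
  unfold solitonMass
  positivity

theorem intervalIntegrable_sq_mul_one_sub_sq_rpow {μ : ℝ} (hμ : 0 < μ) :
    IntervalIntegrable (fun t : ℝ => t ^ 2 * (1 - t ^ 2) ^ (1 / μ - 1)) volume 0 1 :=
  (intervalIntegrable_one_sub_sq_rpow (neg_one_lt_exponent hμ)).continuousOn_mul
    (by fun_prop)

/-- Integrate the derivative of `t * (1 - t ^ 2) ^ (1 / μ)`, which vanishes at both ends. -/
theorem integral_sq_mul_one_sub_sq_rpow {μ : ℝ} (hμ : 0 < μ) :
    ∫ t in (0 : ℝ)..1, t ^ 2 * (1 - t ^ 2) ^ (1 / μ - 1) =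
      μ / (2 + μ) * ∫ t in (0 : ℝ)..1, (1 - t ^ 2) ^ (1 / μ - 1) := by
  have hI := intervalIntegrable_one_sub_sq_rpow (neg_one_lt_exponent hμ)
  have hI2 := (intervalIntegrable_sq_mul_one_sub_sq_rpow hμ).const_mul (1 + 2 / μ)
  have key := intervalIntegral.integral_eq_sub_of_hasDerivAt_of_le zero_le_one
    (f := fun t : ℝ => t * (1 - t ^ 2) ^ (1 / μ))
    (f' := fun t : ℝ => (1 - t ^ 2) ^ (1 / μ - 1) -
      (1 + 2 / μ) * (t ^ 2 * (1 - t ^ 2) ^ (1 / μ - 1))) ?_ ?_ (hI.sub hI2)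
  · rw [intervalIntegral.integral_sub hI hI2, intervalIntegral.integral_const_mul] at key
    have h0 : (0 : ℝ) ^ μ⁻¹ = 0 := Real.zero_rpow (by positivity)
    norm_num [h0] at key
    have h3 : (∫ t in (0 : ℝ)..1, (1 - t ^ 2) ^ (1 / μ - 1)) =
        (1 + 2 / μ) * ∫ t in (0 : ℝ)..1, t ^ 2 * (1 - t ^ 2) ^ (1 / μ - 1) := by
      simp only [one_div]
      linarith
    rw [h3]
    field_simp
    ring
  · apply ContinuousOn.mul continuousOn_id
    exact ContinuousOn.rpow_const (by fun_prop) fun t ht => Or.inr (by positivity)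
  · intro t ht
    have hpos : 0 < 1 - t ^ 2 := by nlinarith [ht.1, ht.2]
    have h1 : HasDerivAt (fun t : ℝ => 1 - t ^ 2) (-(2 * t)) t := by
      simpa using (hasDerivAt_pow 2 t).const_sub 1
    have h2 := (hasDerivAt_id t).mul (h1.rpow_const (p := 1 / μ) (Or.inl hpos.ne'))
    refine HasDerivAt.congr_deriv h2 ?_
    have e : (1 - t ^ 2) ^ (1 / μ) = (1 - t ^ 2) * (1 - t ^ 2) ^ (1 / μ - 1) := by
      nth_rewrite 2 [← Real.rpow_one (1 - t ^ 2)]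
      rw [← Real.rpow_add hpos]
      congr 1
      ring
    simp only [id, e]
    ring

/-- The density of the action: `2s` times the logarithmic slope at amplitude `s` of the soliton of
frequency `c`. -/
noncomputable def actionDensity (μ c s : ℝ) : ℝ := 2 * s * √(c - |s| ^ (2 * μ) / (μ + 1))

/-- The action accumulated between the amplitudes `0` and `s` along the soliton of frequency
`c`. -/
noncomputable def action (μ c s : ℝ) : ℝ := ∫ t in (0 : ℝ)..s, actionDensity μ c t

/-- The chain rule asks for a C¹ function on all of ℝ; the absolute value and the convention that
`√` vanishes on negative numbers extend the density beyond the range of soliton amplitudes. -/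
theorem continuous_actionDensity {μ : ℝ} (hμ : 0 < μ) (c : ℝ) :
    Continuous (actionDensity μ c) := by
  have : Continuous fun s : ℝ => |s| ^ (2 * μ) :=
    continuous_abs.rpow_const fun _ => Or.inr (by positivity)
  unfold actionDensity
  fun_prop

theorem hasDerivAt_action {μ : ℝ} (hμ : 0 < μ) (c s : ℝ) :
    HasDerivAt (action μ c) (actionDensity μ c s) s :=
  ((continuous_actionDensity hμ c).integral_hasStrictDerivAt 0 s).hasDerivAt

theorem action_le {μ : ℝ} (hμ : 0 < μ) {c s : ℝ} (hs : 0 ≤ s) :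
    action μ c s ≤ √c * s ^ 2 := by
  have h1 : ∫ t in (0 : ℝ)..s, √c * (2 * t) = √c * s ^ 2 := by
    rw [intervalIntegral.integral_const_mul, intervalIntegral.integral_const_mul, integral_id]
    ring
  rw [← h1, action]
  apply intervalIntegral.integral_mono_on hs
    ((continuous_actionDensity hμ c).intervalIntegrable _ _)
    (Continuous.intervalIntegrable (by fun_prop) _ _)
  intro t ht
  rw [actionDensity, mul_comm (√c)]
  have : √(c - |t| ^ (2 * μ) / (μ + 1)) ≤ √c := by
    apply Real.sqrt_le_sqrt
    have : 0 ≤ |t| ^ (2 * μ) / (μ + 1) := by positivity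
    linarith
  have := ht.1
  gcongr

/-- The action of half of the soliton of amplitude `M`. -/
theorem action_amplitude {μ : ℝ} (hμ : 0 < μ) {M : ℝ} (hM : 0 ≤ M) :
    action μ (M ^ (2 * μ) / (μ + 1)) M = √(M ^ (2 * μ) / (μ + 1)) * M ^ 2 *
      (2 / (2 + μ) * ∫ t in (0 : ℝ)..1, (1 - t ^ 2) ^ (1 / μ - 1)) := by
  rcases hM.eq_or_lt with rfl | hM
  · simp [action]
  set c := M ^ (2 * μ) / (μ + 1) with hc
  -- Substitute `s = M * (1 - t ^ 2) ^ (1 / (2 * μ))`, under which the square root in the density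
  -- becomes `√c * t`.
  have key := intervalIntegral.integral_eq_sub_of_hasDerivAt_of_le zero_le_one
    (f := fun t : ℝ => action μ c (M * (1 - t ^ 2) ^ (1 / (2 * μ))))
    (f' := fun t : ℝ => -(2 * M ^ 2 * √c / μ) * (t ^ 2 * (1 - t ^ 2) ^ (1 / μ - 1))) ?_ ?_
    ((intervalIntegrable_sq_mul_one_sub_sq_rpow hμ).const_mul _)
  · rw [intervalIntegral.integral_const_mul, integral_sq_mul_one_sub_sq_rpow hμ] at key
    have h0 : (0 : ℝ) ^ (1 / (2 * μ)) = 0 := Real.zero_rpow (by positivity)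
    have h1 : action μ c 0 = 0 := by simp [action]
    have h2 : (1 : ℝ) - 1 ^ 2 = 0 := by norm_num
    have h3 : (1 : ℝ) - 0 ^ 2 = 1 := by norm_num
    rw [h2, h3, h0, mul_zero, h1, Real.one_rpow, mul_one] at key
    have : action μ c M = 2 * M ^ 2 * √c / μ *
      (μ / (2 + μ) * ∫ t in (0 : ℝ)..1, (1 - t ^ 2) ^ (1 / μ - 1)) := by linarith
    rw [this]
    field_simp
  · have hact : Continuous (action μ c) :=
      continuous_iff_continuousAt.2 fun s => (hasDerivAt_action hμ c s).continuousAt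
    apply hact.comp_continuousOn
    apply ContinuousOn.mul continuousOn_const
    exact ContinuousOn.rpow_const (by fun_prop) fun t ht => Or.inr (by positivity)
  · intro t ht
    have hpos : 0 < 1 - t ^ 2 := by nlinarith [ht.1, ht.2]
    have h1 : HasDerivAt (fun t : ℝ => 1 - t ^ 2) (-(2 * t)) t := by
      simpa using (hasDerivAt_pow 2 t).const_sub 1
    have h2 := (h1.rpow_const (p := 1 / (2 * μ)) (Or.inl hpos.ne')).const_mul M
    have h3 := (hasDerivAt_action hμ c (M * (1 - t ^ 2) ^ (1 / (2 * μ)))).comp t h2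
    refine HasDerivAt.congr_deriv h3 ?_
    have e1 : |M * (1 - t ^ 2) ^ (1 / (2 * μ))| ^ (2 * μ) / (μ + 1) = c * (1 - t ^ 2) := by
      rw [abs_of_nonneg (by positivity), Real.mul_rpow hM.le (by positivity),
        ← Real.rpow_mul hpos.le, one_div_mul_cancel (by positivity), Real.rpow_one, hc]
      ring
    have hc0 : 0 ≤ c := by positivity
    have e2 : √(c - c * (1 - t ^ 2)) = √c * t := by
      rw [show c - c * (1 - t ^ 2) = c * t ^ 2 by ring, Real.sqrt_mul hc0, Real.sqrt_sq ht.1.le]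
    have e3 : (1 - t ^ 2) ^ (1 / μ - 1) =
        (1 - t ^ 2) ^ (1 / (2 * μ)) * (1 - t ^ 2) ^ (1 / (2 * μ) - 1) := by
      rw [← Real.rpow_add hpos]
      congr 1
      field_simp
      ring
    rw [actionDensity, e1, e2, e3]
    field_simp

/-- Eliminating the amplitude in favour of the frequency c leaves a pure power c^a with a = 1/μ +
1/2. Its derivative in c is the soliton mass at frequency c, whence the prefactor A/a. -/
theorem two_mul_action_amplitude {μ : ℝ} (hμ : 0 < μ) {M : ℝ} (hM : 0 ≤ M) :
    2 * action μ (M ^ (2 * μ) / (μ + 1)) M = solitonMass μ / (1 / μ + 1 / 2) *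
      (M ^ (2 * μ) / (μ + 1)) ^ (1 / μ + 1 / 2) := by
  rw [action_amplitude hμ hM, solitonMass]
  set c := M ^ (2 * μ) / (μ + 1) with hc
  have hc0 : 0 ≤ c := by positivity
  have e1 : M ^ 2 = (μ + 1) ^ (1 / μ) * c ^ (1 / μ) := by
    rw [← Real.mul_rpow (by positivity) hc0, hc, mul_div_cancel₀ _ (by positivity),
      ← Real.rpow_mul hM, mul_assoc, mul_one_div_cancel hμ.ne']
    simp
  have e2 : c ^ (1 / μ + 1 / 2) = c ^ (1 / μ) * √c := by
    rw [Real.rpow_add_of_nonneg hc0 (by positivity) (by positivity), Real.sqrt_eq_rpow]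
  rw [e1, e2]
  field_simp

/-- Complete the square in `d - r * s`, where `r` is the square root in the density; it vanishes
exactly when the first-order soliton equation |f'| = r|f| holds. -/
theorem actionDensity_mul_le {μ : ℝ} (hμ : 0 < μ) {c s d : ℝ} (hs : 0 ≤ s)
    (hc : s ^ (2 * μ) / (μ + 1) ≤ c) :
    |actionDensity μ c s| * d ≤ d ^ 2 + (c * s ^ 2 - 1 / (μ + 1) * s ^ (2 * μ + 2)) := by
  have h1 : s ^ (2 * μ + 2) = s ^ (2 * μ) * s ^ 2 := by
    rw [Real.rpow_add_of_nonneg hs (by positivity) (by norm_num), Real.rpow_two]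
  rw [actionDensity, abs_of_nonneg (by positivity), abs_of_nonneg hs, h1]
  have h2 := Real.sq_sqrt (sub_nonneg.2 hc)
  set r := √(c - s ^ (2 * μ) / (μ + 1))
  have h3 : c * s ^ 2 - 1 / (μ + 1) * (s ^ (2 * μ) * s ^ 2) = (r * s) ^ 2 := by
    rw [mul_pow, h2]
    ring
  rw [h3]
  nlinarith [sq_nonneg (d - r * s)]

/-- Young's inequality for the action and the mass of the soliton. -/
theorem mul_le_action_add {A a m c : ℝ} (hA : 0 < A) (ha : 1 < a) (hm : 0 < m) (hc : 0 ≤ c) :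
    c * m ≤ A / a * c ^ a + (1 - 1 / a) * (m / A) ^ (1 / (a - 1)) * m := by
  -- `w` is the frequency at which equality holds, `A * w ^ (a - 1) = m`; the inequality is
  -- Bernoulli's for `c / w`.
  set w := (m / A) ^ (1 / (a - 1)) with hw
  have hw0 : 0 < w := by positivity
  have ha1 : a - 1 ≠ 0 := by linarith
  have h1 : w ^ (a - 1) = m / A := by
    rw [hw, ← Real.rpow_mul (by positivity), one_div_mul_cancel ha1, Real.rpow_one]
  have h2 := one_add_mul_self_le_rpow_one_add (s := c / w - 1)
    (by have : 0 ≤ c / w := by positivity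
        linarith) ha.le
  rw [add_sub_cancel, Real.div_rpow hc hw0.le, le_div_iff₀ (by positivity)] at h2
  have h3 : w ^ a = m / A * w := by
    rw [← h1]
    nth_rewrite 3 [← Real.rpow_one w]
    rw [← Real.rpow_add hw0]
    congr 1
    ring
  rw [h3] at h2
  have h4 : A / a * ((1 + a * (c / w - 1)) * (m / A * w)) = c * m - (1 - 1 / a) * w * m := by
    field_simp
    ring
  have h5 : A / a * ((1 + a * (c / w - 1)) * (m / A * w)) ≤ A / a * c ^ a := by gcongr
  linarith

/-- This recognises γ_μ as the constant of Young's inequality: for a = 1/μ + 1/2 one has 1 - 1/a =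
(2 - μ)/(2 + μ) and 1/(a - 1) = 2μ/(2 - μ). -/
theorem gammaConst_mul_rpow {μ : ℝ} (hμ : 0 < μ) (hμ2 : μ < 2) {m : ℝ} (hm : 0 < m) :
    gammaConst μ * m ^ (2 * μ / (2 - μ)) =
      (1 - 1 / (1 / μ + 1 / 2)) * (m / solitonMass μ) ^ (1 / (1 / μ + 1 / 2 - 1)) := by
  have h2 : (2 : ℝ) - μ ≠ 0 := by linarith
  have e1 : 1 / (1 / μ + 1 / 2 - 1) = 2 * μ / (2 - μ) := by
    have : 1 / μ + 1 / 2 - 1 = (2 - μ) / (2 * μ) := by field_simp; ring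
    rw [this, one_div_div]
  have e2 : 1 - 1 / (1 / μ + 1 / 2) = (2 - μ) / (2 + μ) := by
    have : 1 / μ + 1 / 2 = (2 + μ) / (2 * μ) := by field_simp
    rw [this, one_div_div]
    field_simp
    ring
  rw [e1, e2, Real.div_rpow hm.le (solitonMass_pos hμ).le, gammaConst]
  change (2 - μ) / (2 + μ) * solitonMass μ ^ (-(2 * μ / (2 - μ))) * _ = _
  rw [Real.rpow_neg (solitonMass_pos hμ).le]
  ring

theorem gammaConst_pos {μ : ℝ} (hμ : 0 < μ) (hμ2 : μ < 2) : 0 < gammaConst μ := by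
  have h1 := solitonMass_pos hμ
  have h2 : 0 < 2 - μ := by linarith
  change 0 < (2 - μ) / (2 + μ) * solitonMass μ ^ (-(2 * μ / (2 - μ)))
  positivity

variable {V I X : Type*} {G : MetricGraph V I X}

/-- The action of a function on a half-line is at least that of the soliton with the same
supremum, up to a contribution of the value at the endpoint. -/
theorem H1.exists_action_le (Ψ : G.H1) (e : X) {μ : ℝ} (hμ : 0 < μ) {B : ℝ}
    (hB : ∀ x, 0 ≤ x → ‖Ψ.val (Sum.inr e) x‖ ^ 2 ≤ B) :
    ∃ c, 0 ≤ c ∧ √c ≤ √(B ^ μ) ∧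
      solitonMass μ / (1 / μ + 1 / 2) * c ^ (1 / μ + 1 / 2) ≤
        ∫ x, ‖Ψ.der (Sum.inr e) x‖ ^ 2 ∂(G.edgeMeasure (Sum.inr e)) +
          c * ∫ x, ‖Ψ.val (Sum.inr e) x‖ ^ 2 ∂(G.edgeMeasure (Sum.inr e)) -
          1 / (μ + 1) * ∫ x, ‖Ψ.val (Sum.inr e) x‖ ^ (2 * μ + 2) ∂(G.edgeMeasure (Sum.inr e)) +
          √c * ‖Ψ.val (Sum.inr e) 0‖ ^ 2 := by
  set f := Ψ.val (Sum.inr e) with hf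
  set S : Set ℝ := (fun x => ‖f x‖) '' Ici 0 with hS
  have hSne : S.Nonempty := ⟨_, 0, le_refl (0 : ℝ), rfl⟩
  have hSb : ∀ s ∈ S, s ≤ √B := by
    rintro _ ⟨x, hx, rfl⟩
    exact Real.le_sqrt_of_sq_le (hB x hx)
  have hSB : BddAbove S := ⟨√B, hSb⟩
  set M := sSup S with hMdef
  have hfM : ∀ x, 0 ≤ x → ‖f x‖ ≤ M := fun x hx => le_csSup hSB ⟨x, hx, rfl⟩
  have hM0 : 0 ≤ M := (norm_nonneg _).trans (hfM 0 le_rfl)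
  have hMB : M ≤ √B := csSup_le hSne hSb
  have hB0 : 0 ≤ B := (sq_nonneg _).trans (hB 0 le_rfl)
  -- The least frequency for which the square root in the density has a nonnegative argument at
  -- every value of `‖f‖`; the soliton of frequency `c` has amplitude `M`.
  set c := M ^ (2 * μ) / (μ + 1) with hc
  have hc0 : 0 ≤ c := by positivity
  refine ⟨c, hc0, ?_, ?_⟩
  · apply Real.sqrt_le_sqrt
    calc c ≤ M ^ (2 * μ) := div_le_self (by positivity) (by linarith)
      _ ≤ √B ^ (2 * μ) := by gcongr
      _ = B ^ μ := by
        rw [Real.rpow_mul (Real.sqrt_nonneg _), Real.rpow_two, Real.sq_sqrt hB0]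
  have hfc : ∀ x, 0 ≤ x → ‖f x‖ ^ (2 * μ) / (μ + 1) ≤ c := fun x hx => by
    have := hfM x hx
    rw [hc]
    gcongr
  set ν := G.edgeMeasure (Sum.inr e)
  have hi1 : Integrable (fun x => ‖Ψ.der (Sum.inr e) x‖ ^ 2) ν :=
    integrable_norm_sq (Ψ.memLp_der _)
  have hi2 : Integrable (fun x => c * ‖f x‖ ^ 2) ν :=
    (integrable_norm_sq (Ψ.memLp_val _)).const_mul c
  have hi3 : Integrable (fun x => 1 / (μ + 1) * ‖f x‖ ^ (2 * μ + 2)) ν :=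
    (Ψ.integrable_rpow hμ (e := Sum.inr e) hB).const_mul _
  set h : ℝ → ℝ := fun x => ‖Ψ.der (Sum.inr e) x‖ ^ 2 +
    (c * ‖f x‖ ^ 2 - 1 / (μ + 1) * ‖f x‖ ^ (2 * μ + 2)) with hh
  have hint : Integrable h ν := hi1.add (hi2.sub hi3)
  have hle : ∀ x, 0 ≤ x → |actionDensity μ c ‖f x‖| * ‖Ψ.der (Sum.inr e) x‖ ≤ h x :=
    fun x hx => actionDensity_mul_le hμ (norm_nonneg _) (hfc x hx)
  have hnn : ∀ x, 0 ≤ x → 0 ≤ h x := fun x hx => le_trans (by positivity) (hle x hx)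
  have hvar : ∀ x y, 0 ≤ x → x ≤ y → |action μ c ‖f y‖ - action μ c ‖f x‖| ≤
      ∫ t in Ioc x y, h t := by
    intro x y hx hxy
    have hy : 0 ≤ y := hx.trans hxy
    have hsub : Icc x y ⊆ Ici 0 := fun t ht => hx.trans ht.1
    refine (Ψ.abs_comp_norm_val_sub_le (e := Sum.inr e) (hasDerivAt_action hμ c)
      (continuous_actionDensity hμ c) hx hy hxy).trans ?_
    rw [← intervalIntegral.integral_of_le hxy]
    apply intervalIntegral.integral_mono_on hxy
    · rw [intervalIntegrable_iff_integrableOn_Icc_of_le hxy]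
      refine IntegrableOn.continuousOn_mul ?_ (integrableOn_Icc_of_memLp
        (Ψ.memLp_der (Sum.inr e)) hx hy).norm isCompact_Icc
      exact ((continuous_actionDensity hμ c).comp_continuousOn
        ((Ψ.continuousOn (Sum.inr e)).mono hsub).norm).abs
    · rw [intervalIntegrable_iff_integrableOn_Icc_of_le hxy]
      exact hint.mono_measure (Measure.restrict_mono hsub le_rfl)
    · exact fun t ht => hle t (hsub ht)
  have htotal : ∫ x, h x ∂ν = ∫ x, ‖Ψ.der (Sum.inr e) x‖ ^ 2 ∂ν + c * ∫ x, ‖f x‖ ^ 2 ∂ν -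
      1 / (μ + 1) * ∫ x, ‖f x‖ ^ (2 * μ + 2) ∂ν := by
    have e1 := integral_add hi1 (hi2.sub hi3)
    have e2 := integral_sub hi2 hi3
    rw [integral_const_mul, integral_const_mul] at e2
    simp only [Pi.sub_apply] at e1
    rw [e2] at e1
    rw [hh, e1]
    ring
  -- The action climbs from its value at 0 to its value at `x` and descends to almost zero at a
  -- remote `y`. The two intervals are disjoint, so both variations fit into one integral of `h`.
  have hpt : ∀ x, 0 ≤ x → 2 * action μ c ‖f x‖ ≤ ∫ x, h x ∂ν + √c * ‖f 0‖ ^ 2 := by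
    intro x hx
    apply le_of_forall_pos_le_add
    intro ε hε
    obtain ⟨y, hxy, hy, hlt⟩ := exists_norm_lt_of_memLp (Ψ.memLp_val (Sum.inr e))
      (show 0 < √(ε / (√c + 1)) by positivity) x
    have h1 := hvar 0 x le_rfl hx
    have h2 := hvar x y hx hxy
    have hio : ∀ a b, 0 ≤ a → IntegrableOn h (Ioc a b) := fun a b ha =>
      hint.mono_measure (Measure.restrict_mono (fun t ht => ha.trans ht.1.le) le_rfl)
    have h3 : (∫ t in Ioc 0 x, h t) + ∫ t in Ioc x y, h t ≤ ∫ x, h x ∂ν := by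
      rw [← setIntegral_union (Ioc_disjoint_Ioc_of_le le_rfl) measurableSet_Ioc
        (hio 0 x le_rfl) (hio x y hx), Ioc_union_Ioc_eq_Ioc hx hxy]
      refine setIntegral_mono_set hint ?_ ?_
      · filter_upwards [ae_restrict_mem measurableSet_Ici] with t ht
        exact hnn t ht
      · exact LE.le.eventuallyLE fun t ht => ht.1.le
    have h4 := action_le hμ (c := c) (norm_nonneg (f 0))
    have h5 := action_le hμ (c := c) (norm_nonneg (f y))
    have h6 : √c * ‖f y‖ ^ 2 ≤ ε := by
      have : ‖f y‖ ^ 2 ≤ ε / (√c + 1) := by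
        rw [← Real.sq_sqrt (show 0 ≤ ε / (√c + 1) by positivity)]
        gcongr
      rw [le_div_iff₀ (by positivity)] at this
      nlinarith [sq_nonneg ‖f y‖]
    rw [abs_le] at h1 h2
    linarith [h1.2, h2.1]
  -- The supremum is approached along a sequence, which spares proving that it is attained.
  obtain ⟨u, -, hu, huS⟩ := exists_seq_tendsto_sSup hSne hSB
  have hact : Continuous (action μ c) :=
    continuous_iff_continuousAt.2 fun s => (hasDerivAt_action hμ c s).continuousAt
  have hlim := ((hact.tendsto M).comp hu).const_mul 2
  rw [← htotal, ← two_mul_action_amplitude hμ hM0]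
  refine le_of_tendsto' hlim fun n => ?_
  obtain ⟨x, hx, hxu⟩ := huS n
  simp only [Function.comp_apply, ← hxu]
  exact hpt x hx

/-- Young's inequality is applied at the upper bound `m` rather than at the mass of the edge. The
estimate becomes linear in the mass of the edge and can be summed over the external edges. -/
theorem H1.free_energy_external_ge (Ψ : G.H1) (e : X) {μ : ℝ} (hμ : 0 < μ) (hμ2 : μ < 2) {B m : ℝ}
    (hB : ∀ x, 0 ≤ x → ‖Ψ.val (Sum.inr e) x‖ ^ 2 ≤ B) (hm : 0 < m)
    (hmass : ∫ x, ‖Ψ.val (Sum.inr e) x‖ ^ 2 ∂(G.edgeMeasure (Sum.inr e)) ≤ m) :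
    -(gammaConst μ * m ^ (2 * μ / (2 - μ)) *
        ∫ x, ‖Ψ.val (Sum.inr e) x‖ ^ 2 ∂(G.edgeMeasure (Sum.inr e))) -
      √(B ^ μ) * ‖Ψ.val (Sum.inr e) 0‖ ^ 2 ≤
    ∫ x, ‖Ψ.der (Sum.inr e) x‖ ^ 2 ∂(G.edgeMeasure (Sum.inr e)) -
      1 / (μ + 1) * ∫ x, ‖Ψ.val (Sum.inr e) x‖ ^ (2 * μ + 2) ∂(G.edgeMeasure (Sum.inr e)) := by
  obtain ⟨c, hc0, hcB, hact⟩ := Ψ.exists_action_le e hμ hB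
  have ha : 1 < 1 / μ + 1 / 2 := by
    have : 1 / 2 < 1 / μ := one_div_lt_one_div_of_lt hμ hμ2
    linarith
  have hyoung := mul_le_action_add (solitonMass_pos hμ) ha hm hc0
  rw [← gammaConst_mul_rpow hμ hμ2 hm] at hyoung
  set g := gammaConst μ * m ^ (2 * μ / (2 - μ))
  set N := ∫ x, ‖Ψ.val (Sum.inr e) x‖ ^ 2 ∂(G.edgeMeasure (Sum.inr e))
  have hN : 0 ≤ N := integral_nonneg fun _ => by positivity
  set T := solitonMass μ / (1 / μ + 1 / 2) * c ^ (1 / μ + 1 / 2)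
  have hT : 0 ≤ T := by
    have := solitonMass_pos hμ
    positivity
  -- Young gives `(c - g) * m ≤ T`; if `c ≤ g` the left side is nonpositive, otherwise it increases
  -- with `N ≤ m`.
  have h1 : (c - g) * N ≤ T := by
    rcases le_total c g with h | h
    · nlinarith
    · nlinarith
  have h2 : √c * ‖Ψ.val (Sum.inr e) 0‖ ^ 2 ≤ √(B ^ μ) * ‖Ψ.val (Sum.inr e) 0‖ ^ 2 := by gcongr
  linarith

end Soliton
end MetricGraph

/-! ### The mass threshold: coercivity and finiteness of the infimum. -/

namespace MetricGraph
section Thresholds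

open MeasureTheory Set Filter Topology

variable {V I X : Type*} {G : MetricGraph V I X} [Fintype I] [Fintype X]

/-- The admissible constants in the critical Gagliardo–Nirenberg inequality. -/
theorem lpNorm_six_le_iff {K : ℝ} (hK : 0 ≤ K) (Ψ : G.H1) :
    G.lpNorm 6 Ψ.val ≤
      K * G.lpNorm 2 Ψ.der ^ (1 / 3 : ℝ) * G.lpNorm 2 Ψ.val ^ (2 / 3 : ℝ) ↔
    G.normPow 6 Ψ.val ≤ K ^ 6 * (G.kinetic Ψ * G.mass Ψ ^ 2) := by
  have hN := mass_nonneg Ψ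
  have hD := kinetic_nonneg Ψ
  have hQ := G.normPow_nonneg 6 Ψ.val
  have e : K * G.lpNorm 2 Ψ.der ^ (1 / 3 : ℝ) * G.lpNorm 2 Ψ.val ^ (2 / 3 : ℝ) =
      (K ^ 6 * (G.kinetic Ψ * G.mass Ψ ^ 2)) ^ (1 / 6 : ℝ) := by
    simp only [lpNorm]
    change K * (G.kinetic Ψ ^ (1 / 2 : ℝ)) ^ (1 / 3 : ℝ) *
      (G.mass Ψ ^ (1 / 2 : ℝ)) ^ (2 / 3 : ℝ) = _
    rw [Real.mul_rpow (by positivity) (by positivity), Real.mul_rpow hD (by positivity),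
      ← Real.rpow_natCast K 6, ← Real.rpow_natCast (G.mass Ψ) 2, ← Real.rpow_mul hK,
      ← Real.rpow_mul hN, ← Real.rpow_mul hN, ← Real.rpow_mul hD]
    norm_num
    ring
  rw [e, lpNorm]
  exact Real.rpow_le_rpow_iff hQ (by positivity) (by norm_num)

theorem K62_nonneg (G : MetricGraph V I X) : 0 ≤ G.K62 :=
  Real.sInf_nonneg fun _ hK => hK.1

theorem normPow_pos {Ψ : G.H1} (hΨ : 0 < G.mass Ψ) {μ : ℝ} (hμ : 0 < μ) {B : ℝ}
    (hB : ∀ e, ∀ x ∈ G.dom e, ‖Ψ.val e x‖ ^ 2 ≤ B) : 0 < G.normPow (2 * μ + 2) Ψ.val := by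
  refine lt_of_le_of_ne (G.normPow_nonneg _ _) fun h0 => hΨ.ne' ?_
  rw [eq_comm, normPow, Finset.sum_eq_zero_iff_of_nonneg
    fun _ _ => integral_norm_rpow_nonneg _ _ _] at h0
  rw [mass, normPow]
  refine Finset.sum_eq_zero fun e he => ?_
  have h1 := h0 e he
  rw [integral_eq_zero_iff_of_nonneg (fun x => by positivity) (Ψ.integrable_rpow hμ (hB e))] at h1
  apply integral_eq_zero_of_ae
  filter_upwards [h1] with x hx
  simp only [Pi.zero_apply] at hx ⊢
  rw [Real.rpow_eq_zero (norm_nonneg _) (by positivity)] at hx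
  rw [hx]
  simp

variable [Fintype V]

/-- The admissible constants form a closed set, so the infimum is itself admissible. The supremum
bound provides one such constant, without which `sInf` would be the default value 0. -/
theorem normPow_six_le [Nonempty X] (hG : G.Connected) (Ψ : G.H1) :
    G.normPow 6 Ψ.val ≤ G.K62 ^ 6 * (G.kinetic Ψ * G.mass Ψ ^ 2) := by
  rw [← lpNorm_six_le_iff G.K62_nonneg]
  set S := {K : ℝ | 0 ≤ K ∧ ∀ Ψ : G.H1, G.lpNorm 6 Ψ.val ≤
      K * G.lpNorm 2 Ψ.der ^ (1 / 3 : ℝ) * G.lpNorm 2 Ψ.val ^ (2 / 3 : ℝ)} with hS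
  have hne : S.Nonempty := by
    obtain ⟨C, hC, hsup⟩ := exists_norm_sq_le hG
    refine ⟨C ^ (1 / 3 : ℝ), by positivity, fun Φ => ?_⟩
    rw [lpNorm_six_le_iff (by positivity)]
    have h1 := Φ.normPow_le zero_lt_two (hsup Φ).2
    have e1 : (C ^ (1 / 3 : ℝ)) ^ 6 = C ^ 2 := by
      rw [← Real.rpow_natCast, ← Real.rpow_mul hC, ← Real.rpow_natCast]
      norm_num
    have e2 : (C * (√(G.mass Φ) * √(G.kinetic Φ))) ^ (2 : ℝ) =
        C ^ 2 * (G.mass Φ * G.kinetic Φ) := by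
      rw [Real.rpow_two, mul_pow, mul_pow, Real.sq_sqrt (mass_nonneg Φ),
        Real.sq_sqrt (kinetic_nonneg Φ)]
    rw [e2, show (2 : ℝ) * 2 + 2 = 6 by norm_num] at h1
    rw [e1]
    linarith
  obtain ⟨u, -, hu, huS⟩ := exists_seq_tendsto_sInf hne ⟨0, fun K hK => hK.1⟩
  have hlim := (hu.mul_const (G.lpNorm 2 Ψ.der ^ (1 / 3 : ℝ))).mul_const
    (G.lpNorm 2 Ψ.val ^ (2 / 3 : ℝ))
  exact ge_of_tendsto' hlim fun n => (huS n).2 Ψ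

theorem K62_pos [Nonempty X] (hG : G.Connected) {Ψ : G.H1} (hΨ : 0 < G.mass Ψ) : 0 < G.K62 := by
  refine lt_of_le_of_ne G.K62_nonneg fun h => ?_
  obtain ⟨B, -, hB⟩ := Ψ.exists_bound hG
  have h1 := normPow_pos hΨ zero_lt_two hB
  have h2 := normPow_six_le hG Ψ
  rw [← h] at h2
  norm_num at h1 h2
  linarith

/-- Form boundedness bounds E^lin from below by completing the square in ‖Ψ'‖. A function of mass 1
exists because the infimum over an empty set would be `⊤`, contradicting E₀ > 0. -/
theorem exists_E0_eq_coe [Nonempty X] (hG : G.Connected) {μ : ℝ} {α : V → ℝ}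
    {W : I ⊕ X → ℝ → ℝ} (hW : G.IsAdmissiblePotential μ W) (hE0 : 0 < G.E0 α W) :
    ∃ E : ℝ, 0 < E ∧ G.E0 α W = E ∧ ∃ Ψ : G.H1, G.mass Ψ = 1 := by
  have hlt : (⨅ Ψ : {Ψ : G.H1 // G.mass Ψ = 1}, (G.linEnergy α W Ψ.1 : EReal)) < 0 := by
    have h := EReal.neg_lt_neg_iff.2 hE0
    rwa [E0, neg_neg, neg_zero] at h
  obtain ⟨C, -, hC⟩ := exists_le_linEnergy hG α hW
  have hge : ((-(C ^ 2 / 4) - 1 : ℝ) : EReal) ≤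
      ⨅ Ψ : {Ψ : G.H1 // G.mass Ψ = 1}, (G.linEnergy α W Ψ.1 : EReal) := by
    refine le_iInf fun Ψ => EReal.coe_le_coe_iff.2 ?_
    have h1 := hC Ψ.1
    rw [Ψ.2, Real.sqrt_one, one_mul] at h1
    have h2 := Real.sq_sqrt (kinetic_nonneg Ψ.1)
    nlinarith [sq_nonneg (√(G.kinetic Ψ.1) - C / 2)]
  obtain ⟨Ψ, -⟩ := iInf_lt_iff.1 hlt
  have hbot := ((EReal.bot_lt_coe _).trans_le hge).ne'
  obtain ⟨R, hR⟩ : ∃ R : ℝ, (R : EReal) =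
      ⨅ Ψ : {Ψ : G.H1 // G.mass Ψ = 1}, (G.linEnergy α W Ψ.1 : EReal) :=
    ⟨_, EReal.coe_toReal (hlt.trans EReal.zero_lt_top).ne hbot⟩
  refine ⟨-R, ?_, ?_, Ψ.1, Ψ.2⟩
  · rw [← hR] at hlt
    have : R < 0 := by exact_mod_cast hlt
    linarith
  · rw [E0, ← hR, EReal.coe_neg]

/-- Near-minimisers of E^lin at mass 1, multiplied by √m, are competitors at mass m, and the
nonlinear term only lowers their energy. -/
theorem energyInf_le {μ : ℝ} (hμ : 0 < μ) {α : V → ℝ} {W : I ⊕ X → ℝ → ℝ} {E : ℝ}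
    (hE : G.E0 α W = E) {m : ℝ} (hm : 0 < m) :
    G.energyInf α W μ m ≤ ((-(m * E) : ℝ) : EReal) := by
  have hlin : (⨅ Ψ : {Ψ : G.H1 // G.mass Ψ = 1}, (G.linEnergy α W Ψ.1 : EReal)) =
      ((-E : ℝ) : EReal) := by
    rw [EReal.coe_neg, ← hE, E0, neg_neg]
  refine le_of_forall_gt fun R' hR' => ?_
  induction R' with
  | bot => exact absurd hR' (by simp)
  | top =>
    obtain ⟨Ψ, -⟩ : ∃ Ψ : {Ψ : G.H1 // G.mass Ψ = 1}, (G.linEnergy α W Ψ.1 : EReal) < ⊤ := by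
      rw [← iInf_lt_iff, hlin]
      exact EReal.coe_lt_top _
    refine iInf_lt_iff.2 ⟨⟨Ψ.1.smul √m, ?_⟩, EReal.coe_lt_top _⟩
    rw [mass_smul (Real.sqrt_nonneg m), Real.sq_sqrt hm.le, Ψ.2, mul_one]
  | coe R =>
    have hR : -(m * E) < R := by exact_mod_cast hR'
    obtain ⟨Ψ, hΨ⟩ : ∃ Ψ : {Ψ : G.H1 // G.mass Ψ = 1},
        (G.linEnergy α W Ψ.1 : EReal) < ((R / m : ℝ) : EReal) := by
      rw [← iInf_lt_iff, hlin, EReal.coe_lt_coe_iff, lt_div_iff₀ hm]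
      linarith
    refine iInf_lt_iff.2 ⟨⟨Ψ.1.smul √m, ?_⟩, EReal.coe_lt_coe_iff.2 ?_⟩
    · rw [mass_smul (Real.sqrt_nonneg m), Real.sq_sqrt hm.le, Ψ.2, mul_one]
    · refine (energy_le_linEnergy α W hμ _).trans_lt ?_
      rw [linEnergy_smul α W (Real.sqrt_nonneg m), Real.sq_sqrt hm.le]
      have := EReal.coe_lt_coe_iff.1 hΨ
      rw [lt_div_iff₀ hm] at this
      linarith

theorem massThreshold_pos [Nonempty X] (hG : G.Connected) {μ : ℝ} (hμ : 0 < μ) {α : V → ℝ}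
    {W : I ⊕ X → ℝ → ℝ} {E : ℝ} (hE0 : 0 < E) (hE : G.E0 α W = E) {Ψ : G.H1}
    (hΨ : G.mass Ψ = 1) : 0 < G.massThreshold α W μ := by
  rw [massThreshold, hE, EReal.toReal_coe]
  split_ifs with h
  · have := gammaConst_pos hμ h
    positivity
  · have : 0 < G.K62 := K62_pos hG (Ψ := Ψ) (by rw [hΨ]; exact one_pos)
    positivity

theorem critical_bound {K m : ℝ} (hK : 0 < K) (hm : 0 ≤ m) (h : m < √3 / K ^ 3) :
    K ^ 6 * m ^ 2 < 3 := by
  rw [lt_div_iff₀ (by positivity)] at h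
  have : (m * K ^ 3) ^ 2 < √3 ^ 2 := by gcongr
  rw [Real.sq_sqrt (by norm_num)] at this
  linarith

/-- Below the threshold the free energy is controlled from below, with a constant smaller than
`E₀`, up to terms which see only the compact core. -/
theorem exists_free_energy_ge [Nonempty X] (hG : G.Connected) {μ : ℝ} (hμ : 0 < μ) (hμ2 : μ ≤ 2)
    {α : V → ℝ} {W : I ⊕ X → ℝ → ℝ} {E : ℝ} (hE0 : 0 < E) (hE : G.E0 α W = E) {Ψ₁ : G.H1}
    (hΨ₁ : G.mass Ψ₁ = 1) {m : ℝ} (hm : 0 < m) (hmt : m < G.massThreshold α W μ) :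
    ∃ m' > m, ∃ E', 0 ≤ E' ∧ E' < E ∧ ∀ (B : ℝ) (Ψ : G.H1), 0 ≤ B →
      (∀ e, ∀ x ∈ G.dom e, ‖Ψ.val e x‖ ^ 2 ≤ B) → G.mass Ψ ≤ m' →
      -(E' * G.mass Ψ) -
        (∑ i, ∫ x, ‖Ψ.val (Sum.inl i) x‖ ^ (2 * μ + 2) ∂(G.edgeMeasure (Sum.inl i)) +
          √(B ^ μ) * ∑ x, ‖Ψ.val (Sum.inr x) 0‖ ^ 2) ≤
      G.kinetic Ψ - 1 / (μ + 1) * G.normPow (2 * μ + 2) Ψ.val := by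
  rw [massThreshold, hE, EReal.toReal_coe] at hmt
  split_ifs at hmt with hlt
  · have hγ := gammaConst_pos hμ hlt
    -- The room between `m` and `m'` is for the escaping parts, whose masses lie below `m'` only
    -- eventually.
    obtain ⟨m', hm', hm't⟩ := exists_between hmt
    have hm'0 : 0 < m' := hm.trans hm'
    have h2 : 0 < 2 - μ := by linarith
    refine ⟨m', hm', gammaConst μ * m' ^ (2 * μ / (2 - μ)), by positivity, ?_, ?_⟩
    -- The exponents in the threshold and in the half-line bound are reciprocal, so `m' < m*` is
    -- literally `γ m' ^ (2μ/(2 - μ)) < E`.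
    · have h3 : m' ^ (2 * μ / (2 - μ)) <
          ((E / gammaConst μ) ^ (1 / μ - 1 / 2)) ^ (2 * μ / (2 - μ)) := by gcongr
      rw [← Real.rpow_mul (by positivity), show (1 / μ - 1 / 2) * (2 * μ / (2 - μ)) = 1 by
        field_simp, Real.rpow_one, lt_div_iff₀ hγ] at h3
      linarith
    · intro B Ψ hB0 hB hmass
      set E' := gammaConst μ * m' ^ (2 * μ / (2 - μ))
      have hE' : 0 ≤ E' := by positivity
      rw [mass, kinetic, normPow_two, normPow_two, normPow, Fintype.sum_sum_type,
        Fintype.sum_sum_type, Fintype.sum_sum_type]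
      rw [mass, normPow_two] at hmass
      have hX : ∀ x, ∫ y, ‖Ψ.val (Sum.inr x) y‖ ^ 2 ∂(G.edgeMeasure (Sum.inr x)) ≤ m' :=
        fun x => (Finset.single_le_sum
          (f := fun e => ∫ y, ‖Ψ.val e y‖ ^ 2 ∂(G.edgeMeasure e))
          (fun _ _ => integral_nonneg fun _ => by positivity)
          (Finset.mem_univ (Sum.inr x))).trans hmass
      have h3 := Finset.sum_le_sum fun x (_ : x ∈ Finset.univ) =>
        Ψ.free_energy_external_ge x hμ hlt (fun y hy => hB (Sum.inr x) y hy) hm'0 (hX x)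
      rw [Finset.sum_sub_distrib, Finset.sum_sub_distrib, Finset.sum_neg_distrib,
        ← Finset.mul_sum, ← Finset.mul_sum, ← Finset.mul_sum] at h3
      have h4 : 0 ≤ ∑ i, ∫ x, ‖Ψ.val (Sum.inl i) x‖ ^ 2 ∂(G.edgeMeasure (Sum.inl i)) :=
        Finset.sum_nonneg fun _ _ => integral_nonneg fun _ => by positivity
      have h5 : 0 ≤ ∑ i, ∫ x, ‖Ψ.der (Sum.inl i) x‖ ^ 2 ∂(G.edgeMeasure (Sum.inl i)) :=
        Finset.sum_nonneg fun _ _ => integral_nonneg fun _ => by positivity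
      have h6 : 0 ≤ ∑ i, ∫ x, ‖Ψ.val (Sum.inl i) x‖ ^ (2 * μ + 2)
          ∂(G.edgeMeasure (Sum.inl i)) :=
        Finset.sum_nonneg fun _ _ => integral_norm_rpow_nonneg _ _ _
      have h7 : 1 / (μ + 1) * ∑ i, ∫ x, ‖Ψ.val (Sum.inl i) x‖ ^ (2 * μ + 2)
          ∂(G.edgeMeasure (Sum.inl i)) ≤ ∑ i, ∫ x, ‖Ψ.val (Sum.inl i) x‖ ^ (2 * μ + 2)
          ∂(G.edgeMeasure (Sum.inl i)) :=
        mul_le_of_le_one_left h6 ((div_le_one (by positivity)).2 (by linarith))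
      have h8 := mul_nonneg hE' h4
      rw [mul_add, mul_add]
      linarith
  · obtain rfl : μ = 2 := le_antisymm hμ2 (not_lt.1 hlt)
    have hK : 0 < G.K62 := K62_pos hG (Ψ := Ψ₁) (by rw [hΨ₁]; exact one_pos)
    obtain ⟨m', hm', hm't⟩ := exists_between hmt
    -- In the critical case the whole free energy is nonnegative below the threshold, since `K62 ^ 6
    -- * m' ^ 2 < 3`; hence `E' = 0`, and E₀ > 0 gives the gap.
    refine ⟨m', hm', 0, le_rfl, hE0, fun B Ψ hB0 hB hmass => ?_⟩
    have h1 := normPow_six_le hG Ψ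
    have h2 := critical_bound hK (hm.trans hm').le hm't
    have hN := mass_nonneg Ψ
    have hD := kinetic_nonneg Ψ
    have h3 : G.K62 ^ 6 * (G.kinetic Ψ * G.mass Ψ ^ 2) ≤ 3 * G.kinetic Ψ := by
      have : G.K62 ^ 6 * G.mass Ψ ^ 2 ≤ 3 := le_trans (by gcongr) h2.le
      nlinarith
    have h4 : 0 ≤ ∑ i, ∫ x, ‖Ψ.val (Sum.inl i) x‖ ^ ((2 : ℝ) * 2 + 2)
        ∂(G.edgeMeasure (Sum.inl i)) :=
      Finset.sum_nonneg fun _ _ => integral_norm_rpow_nonneg _ _ _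
    have h5 : 0 ≤ √(B ^ (2 : ℝ)) * ∑ x, ‖Ψ.val (Sum.inr x) 0‖ ^ 2 := by positivity
    have h6 : (2 : ℝ) * 2 + 2 = 6 := by norm_num
    rw [h6] at h4 ⊢
    linarith

/-- For t ≥ 1 the right side is at most (a + b + c) t^k with k = max(κ, 1) < 2. It is applied with t
= ‖Ψ'‖. -/
theorem exists_bound_of_quadratic_le {δ a b c κ : ℝ} (hδ : 0 < δ) (ha : 0 ≤ a) (hb : 0 ≤ b)
    (hc : 0 ≤ c) (hκ : κ < 2) :
    ∃ T, ∀ t : ℝ, 0 ≤ t → δ * t ^ 2 ≤ a + b * t + c * t ^ κ → t ≤ T := by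
  set k := max κ 1
  have hk2 : 0 < 2 - k := by
    have : k < 2 := max_lt hκ one_lt_two
    linarith
  refine ⟨max 1 (((a + b + c) / δ) ^ (1 / (2 - k))), fun t ht h => ?_⟩
  rcases le_total t 1 with h1 | h1
  · exact h1.trans (le_max_left _ _)
  refine le_trans ?_ (le_max_right _ _)
  have ht0 : 0 < t := by linarith
  have e1 : (1 : ℝ) ≤ t ^ k := Real.one_le_rpow h1 (le_trans zero_le_one (le_max_right _ _))
  have e2 : t ≤ t ^ k := Real.self_le_rpow_of_one_le h1 (le_max_right _ _)
  have e3 : t ^ κ ≤ t ^ k := Real.rpow_le_rpow_of_exponent_le h1 (le_max_left _ _)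
  have h2 : δ * t ^ 2 ≤ (a + b + c) * t ^ k := by
    have := mul_le_mul_of_nonneg_left e1 ha
    have := mul_le_mul_of_nonneg_left e2 hb
    have := mul_le_mul_of_nonneg_left e3 hc
    linarith
  have h3 : t ^ 2 = t ^ (2 - k) * t ^ k := by
    rw [← Real.rpow_add ht0]
    simp
  have h4 : t ^ (2 - k) ≤ (a + b + c) / δ := by
    rw [le_div_iff₀ hδ]
    rw [h3] at h2
    have : 0 < t ^ k := by positivity
    refine le_of_mul_le_mul_right ?_ this
    linarith
  calc t = (t ^ (2 - k)) ^ (1 / (2 - k)) := by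
        rw [← Real.rpow_mul ht, mul_one_div_cancel hk2.ne', Real.rpow_one]
    _ ≤ _ := by gcongr

/-- Sublevel sets of the energy at a mass below the threshold are bounded in `H¹(𝒢)`. -/
theorem exists_kinetic_le [Nonempty X] (hG : G.Connected) {μ : ℝ} (hμ : 0 < μ) (hμ2 : μ ≤ 2)
    {α : V → ℝ} {W : I ⊕ X → ℝ → ℝ} (hW : G.IsAdmissiblePotential μ W) {Ψ₁ : G.H1}
    (hΨ₁ : G.mass Ψ₁ = 1) {m : ℝ} (hm : 0 < m) (hmt : m < G.massThreshold α W μ) (K : ℝ) :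
    ∃ T, ∀ Ψ : G.H1, G.mass Ψ = m → G.energy α W μ Ψ ≤ K → G.kinetic Ψ ≤ T := by
  obtain ⟨C₁, hC₁, hlin⟩ := exists_le_linEnergy hG α hW
  have hbase : ∀ Ψ : G.H1, G.mass Ψ = m → G.energy α W μ Ψ ≤ K →
      √(G.kinetic Ψ) ^ 2 ≤ (|K| + m) + C₁ * √m * √(G.kinetic Ψ) +
        1 / (μ + 1) * G.normPow (2 * μ + 2) Ψ.val := by
    intro Ψ hmass hen
    rw [Real.sq_sqrt (kinetic_nonneg Ψ)]
    have h1 := hlin Ψ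
    rw [energy] at hen
    rw [hmass] at h1
    have := le_abs_self K
    linarith
  have hfin : ∀ T, (∀ Ψ : G.H1, G.mass Ψ = m → G.energy α W μ Ψ ≤ K → √(G.kinetic Ψ) ≤ T) →
      ∃ T, ∀ Ψ : G.H1, G.mass Ψ = m → G.energy α W μ Ψ ≤ K → G.kinetic Ψ ≤ T := by
    intro T hT
    refine ⟨T ^ 2, fun Ψ h1 h2 => ?_⟩
    rw [← Real.sq_sqrt (kinetic_nonneg Ψ)]
    have := hT Ψ h1 h2
    gcongr
  rcases hμ2.lt_or_eq with hlt | rfl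
  · obtain ⟨C, hC, hsup⟩ := exists_norm_sq_le hG
    obtain ⟨T, hT⟩ := exists_bound_of_quadratic_le (δ := 1) (a := |K| + m) (b := C₁ * √m)
      (c := (C * √m) ^ μ * m) one_pos (by positivity) (by positivity) (by positivity) hlt
    refine hfin T fun Ψ h1 h2 => hT _ (Real.sqrt_nonneg _) ?_
    have h3 := hbase Ψ h1 h2
    have h4 := Ψ.normPow_le hμ (hsup Ψ).2
    rw [h1, ← mul_assoc, Real.mul_rpow (by positivity) (by positivity)] at h4
    have h5 := G.normPow_nonneg (2 * μ + 2) Ψ.val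
    have h6 : 1 / (μ + 1) * G.normPow (2 * μ + 2) Ψ.val ≤ G.normPow (2 * μ + 2) Ψ.val :=
      mul_le_of_le_one_left h5 ((div_le_one (by positivity)).2 (by linarith))
    linarith
  · rw [massThreshold, if_neg (lt_irrefl _)] at hmt
    have hK : 0 < G.K62 := K62_pos hG (Ψ := Ψ₁) (by rw [hΨ₁]; exact one_pos)
    have hcrit := critical_bound hK hm.le hmt
    -- `δ` is the fraction of kinetic energy left after the critical Gagliardo–Nirenberg inequality
    -- has absorbed the nonlinear term.
    obtain ⟨T, hT⟩ := exists_bound_of_quadratic_le (δ := 1 - G.K62 ^ 6 * m ^ 2 / 3)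
      (a := |K| + m) (b := C₁ * √m) (c := 0) (κ := 0) (by linarith) (by positivity)
      (by positivity) le_rfl zero_lt_two
    refine hfin T fun Ψ h1 h2 => hT _ (Real.sqrt_nonneg _) ?_
    have h3 := hbase Ψ h1 h2
    have h4 := normPow_six_le hG Ψ
    rw [h1] at h4
    rw [show (2 : ℝ) * 2 + 2 = 6 by norm_num] at h3
    rw [sub_mul, Real.sq_sqrt (kinetic_nonneg Ψ)]
    rw [Real.sq_sqrt (kinetic_nonneg Ψ)] at h3
    linarith

/-- Only functions of nonpositive energy matter for the lower bound, and their kinetic energy is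
bounded. -/
theorem exists_energyInf_eq_coe [Nonempty X] (hG : G.Connected) {μ : ℝ} (hμ : 0 < μ) (hμ2 : μ ≤ 2)
    {α : V → ℝ} {W : I ⊕ X → ℝ → ℝ} (hW : G.IsAdmissiblePotential μ W) {E : ℝ}
    (hE : G.E0 α W = E) {Ψ₁ : G.H1} (hΨ₁ : G.mass Ψ₁ = 1) {m : ℝ} (hm : 0 < m)
    (hmt : m < G.massThreshold α W μ) : ∃ R : ℝ, G.energyInf α W μ m = R := by
  obtain ⟨T, hT⟩ := exists_kinetic_le hG hμ hμ2 hW hΨ₁ hm hmt 0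
  obtain ⟨C₁, hC₁, hlin⟩ := exists_le_linEnergy hG α hW
  obtain ⟨C, hC, hsup⟩ := exists_norm_sq_le hG
  have hge : ((-(C₁ * (√m * √T)) - m - (C * (√m * √T)) ^ μ * m : ℝ) : EReal) ≤
      G.energyInf α W μ m := by
    refine le_iInf fun Ψ => EReal.coe_le_coe_iff.2 ?_
    rcases le_total (G.energy α W μ Ψ.1) 0 with h | h
    · have h1 := Real.sqrt_le_sqrt (hT Ψ.1 Ψ.2 h)
      have h2 := hlin Ψ.1
      have h3 := Ψ.1.normPow_le hμ (hsup Ψ.1).2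
      rw [Ψ.2] at h2 h3
      have h4 : C₁ * (√m * √(G.kinetic Ψ.1)) ≤ C₁ * (√m * √T) := by gcongr
      have h5 : (C * (√m * √(G.kinetic Ψ.1))) ^ μ * m ≤ (C * (√m * √T)) ^ μ * m := by gcongr
      have h6 := G.normPow_nonneg (2 * μ + 2) Ψ.1.val
      have h7 : 1 / (μ + 1) * G.normPow (2 * μ + 2) Ψ.1.val ≤ G.normPow (2 * μ + 2) Ψ.1.val :=
        mul_le_of_le_one_left h6 ((div_le_one (by positivity)).2 (by linarith))
      have h8 := kinetic_nonneg Ψ.1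
      rw [energy]
      linarith
    · refine le_trans ?_ h
      have h1 : 0 ≤ C₁ * (√m * √T) := by positivity
      have h2 : 0 ≤ (C * (√m * √T)) ^ μ * m := by positivity
      linarith
  have hle := energyInf_le (μ := μ) hμ hE hm
  refine ⟨_, (EReal.coe_toReal (hle.trans_lt (EReal.coe_lt_top _)).ne ?_).symm⟩
  exact ((EReal.bot_lt_coe _).trans_le hge).ne'

end Thresholds
end MetricGraph

/-! ### Weak compactness in H¹ of the graph. -/

namespace MetricGraph
section Compactness

open MeasureTheory Set Filter Topology
open scoped ComplexConjugate

theorem eLpNorm_two_le {ν : Measure ℝ} {g : ℝ → ℂ} (hg : MemLp g 2 ν) {R : ℝ}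
    (hR : ∫ x, ‖g x‖ ^ 2 ∂ν ≤ R) : eLpNorm g 2 ν ≤ ENNReal.ofReal √R := by
  rw [hg.eLpNorm_eq_integral_rpow_norm two_ne_zero ENNReal.ofNat_ne_top]
  apply ENNReal.ofReal_le_ofReal
  rw [Real.sqrt_eq_rpow]
  simp only [ENNReal.toReal_ofNat, Real.rpow_ofNat, one_div]
  have : 0 ≤ ∫ x, ‖g x‖ ^ 2 ∂ν := integral_nonneg fun _ => by positivity
  gcongr

/-- Sequential weak compactness of bounded sets of `L²`. -/
theorem exists_subseq_tendsto_integral_mul {ν : Measure ℝ} [SFinite ν] {g : ℕ → ℝ → ℂ}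
    (hg : ∀ n, MemLp (g n) 2 ν) {R : ℝ} (hR : ∀ n, ∫ x, ‖g n x‖ ^ 2 ∂ν ≤ R) :
    ∃ (l : ℝ → ℂ) (φ : ℕ → ℕ), StrictMono φ ∧ MemLp l 2 ν ∧ ∀ h, MemLp h 2 ν →
      Tendsto (fun n => ∫ x, h x * g (φ n) x ∂ν) atTop (𝓝 (∫ x, h x * l x ∂ν)) := by
  have : Fact ((2 : ENNReal) ≠ ⊤) := ⟨ENNReal.ofNat_ne_top⟩
  set H := Lp ℂ 2 ν
  set x : ℕ → H := fun n => (hg n).toLp (g n)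
  set d : ℕ → WeakDual ℂ H := fun n =>
    StrongDual.toWeakDual (InnerProductSpace.toDual ℂ H (x n))
  have hd : ∀ n, d n ∈ WeakDual.toStrongDual ⁻¹'
      Metric.closedBall (0 : StrongDual ℂ H) √R := by
    intro n
    simp only [mem_preimage, mem_closedBall_zero_iff, d]
    change ‖InnerProductSpace.toDual ℂ H (x n)‖ ≤ √R
    rw [LinearIsometryEquiv.norm_map, Lp.norm_toLp]
    exact ENNReal.toReal_le_of_le_ofReal (Real.sqrt_nonneg _) (eLpNorm_two_le (hg n) (hR n))
  obtain ⟨ℓ, -, φ, hφ, hlim⟩ := WeakDual.isSeqCompact_closedBall ℂ H 0 √R hd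
  set y : H := (InnerProductSpace.toDual ℂ H).symm (WeakDual.toStrongDual ℓ)
  refine ⟨y, φ, hφ, Lp.memLp y, fun h hh => ?_⟩
  -- The pairing with `h` is bilinear whereas `inner` is conjugate-linear in its first argument.
  have hh' : MemLp (fun t => conj (h t)) 2 ν := hh.star
  set z : H := hh'.toLp _
  have hz : ∀ w : H, inner ℂ z w = ∫ t, h t * w t ∂ν := by
    intro w
    rw [L2.inner_def]
    apply integral_congr_ae
    filter_upwards [hh'.coeFn_toLp] with t ht
    rw [ht, RCLike.inner_apply, Complex.conj_conj, mul_comm]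
  have h1 : Tendsto (fun n => d (φ n) z) atTop (𝓝 (ℓ z)) :=
    ((WeakDual.eval_continuous z).tendsto ℓ).comp hlim
  have h2 : ∀ n, d n z = conj (inner ℂ z (x n)) := fun n => by
    rw [inner_conj_symm]
    rfl
  have h3 : ℓ z = conj (inner ℂ z y) := by
    rw [inner_conj_symm, ← InnerProductSpace.toDual_apply_apply,
      LinearIsometryEquiv.apply_symm_apply]
    rfl
  simp only [h2, h3] at h1
  have h4 := (Complex.continuous_conj.tendsto _).comp h1
  simp only [Function.comp_def, Complex.conj_conj, hz] at h4
  refine h4.congr fun n => ?_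
  apply integral_congr_ae
  filter_upwards [(hg (φ n)).coeFn_toLp] with t ht
  rw [ht]

variable {V I X : Type*} {G : MetricGraph V I X}

/-- Convergence of values everywhere, together with weak convergence of the derivatives. -/
structure TendstoWeakly (Ψs : ℕ → G.H1) (Ψ : G.H1) : Prop where
  vert : ∀ v, Tendsto (fun n => (Ψs n).vert v) atTop (𝓝 (Ψ.vert v))
  val : ∀ e, ∀ x ∈ G.dom e, Tendsto (fun n => (Ψs n).val e x) atTop (𝓝 (Ψ.val e x))
  der : ∀ e h, MemLp h 2 (G.edgeMeasure e) →
    Tendsto (fun n => ∫ x, h x * (Ψs n).der e x ∂(G.edgeMeasure e)) atTop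
      (𝓝 (∫ x, h x * Ψ.der e x ∂(G.edgeMeasure e)))

/-- The vertex at the left endpoint of an edge. -/
def start (G : MetricGraph V I X) : I ⊕ X → V := Sum.elim G.src G.base

theorem H1.val_zero (Ψ : G.H1) (e : I ⊕ X) : Ψ.val e 0 = Ψ.vert (G.start e) := by
  cases e with
  | inl i => exact Ψ.val_src i
  | inr x => exact Ψ.val_base x

theorem exists_subseq_der [Finite I] [Finite X] (Ψs : ℕ → G.H1) {T : ℝ}
    (hT : ∀ n e, ∫ x, ‖(Ψs n).der e x‖ ^ 2 ∂(G.edgeMeasure e) ≤ T) :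
    ∃ φ : ℕ → ℕ, StrictMono φ ∧ ∀ e, ∃ l, MemLp l 2 (G.edgeMeasure e) ∧
      ∀ h, MemLp h 2 (G.edgeMeasure e) →
        Tendsto (fun n => ∫ x, h x * (Ψs (φ n)).der e x ∂(G.edgeMeasure e)) atTop
          (𝓝 (∫ x, h x * l x ∂(G.edgeMeasure e))) := by
  classical
  have := Fintype.ofFinite I
  have := Fintype.ofFinite X
  suffices ∀ s : Finset (I ⊕ X), ∃ φ : ℕ → ℕ, StrictMono φ ∧ ∀ e ∈ s, ∃ l,
      MemLp l 2 (G.edgeMeasure e) ∧ ∀ h, MemLp h 2 (G.edgeMeasure e) →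
        Tendsto (fun n => ∫ x, h x * (Ψs (φ n)).der e x ∂(G.edgeMeasure e)) atTop
          (𝓝 (∫ x, h x * l x ∂(G.edgeMeasure e))) by
    obtain ⟨φ, hφ, h⟩ := this Finset.univ
    exact ⟨φ, hφ, fun e => h e (Finset.mem_univ e)⟩
  intro s
  induction s using Finset.induction_on with
  | empty => exact ⟨id, strictMono_id, by simp⟩
  | insert e s _ ih =>
    obtain ⟨φ, hφ, ih⟩ := ih
    obtain ⟨l, χ, hχ, hl, hlim⟩ := exists_subseq_tendsto_integral_mul
      (fun n => (Ψs (φ n)).memLp_der e) (fun n => hT (φ n) e)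
    refine ⟨φ ∘ χ, hφ.comp hχ, fun e' he' => ?_⟩
    rcases Finset.mem_insert.1 he' with rfl | he'
    · exact ⟨l, hl, hlim⟩
    · obtain ⟨l', hl', hlim'⟩ := ih e' he'
      exact ⟨l', hl', fun h hh => (hlim' h hh).comp hχ.tendsto_atTop⟩

/-- Fatou's lemma. -/
theorem memLp_two_of_tendsto {ν : Measure ℝ} {f : ℕ → ℝ → ℂ} {l : ℝ → ℂ}
    (hf : ∀ n, MemLp (f n) 2 ν) {R : ℝ} (hR : ∀ n, ∫ x, ‖f n x‖ ^ 2 ∂ν ≤ R)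
    (hlim : ∀ᵐ x ∂ν, Tendsto (fun n => f n x) atTop (𝓝 (l x))) : MemLp l 2 ν := by
  refine ⟨aestronglyMeasurable_of_tendsto_ae atTop (fun n => (hf n).1) hlim, ?_⟩
  refine (Lp.eLpNorm_lim_le_liminf_eLpNorm (fun n => (hf n).1) l hlim).trans_lt ?_
  refine lt_of_le_of_lt ?_ (ENNReal.ofReal_lt_top (r := √R))
  refine (liminf_le_limsup).trans (limsup_le_of_le (by isBoundedDefault) ?_)
  exact Eventually.of_forall fun n => eLpNorm_two_le (hf n) (hR n)

/-- Bounded sequences in `H¹(𝒢)` have weakly convergent subsequences. -/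
theorem exists_tendstoWeakly [Finite V] [Finite I] [Finite X] (Ψs : ℕ → G.H1) {T N B : ℝ}
    (hT : ∀ n e, ∫ x, ‖(Ψs n).der e x‖ ^ 2 ∂(G.edgeMeasure e) ≤ T)
    (hN : ∀ n e, ∫ x, ‖(Ψs n).val e x‖ ^ 2 ∂(G.edgeMeasure e) ≤ N)
    (hBv : ∀ n v, ‖(Ψs n).vert v‖ ≤ B) (hB : ∀ n e, ∀ x ∈ G.dom e, ‖(Ψs n).val e x‖ ≤ B) :
    ∃ (Ψ : G.H1) (φ : ℕ → ℕ), StrictMono φ ∧ TendstoWeakly (fun n => Ψs (φ n)) Ψ := by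
  have := Fintype.ofFinite V
  obtain ⟨c, -, φ₁, hφ₁, hc⟩ := tendsto_subseq_of_bounded
    (s := Metric.closedBall (0 : V → ℂ) (max B 0)) Metric.isBounded_closedBall
    (x := fun n => (Ψs n).vert) fun n => by
      rw [mem_closedBall_zero_iff, pi_norm_le_iff_of_nonneg (le_max_right _ _)]
      exact fun v => (hBv n v).trans (le_max_left _ _)
  obtain ⟨φ₂, hφ₂, hder⟩ := exists_subseq_der (fun n => Ψs (φ₁ n)) (fun n => hT (φ₁ n))
  choose l hl hlim using hder
  set u : ℕ → G.H1 := fun n => Ψs (φ₁ (φ₂ n)) with hu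
  have hvert : ∀ v, Tendsto (fun n => (u n).vert v) atTop (𝓝 (c v)) := fun v =>
    (tendsto_pi_nhds.1 hc v).comp hφ₂.tendsto_atTop
  -- The limit is built as a primitive of the weak limit of the derivatives, starting from the limit
  -- at the vertex. Continuity is then automatic, and testing the weak convergence with indicators
  -- of `(0, x]` gives pointwise convergence.
  set f : I ⊕ X → ℝ → ℂ := fun e x =>
    c (G.start e) + ∫ t in (0 : ℝ)..x, (G.dom e).indicator (l e) t with hf
  have hval : ∀ e, ∀ x ∈ G.dom e, Tendsto (fun n => (u n).val e x) atTop (𝓝 (f e x)) := by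
    intro e x hx
    have hx0 := nonneg_of_mem_dom hx
    have hsub : Ioc 0 x ⊆ G.dom e :=
      Ioc_subset_Icc_self.trans (Icc_subset_dom (G.zero_mem_dom e) hx)
    have hind : MemLp ((Ioc 0 x).indicator fun _ => (1 : ℂ)) 2 (G.edgeMeasure e) := by
      apply memLp_indicator_const _ measurableSet_Ioc
      right
      refine ((Measure.restrict_apply_le _ _).trans_lt ?_).ne
      simp
    have e1 : ∀ g : ℝ → ℂ,
        ∫ t, (Ioc 0 x).indicator (fun _ => (1 : ℂ)) t * g t ∂(G.edgeMeasure e) =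
          ∫ t in Ioc 0 x, g t := by
      intro g
      have : ∀ t, (Ioc 0 x).indicator (fun _ => (1 : ℂ)) t * g t = (Ioc 0 x).indicator g t := by
        intro t
        by_cases ht : t ∈ Ioc 0 x <;> simp [ht]
      simp_rw [this]
      rw [integral_indicator measurableSet_Ioc, edgeMeasure,
        Measure.restrict_restrict measurableSet_Ioc, inter_eq_left.2 hsub]
    have h1 := hlim e _ hind
    simp only [e1] at h1
    have h2 : f e x = c (G.start e) + ∫ t in Ioc 0 x, l e t := by
      simp only [hf]
      rw [intervalIntegral.integral_of_le hx0]
      congr 1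
      apply setIntegral_congr_fun measurableSet_Ioc
      intro t ht
      simp [hsub ht]
    rw [h2]
    refine ((hvert (G.start e)).add h1).congr fun n => ?_
    rw [← intervalIntegral.integral_of_le hx0]
    change _ + ∫ t in (0 : ℝ)..x, (u n).der e t = _
    rw [(u n).integral_der (G.zero_mem_dom e) hx hx0, (u n).val_zero]
    ring
  have hfc : ∀ e, Continuous (f e) := by
    intro e
    have hi : MemLp ((G.dom e).indicator (l e)) 2 volume := by
      rw [memLp_indicator_iff_restrict (G.measurableSet_dom e)]
      exact hl e
    refine continuous_const.add (intervalIntegral.continuous_primitive (fun a b => ?_) 0)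
    have : LocallyIntegrable ((G.dom e).indicator (l e)) volume :=
      hi.locallyIntegrable one_le_two
    exact intervalIntegrable_iff.2
      ((this.integrableOn_isCompact isCompact_uIcc).mono_set uIoc_subset_uIcc)
  have hae : ∀ e, ∀ᵐ x ∂(G.edgeMeasure e),
      Tendsto (fun n => (u n).val e x) atTop (𝓝 (f e x)) := fun e =>
    (G.ae_mem_dom e).mono fun x hx => hval e x hx
  have hfm : ∀ e, MemLp (f e) 2 (G.edgeMeasure e) := fun e =>
    memLp_two_of_tendsto (fun n => (u n).memLp_val e) (fun n => hN _ e) (hae e)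
  have hend : ∀ e x v, x ∈ G.dom e → (∀ n, (u n).val e x = (u n).vert v) → f e x = c v := by
    intro e x v hx h
    refine tendsto_nhds_unique (hval e x hx) ?_
    simp only [h]
    exact hvert v
  refine ⟨⟨f, l, c, fun e => (hfc e).continuousOn, hfm, hl, fun e φ h1 h2 h3 => ?_,
    fun i => hend _ _ _ (G.zero_mem_dom _) fun n => (u n).val_src i,
    fun i => hend _ _ _ ⟨(G.len_pos i).le, le_rfl⟩ fun n => (u n).val_tgt i,
    fun x => hend _ _ _ (G.zero_mem_dom _) fun n => (u n).val_base x⟩, φ₁ ∘ φ₂, hφ₁.comp hφ₂,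
    ⟨hvert, hval, fun e h hh => hlim e h hh⟩⟩
  have hd : Continuous (deriv φ) := h1.continuous_deriv (by simp)
  have l1 : Tendsto (fun n => ∫ x in G.dom e, ((deriv φ x : ℝ) : ℂ) * (u n).val e x) atTop
      (𝓝 (∫ x in G.dom e, ((deriv φ x : ℝ) : ℂ) * f e x)) := by
    refine tendsto_integral_of_dominated_convergence (fun x => ‖deriv φ x‖ * B) ?_ ?_ ?_ ?_
    · exact fun n => (Complex.continuous_ofReal.comp hd).aestronglyMeasurable.mul
        ((u n).memLp_val e).aestronglyMeasurable
    · exact ((hd.norm.integrable_of_hasCompactSupport h2.deriv.norm).mul_const B).integrableOn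
    · intro n
      filter_upwards [G.ae_mem_dom e] with x hx
      rw [norm_mul, Complex.norm_real]
      gcongr
      exact hB _ e x hx
    · filter_upwards [hae e] with x hx
      exact hx.const_mul _
  have l2 : Tendsto (fun n => -∫ x in G.dom e, (φ x : ℂ) * (u n).der e x) atTop
      (𝓝 (-∫ x in G.dom e, (φ x : ℂ) * l e x)) := by
    refine Tendsto.neg (hlim e _ ?_)
    change MemLp _ 2 (volume.restrict (G.dom e))
    exact (Complex.continuous_ofReal.comp h1.continuous).memLp_of_hasCompactSupport
      (h2.comp_left (g := ((↑) : ℝ → ℂ)) Complex.ofReal_zero)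
  refine tendsto_nhds_unique l1 (l2.congr fun n => ?_)
  exact ((u n).isWeakDeriv e φ h1 h2 h3).symm

end Compactness
end MetricGraph

/-! ### Inequalities and limits for the cross terms. -/

namespace MetricGraph
section Splitting

open MeasureTheory Set Filter Topology
open scoped ComplexConjugate

theorem norm_add_sq_complex (a b : ℂ) :
    ‖a + b‖ ^ 2 = ‖a‖ ^ 2 + ‖b‖ ^ 2 + 2 * (conj a * b).re := by
  rw [Complex.sq_norm, Complex.sq_norm, Complex.sq_norm, Complex.normSq_add, ← Complex.conj_re,
    map_mul, Complex.conj_conj]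

theorem abs_norm_add_sq_sub_le (a b : ℂ) :
    |‖a + b‖ ^ 2 - ‖a‖ ^ 2 - ‖b‖ ^ 2| ≤ 2 * (‖a‖ * ‖b‖) := by
  rw [norm_add_sq_complex, show ‖a‖ ^ 2 + ‖b‖ ^ 2 + 2 * (conj a * b).re - ‖a‖ ^ 2 - ‖b‖ ^ 2 =
    2 * (conj a * b).re by ring, abs_mul, abs_two]
  gcongr
  refine (Complex.abs_re_le_norm _).trans ?_
  rw [norm_mul, RCLike.norm_conj]

/-- A one-sided substitute for the Brezis–Lieb lemma. With y ≤ x, Bernoulli's inequality at x/(x +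
y) bounds the increment by p(x + y)^{p-1} y for p = 2μ + 2, and x + y ≤ 2x turns this into a
multiple of xy. -/
theorem add_rpow_le {μ : ℝ} (hμ : 0 < μ) {x y B : ℝ} (hx : 0 ≤ x) (hy : 0 ≤ y) (hxB : x ^ 2 ≤ B)
    (hyB : y ^ 2 ≤ B) : (x + y) ^ (2 * μ + 2) ≤ x ^ (2 * μ + 2) + y ^ (2 * μ + 2) +
      (2 * μ + 2) * (2 * (4 * B) ^ μ) * (x * y) := by
  wlog hxy : y ≤ x generalizing x y
  · have := this hy hx hyB hxB (le_of_not_ge hxy)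
    rw [add_comm x y, mul_comm x y]
    linarith
  rcases (add_nonneg hx hy).eq_or_lt with h0 | h0
  · rw [← h0, Real.zero_rpow (by positivity)]
    have : 0 ≤ B := (sq_nonneg x).trans hxB
    positivity
  have h1 := one_add_mul_self_le_rpow_one_add (s := -(y / (x + y)))
    (by have : y / (x + y) ≤ 1 := (div_le_one h0).2 (by linarith)
        linarith) (show 1 ≤ 2 * μ + 2 by linarith)
  have e1 : 1 + -(y / (x + y)) = x / (x + y) := by field_simp; ring
  rw [e1, Real.div_rpow hx h0.le, le_div_iff₀ (by positivity)] at h1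
  have e2 : (x + y) ^ (2 * μ + 2) = ((x + y) ^ 2) ^ μ * (x + y) * (x + y) := by
    rw [rpow_two_mul_add_two hμ h0.le]
    ring
  have h2 : (2 * μ + 2) * (y / (x + y)) * (x + y) ^ (2 * μ + 2) =
      (2 * μ + 2) * (((x + y) ^ 2) ^ μ * (x + y) * y) := by
    rw [e2]
    field_simp
  have h3 : ((x + y) ^ 2) ^ μ ≤ (4 * B) ^ μ := by
    apply Real.rpow_le_rpow (by positivity) _ hμ.le
    nlinarith [sq_nonneg (x - y)]
  have h4 : ((x + y) ^ 2) ^ μ * (x + y) * y ≤ (4 * B) ^ μ * (2 * x) * y := by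
    have hB0 : 0 ≤ B := (sq_nonneg x).trans hxB
    have : 0 ≤ (4 * B) ^ μ := by positivity
    gcongr
    linarith
  have h5 : 0 ≤ y ^ (2 * μ + 2) := by positivity
  have h6 : (2 * μ + 2) * (((x + y) ^ 2) ^ μ * (x + y) * y) ≤
      (2 * μ + 2) * ((4 * B) ^ μ * (2 * x) * y) := by gcongr
  linarith

/-- The product of a fixed function and a bounded sequence converging to zero pointwise. -/
theorem tendsto_integral_norm_mul_norm {ν : Measure ℝ} {f : ℝ → ℂ} {g : ℕ → ℝ → ℂ}
    (hf : MemLp f 2 ν) (hg : ∀ n, MemLp (g n) 2 ν) {R : ℝ}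
    (hR : ∀ n, ∫ x, ‖g n x‖ ^ 2 ∂ν ≤ R)
    (hlim : ∀ᵐ x ∂ν, Tendsto (fun n => g n x) atTop (𝓝 0)) :
    Tendsto (fun n => ∫ x, ‖f x‖ * ‖g n x‖ ∂ν) atTop (𝓝 0) := by
  have hR0 : 0 ≤ R := le_trans (integral_nonneg fun _ => by positivity) (hR 0)
  -- There is no common dominating function for `g n`, but the excess of `‖f‖‖g‖` over `ε‖g‖²` is
  -- dominated by `‖f‖² / (4ε)`, and the rest is at most `ε R`.
  have key : ∀ ε > 0, Tendsto
      (fun n => ∫ x, max (‖f x‖ * ‖g n x‖ - ε * ‖g n x‖ ^ 2) 0 ∂ν) atTop (𝓝 0) := by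
    intro ε hε
    suffices h : Tendsto (fun n => ∫ x, max (‖f x‖ * ‖g n x‖ - ε * ‖g n x‖ ^ 2) 0 ∂ν) atTop
        (𝓝 (∫ _, (0 : ℝ) ∂ν)) by rwa [integral_zero] at h
    refine tendsto_integral_of_dominated_convergence (fun x => 1 / (4 * ε) * ‖f x‖ ^ 2) ?_
      ((integrable_norm_sq hf).const_mul _) ?_ ?_
    · intro n
      exact ((hf.1.norm.mul (hg n).1.norm).sub
        (((hg n).1.norm.pow 2).const_mul ε)).sup aestronglyMeasurable_const
    · intro n
      filter_upwards with x
      rw [Real.norm_of_nonneg (le_max_right _ _)]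
      refine max_le ?_ (by positivity)
      rw [div_mul_eq_mul_div, one_mul, le_div_iff₀ (by positivity)]
      nlinarith [sq_nonneg (‖f x‖ - 2 * ε * ‖g n x‖)]
    · filter_upwards [hlim] with x hx
      have h1 := hx.norm
      rw [norm_zero] at h1
      have h2 := (((h1.const_mul ‖f x‖).sub ((h1.pow 2).const_mul ε)).max
        (tendsto_const_nhds (x := (0 : ℝ))))
      simpa using h2
  rw [Metric.tendsto_atTop]
  intro δ hδ
  set ε := δ / (2 * (R + 1)) with hε
  have hε0 : 0 < ε := by positivity
  obtain ⟨N, hN⟩ := Metric.tendsto_atTop.1 (key ε hε0) (δ / 2) (by positivity)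
  refine ⟨N, fun n hn => ?_⟩
  have h1 := hN n hn
  rw [Real.dist_eq, sub_zero] at h1 ⊢
  rw [abs_of_nonneg (integral_nonneg fun _ => by positivity)]
  have hi1 := integrable_norm_mul_norm hf (hg n)
  have hi2 := (integrable_norm_sq (hg n)).const_mul ε
  have h2 : ∫ x, ‖f x‖ * ‖g n x‖ ∂ν ≤
      ∫ x, max (‖f x‖ * ‖g n x‖ - ε * ‖g n x‖ ^ 2) 0 ∂ν + ε * ∫ x, ‖g n x‖ ^ 2 ∂ν := by
    have hi3 : Integrable (fun x => max (‖f x‖ * ‖g n x‖ - ε * ‖g n x‖ ^ 2) 0) ν :=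
      (hi1.sub hi2).sup (integrable_zero _ _ _)
    rw [← integral_const_mul, ← integral_add hi3 hi2]
    refine integral_mono hi1 (hi3.add hi2) fun x => ?_
    have := le_max_left (‖f x‖ * ‖g n x‖ - ε * ‖g n x‖ ^ 2) 0
    linarith
  have h3 : ε * ∫ x, ‖g n x‖ ^ 2 ∂ν ≤ δ / 2 := by
    have : ε * ∫ x, ‖g n x‖ ^ 2 ∂ν ≤ ε * (R + 1) := by
      gcongr
      linarith [hR n]
    have e : ε * (R + 1) = δ / 2 := by rw [hε]; field_simp
    linarith
  linarith [le_abs_self (∫ x, max (‖f x‖ * ‖g n x‖ - ε * ‖g n x‖ ^ 2) 0 ∂ν)]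

/-- Against a bounded sequence converging to zero pointwise, the integrable part of a weight
contributes a vanishing amount. -/
theorem IsWeight.tendsto_integral_mul {ν : Measure ℝ} {w A : ℝ → ℝ} {b B : ℝ}
    (hw : IsWeight ν w A b) {h : ℕ → ℝ → ℝ} (hi : ∀ n, Integrable (h n) ν)
    (hB : ∀ n, ∀ᵐ x ∂ν, 0 ≤ h n x ∧ h n x ≤ B)
    (hlim : ∀ᵐ x ∂ν, Tendsto (fun n => h n x) atTop (𝓝 0)) :
    ∃ r : ℕ → ℝ, Tendsto r atTop (𝓝 0) ∧
      ∀ n, ∫ x, w x * h n x ∂ν ≤ r n + b * ∫ x, h n x ∂ν := by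
  have hAi : ∀ n, Integrable (fun x => A x * h n x) ν := fun n => by
    refine (hw.integrable.mul_const B).mono' (hw.integrable.1.mul (hi n).1) ?_
    filter_upwards [hB n] with x hx
    rw [norm_mul, Real.norm_of_nonneg (hw.bound_nonneg x), Real.norm_of_nonneg hx.1]
    exact mul_le_mul_of_nonneg_left hx.2 (hw.bound_nonneg x)
  refine ⟨fun n => ∫ x, A x * h n x ∂ν, ?_, fun n => ?_⟩
  · rw [← integral_zero ℝ ℝ (μ := ν)]
    refine tendsto_integral_of_dominated_convergence (fun x => A x * B) (fun n => (hAi n).1)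
      (hw.integrable.mul_const B) (fun n => ?_) ?_
    · filter_upwards [hB n] with x hx
      rw [norm_mul, Real.norm_of_nonneg (hw.bound_nonneg x), Real.norm_of_nonneg hx.1]
      exact mul_le_mul_of_nonneg_left hx.2 (hw.bound_nonneg x)
    · filter_upwards [hlim] with x hx
      simpa using hx.const_mul (A x)
  · rw [← integral_const_mul, ← integral_add (hAi n) ((hi n).const_mul b)]
    refine integral_mono_ae (hw.integrable_mul (hi n) (B := B) ?_)
      ((hAi n).add ((hi n).const_mul b)) ?_
    · filter_upwards [hB n] with x hx
      rw [Real.norm_of_nonneg hx.1]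
      exact hx.2
    · filter_upwards [hB n, hw.le] with x hx h1
      have h2 : w x * h n x ≤ (A x + b) * h n x := mul_le_mul_of_nonneg_right h1 hx.1
      linarith

end Splitting
end MetricGraph

/-! ### Asymptotic splitting of mass and energy along a weak limit. -/

namespace MetricGraph
section WeakSplitting

open MeasureTheory Set Filter Topology
open scoped ComplexConjugate

variable {V I X : Type*} {G : MetricGraph V I X} {u : ℕ → G.H1} {Ψ : G.H1}

theorem H1.val_eq_add_sub (Φ Ψ : G.H1) (e : I ⊕ X) (x : ℝ) :
    Φ.val e x = Ψ.val e x + (Φ.sub Ψ).val e x := by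
  simp [H1.sub]

theorem H1.der_eq_add_sub (Φ Ψ : G.H1) (e : I ⊕ X) (x : ℝ) :
    Φ.der e x = Ψ.der e x + (Φ.sub Ψ).der e x := by
  simp [H1.sub]

theorem norm_sub_sq_le (a b : ℂ) : ‖a - b‖ ^ 2 ≤ 2 * ‖a‖ ^ 2 + 2 * ‖b‖ ^ 2 := by
  have h := norm_sub_le a b
  have h1 : ‖a - b‖ ^ 2 ≤ (‖a‖ + ‖b‖) ^ 2 := by gcongr
  nlinarith [sq_nonneg (‖a‖ - ‖b‖)]

theorem TendstoWeakly.norm_sq_le (h : TendstoWeakly u Ψ) {B : ℝ} {e : I ⊕ X}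
    (hB : ∀ n, ∀ x ∈ G.dom e, ‖(u n).val e x‖ ^ 2 ≤ B) :
    ∀ x ∈ G.dom e, ‖Ψ.val e x‖ ^ 2 ≤ B := fun x hx =>
  le_of_tendsto' ((h.val e x hx).norm.pow 2) fun n => hB n x hx

theorem TendstoWeakly.sub_norm_sq_le (h : TendstoWeakly u Ψ) {B : ℝ} {e : I ⊕ X}
    (hB : ∀ n, ∀ x ∈ G.dom e, ‖(u n).val e x‖ ^ 2 ≤ B) (n : ℕ) :
    ∀ x ∈ G.dom e, ‖((u n).sub Ψ).val e x‖ ^ 2 ≤ 4 * B := fun x hx => by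
  have h1 := norm_sub_sq_le ((u n).val e x) (Ψ.val e x)
  have h2 := hB n x hx
  have h3 := h.norm_sq_le hB x hx
  change ‖(u n).val e x - Ψ.val e x‖ ^ 2 ≤ _
  linarith

theorem TendstoWeakly.sub_val (h : TendstoWeakly u Ψ) (e : I ⊕ X) :
    ∀ x ∈ G.dom e, Tendsto (fun n => ((u n).sub Ψ).val e x) atTop (𝓝 0) := fun x hx => by
  have := (h.val e x hx).sub_const (Ψ.val e x)
  rwa [sub_self] at this

theorem integral_sub_norm_sq_le {N : ℝ} {e : I ⊕ X}
    (hN : ∀ n, ∫ x, ‖(u n).val e x‖ ^ 2 ∂(G.edgeMeasure e) ≤ N) (n : ℕ) :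
    ∫ x, ‖((u n).sub Ψ).val e x‖ ^ 2 ∂(G.edgeMeasure e) ≤
      2 * N + 2 * ∫ x, ‖Ψ.val e x‖ ^ 2 ∂(G.edgeMeasure e) := by
  have h1 := (integrable_norm_sq ((u n).memLp_val e)).const_mul 2
  have h2 := (integrable_norm_sq (Ψ.memLp_val e)).const_mul 2
  have h3 : ∫ x, ‖((u n).sub Ψ).val e x‖ ^ 2 ∂(G.edgeMeasure e) ≤
      2 * ∫ x, ‖(u n).val e x‖ ^ 2 ∂(G.edgeMeasure e) +
        2 * ∫ x, ‖Ψ.val e x‖ ^ 2 ∂(G.edgeMeasure e) := by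
    rw [← integral_const_mul, ← integral_const_mul, ← integral_add h1 h2]
    exact integral_mono (integrable_norm_sq (((u n).sub Ψ).memLp_val e)) (h1.add h2)
      fun x => norm_sub_sq_le _ _
  linarith [hN n]

theorem TendstoWeakly.cross (h : TendstoWeakly u Ψ) {N : ℝ} {e : I ⊕ X}
    (hN : ∀ n, ∫ x, ‖(u n).val e x‖ ^ 2 ∂(G.edgeMeasure e) ≤ N) :
    Tendsto (fun n => ∫ x, ‖Ψ.val e x‖ * ‖((u n).sub Ψ).val e x‖ ∂(G.edgeMeasure e)) atTop
      (𝓝 0) :=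
  tendsto_integral_norm_mul_norm (Ψ.memLp_val e) (fun n => ((u n).sub Ψ).memLp_val e)
    (fun n => integral_sub_norm_sq_le hN n)
    ((G.ae_mem_dom e).mono fun x hx => h.sub_val e x hx)

theorem abs_integral_sub_le (Φ Ψ : G.H1) (e : I ⊕ X) :
    |∫ x, ‖Φ.val e x‖ ^ 2 ∂(G.edgeMeasure e) - ∫ x, ‖Ψ.val e x‖ ^ 2 ∂(G.edgeMeasure e) -
      ∫ x, ‖(Φ.sub Ψ).val e x‖ ^ 2 ∂(G.edgeMeasure e)| ≤
    2 * ∫ x, ‖Ψ.val e x‖ * ‖(Φ.sub Ψ).val e x‖ ∂(G.edgeMeasure e) := by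
  have h1 := integrable_norm_sq (Φ.memLp_val e)
  have h2 := integrable_norm_sq (Ψ.memLp_val e)
  have h3 := integrable_norm_sq ((Φ.sub Ψ).memLp_val e)
  have h4 := integrable_norm_mul_norm (Ψ.memLp_val e) ((Φ.sub Ψ).memLp_val e)
  have e1 : ∫ x, ‖Φ.val e x‖ ^ 2 ∂(G.edgeMeasure e) - ∫ x, ‖Ψ.val e x‖ ^ 2 ∂(G.edgeMeasure e) -
      ∫ x, ‖(Φ.sub Ψ).val e x‖ ^ 2 ∂(G.edgeMeasure e) =
      ∫ x, (‖Φ.val e x‖ ^ 2 - ‖Ψ.val e x‖ ^ 2 - ‖(Φ.sub Ψ).val e x‖ ^ 2)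
        ∂(G.edgeMeasure e) := by
    have h5 : Integrable (fun x => ‖Φ.val e x‖ ^ 2 - ‖Ψ.val e x‖ ^ 2) (G.edgeMeasure e) :=
      h1.sub h2
    rw [← integral_sub h1 h2, ← integral_sub h5 h3]
  rw [e1, ← integral_const_mul]
  refine (abs_integral_le_integral_abs).trans ?_
  refine integral_mono ((h1.sub h2).sub h3).abs (h4.const_mul 2) fun x => ?_
  have := abs_norm_add_sq_sub_le (Ψ.val e x) ((Φ.sub Ψ).val e x)
  rwa [← Φ.val_eq_add_sub] at this

/-- The discrepancy is twice the real part of the pairing of Ψ' with the difference of the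
derivatives, which vanishes by weak convergence alone. -/
theorem TendstoWeakly.kinetic_edge (h : TendstoWeakly u Ψ) (e : I ⊕ X) :
    Tendsto (fun n => ∫ x, ‖(u n).der e x‖ ^ 2 ∂(G.edgeMeasure e) -
      ∫ x, ‖Ψ.der e x‖ ^ 2 ∂(G.edgeMeasure e) -
      ∫ x, ‖((u n).sub Ψ).der e x‖ ^ 2 ∂(G.edgeMeasure e)) atTop (𝓝 0) := by
  have hstar : MemLp (fun x => conj (Ψ.der e x)) 2 (G.edgeMeasure e) := (Ψ.memLp_der e).star
  have hmul : ∀ n, Integrable (fun x => conj (Ψ.der e x) * ((u n).sub Ψ).der e x)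
      (G.edgeMeasure e) := fun n => hstar.integrable_mul (((u n).sub Ψ).memLp_der e)
  have e1 : ∀ n, ∫ x, ‖(u n).der e x‖ ^ 2 ∂(G.edgeMeasure e) -
      ∫ x, ‖Ψ.der e x‖ ^ 2 ∂(G.edgeMeasure e) -
      ∫ x, ‖((u n).sub Ψ).der e x‖ ^ 2 ∂(G.edgeMeasure e) =
      2 * (∫ x, conj (Ψ.der e x) * ((u n).sub Ψ).der e x ∂(G.edgeMeasure e)).re := by
    intro n
    have h1 := integrable_norm_sq ((u n).memLp_der e)
    have h2 := integrable_norm_sq (Ψ.memLp_der e)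
    have h3 := integrable_norm_sq (((u n).sub Ψ).memLp_der e)
    have h4 : (∫ x, conj (Ψ.der e x) * ((u n).sub Ψ).der e x ∂(G.edgeMeasure e)).re =
        ∫ x, (conj (Ψ.der e x) * ((u n).sub Ψ).der e x).re ∂(G.edgeMeasure e) :=
      (integral_re (hmul n)).symm
    have h5 : Integrable (fun x => ‖(u n).der e x‖ ^ 2 - ‖Ψ.der e x‖ ^ 2) (G.edgeMeasure e) :=
      h1.sub h2
    rw [h4, ← integral_const_mul, ← integral_sub h1 h2, ← integral_sub h5 h3]
    apply integral_congr_ae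
    filter_upwards with x
    have := norm_add_sq_complex (Ψ.der e x) (((u n).sub Ψ).der e x)
    rw [← (u n).der_eq_add_sub] at this
    simp only [this]
    ring
  simp only [e1]
  have h1 := (h.der e _ hstar).sub_const (∫ x, conj (Ψ.der e x) * Ψ.der e x ∂(G.edgeMeasure e))
  rw [sub_self] at h1
  have h2 : Tendsto (fun n => ∫ x, conj (Ψ.der e x) * ((u n).sub Ψ).der e x ∂(G.edgeMeasure e))
      atTop (𝓝 0) := by
    refine h1.congr fun n => ?_
    have i1 : Integrable (fun x => conj (Ψ.der e x) * (u n).der e x) (G.edgeMeasure e) :=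
      hstar.integrable_mul ((u n).memLp_der e)
    have i2 : Integrable (fun x => conj (Ψ.der e x) * Ψ.der e x) (G.edgeMeasure e) :=
      hstar.integrable_mul (Ψ.memLp_der e)
    rw [← integral_sub i1 i2]
    apply integral_congr_ae
    filter_upwards with x
    simp only [H1.sub]
    exact (mul_sub _ _ _).symm
  have h3 := ((Complex.continuous_re.tendsto _).comp h2).const_mul 2
  simpa using h3

/-- Only a lower bound is needed, so the square of the difference weighted by `W₊` is discarded by
sign. Weighted by `W₋` it vanishes in the limit, because `W₋` is integrable up to an arbitrarily
small constant. The cross terms vanish for both weights. -/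
theorem TendstoWeakly.potential_edge (h : TendstoWeakly u Ψ) {N B : ℝ} {e : I ⊕ X}
    (hN : ∀ n, ∫ x, ‖(u n).val e x‖ ^ 2 ∂(G.edgeMeasure e) ≤ N)
    (hB : ∀ n, ∀ x ∈ G.dom e, ‖(u n).val e x‖ ^ 2 ≤ B) {W Wp Wm Ap : ℝ → ℝ} {b : ℝ}
    (hW : ∀ᵐ x ∂(G.edgeMeasure e), W x = Wp x - Wm x)
    (hp : IsWeight (G.edgeMeasure e) Wp Ap b)
    (hm : ∀ ε > 0, ∃ A, IsWeight (G.edgeMeasure e) Wm A ε) :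
    ∃ r : ℕ → ℝ, Tendsto r atTop (𝓝 0) ∧ ∀ n,
      ∫ x, W x * ‖Ψ.val e x‖ ^ 2 ∂(G.edgeMeasure e) - r n ≤
        ∫ x, W x * ‖(u n).val e x‖ ^ 2 ∂(G.edgeMeasure e) := by
  set ν := G.edgeMeasure e
  have hB0 : 0 ≤ B := (sq_nonneg _).trans (hB 0 0 (G.zero_mem_dom e))
  set F : ℕ → ℝ → ℝ := fun n x => ‖Ψ.val e x‖ * ‖((u n).sub Ψ).val e x‖ with hF
  set S : ℕ → ℝ → ℝ := fun n x => ‖((u n).sub Ψ).val e x‖ ^ 2 with hS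
  have hFi : ∀ n, Integrable (F n) ν := fun n =>
    integrable_norm_mul_norm (Ψ.memLp_val e) (((u n).sub Ψ).memLp_val e)
  have hSi : ∀ n, Integrable (S n) ν := fun n =>
    integrable_norm_sq (((u n).sub Ψ).memLp_val e)
  have hFB : ∀ n, ∀ᵐ x ∂ν, 0 ≤ F n x ∧ F n x ≤ 5 * B := fun n => by
    filter_upwards [G.ae_mem_dom e] with x hx
    refine ⟨by positivity, ?_⟩
    have h1 := h.norm_sq_le hB x hx
    have h2 := h.sub_norm_sq_le hB n x hx
    simp only [hF]
    nlinarith [sq_nonneg (‖Ψ.val e x‖ - ‖((u n).sub Ψ).val e x‖)]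
  have hSB : ∀ n, ∀ᵐ x ∂ν, 0 ≤ S n x ∧ S n x ≤ 4 * B := fun n =>
    ((u n).sub Ψ).ae_norm_sq_le (h.sub_norm_sq_le hB n)
  have hF0 : ∀ᵐ x ∂ν, Tendsto (fun n => F n x) atTop (𝓝 0) := by
    filter_upwards [G.ae_mem_dom e] with x hx
    simpa using (h.sub_val e x hx).norm.const_mul ‖Ψ.val e x‖
  have hS0 : ∀ᵐ x ∂ν, Tendsto (fun n => S n x) atTop (𝓝 0) := by
    filter_upwards [G.ae_mem_dom e] with x hx
    simpa using (h.sub_val e x hx).norm.pow 2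
  have hcross := h.cross hN
  have hw : ∀ (w A : ℝ → ℝ) (b : ℝ), IsWeight ν w A b →
      Tendsto (fun n => ∫ x, w x * F n x ∂ν) atTop (𝓝 0) := by
    intro w A b hw
    obtain ⟨r, hr, hle⟩ := hw.tendsto_integral_mul hFi hFB hF0
    refine squeeze_zero (fun n => ?_) hle (by simpa using hr.add (hcross.const_mul b))
    apply integral_nonneg_of_ae
    filter_upwards [hw.nonneg, hFB n] with x h1 h2
    exact mul_nonneg h1 h2.1
  obtain ⟨A₁, hA₁⟩ := hm 1 one_pos
  have hmS : Tendsto (fun n => ∫ x, Wm x * S n x ∂ν) atTop (𝓝 0) := by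
    have hnn : ∀ n, 0 ≤ ∫ x, Wm x * S n x ∂ν := fun n => by
      apply integral_nonneg_of_ae
      filter_upwards [hA₁.nonneg, hSB n] with x h1 h2
      exact mul_nonneg h1 h2.1
    set R := 2 * N + 2 * ∫ x, ‖Ψ.val e x‖ ^ 2 ∂ν
    have hSR : ∀ n, ∫ x, S n x ∂ν ≤ R := fun n => integral_sub_norm_sq_le hN n
    have hR0 : 0 ≤ R := le_trans (integral_nonneg fun x => by positivity) (hSR 0)
    rw [Metric.tendsto_atTop]
    intro δ hδ
    obtain ⟨A, hA⟩ := hm (δ / (2 * (R + 1))) (by positivity)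
    obtain ⟨r, hr, hle⟩ := hA.tendsto_integral_mul hSi hSB hS0
    obtain ⟨M, hM⟩ := Metric.tendsto_atTop.1 hr (δ / 2) (by positivity)
    refine ⟨M, fun n hn => ?_⟩
    have h1 := hM n hn
    rw [Real.dist_eq, sub_zero] at h1 ⊢
    rw [abs_of_nonneg (hnn n)]
    have h2 : δ / (2 * (R + 1)) * ∫ x, S n x ∂ν ≤ δ / (2 * (R + 1)) * (R + 1) := by
      gcongr
      linarith [hSR n]
    have h3 : δ / (2 * (R + 1)) * (R + 1) = δ / 2 := by field_simp
    linarith [hle n, le_abs_self (r n)]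
  refine ⟨fun n => 2 * ∫ x, Wp x * F n x ∂ν + 2 * ∫ x, Wm x * F n x ∂ν + ∫ x, Wm x * S n x ∂ν,
    ?_, fun n => ?_⟩
  · simpa using (((hw _ _ _ hp).const_mul 2).add ((hw _ _ _ hA₁).const_mul 2)).add hmS
  have hpot : ∀ (Φ : G.H1), (∀ x ∈ G.dom e, ‖Φ.val e x‖ ^ 2 ≤ B) →
      Integrable (fun x => Wp x * ‖Φ.val e x‖ ^ 2) ν ∧
      Integrable (fun x => Wm x * ‖Φ.val e x‖ ^ 2) ν ∧
      ∫ x, W x * ‖Φ.val e x‖ ^ 2 ∂ν =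
        ∫ x, Wp x * ‖Φ.val e x‖ ^ 2 ∂ν - ∫ x, Wm x * ‖Φ.val e x‖ ^ 2 ∂ν := by
    intro Φ hΦ
    have h0 : ∀ᵐ x ∂ν, ‖‖Φ.val e x‖ ^ 2‖ ≤ B := by
      filter_upwards [Φ.ae_norm_sq_le hΦ] with x hx
      rw [Real.norm_of_nonneg hx.1]
      exact hx.2
    have h1 := hp.integrable_mul (integrable_norm_sq (Φ.memLp_val e)) h0
    have h2 := hA₁.integrable_mul (integrable_norm_sq (Φ.memLp_val e)) h0
    refine ⟨h1, h2, ?_⟩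
    rw [← integral_sub h1 h2]
    apply integral_congr_ae
    filter_upwards [hW] with x hx
    rw [hx]
    ring
  obtain ⟨i1, i2, e1⟩ := hpot Ψ (h.norm_sq_le hB)
  obtain ⟨j1, j2, e2⟩ := hpot (u n) (hB n)
  have nF : ∀ᵐ x ∂ν, ‖F n x‖ ≤ 5 * B := by
    filter_upwards [hFB n] with x hx
    rw [Real.norm_of_nonneg hx.1]
    exact hx.2
  have nS : ∀ᵐ x ∂ν, ‖S n x‖ ≤ 4 * B := by
    filter_upwards [hSB n] with x hx
    rw [Real.norm_of_nonneg hx.1]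
    exact hx.2
  have kp := hp.integrable_mul (hFi n) nF
  have km := hA₁.integrable_mul (hFi n) nF
  have ks := hA₁.integrable_mul (hSi n) nS
  have hpw : ∀ x, |‖(u n).val e x‖ ^ 2 - ‖Ψ.val e x‖ ^ 2 - S n x| ≤ 2 * F n x := fun x => by
    have := abs_norm_add_sq_sub_le (Ψ.val e x) (((u n).sub Ψ).val e x)
    rwa [← (u n).val_eq_add_sub] at this
  have b1 : ∫ x, Wp x * ‖Ψ.val e x‖ ^ 2 ∂ν ≤
      ∫ x, Wp x * ‖(u n).val e x‖ ^ 2 ∂ν + 2 * ∫ x, Wp x * F n x ∂ν := by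
    rw [← integral_const_mul, ← integral_add j1 (kp.const_mul 2)]
    refine integral_mono_ae i1 (j1.add (kp.const_mul 2)) ?_
    filter_upwards [hp.nonneg] with x hx
    have h1 := (abs_le.1 (hpw x)).1
    have h2 : 0 ≤ S n x := by positivity
    have h3 : Wp x * ‖Ψ.val e x‖ ^ 2 ≤ Wp x * (‖(u n).val e x‖ ^ 2 + 2 * F n x) :=
      mul_le_mul_of_nonneg_left (by linarith) hx
    linarith
  have b2 : ∫ x, Wm x * ‖(u n).val e x‖ ^ 2 ∂ν ≤
      ∫ x, Wm x * ‖Ψ.val e x‖ ^ 2 ∂ν + (2 * ∫ x, Wm x * F n x ∂ν + ∫ x, Wm x * S n x ∂ν) := by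
    have kms : Integrable (fun x => 2 * (Wm x * F n x) + Wm x * S n x) ν := (km.const_mul 2).add ks
    rw [← integral_const_mul, ← integral_add (km.const_mul 2) ks, ← integral_add i2 kms]
    refine integral_mono_ae j2 (i2.add kms) ?_
    filter_upwards [hA₁.nonneg] with x hx
    have h1 := (abs_le.1 (hpw x)).2
    have h3 : Wm x * ‖(u n).val e x‖ ^ 2 ≤ Wm x * (‖Ψ.val e x‖ ^ 2 + 2 * F n x + S n x) :=
      mul_le_mul_of_nonneg_left (by linarith) hx
    linarith
  rw [e1, e2]
  linarith

/-- The constant contains `4 * (4 * B)` because the squared modulus of the difference is bounded by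
`4 * B` only. -/
theorem TendstoWeakly.rpow_edge (h : TendstoWeakly u Ψ) {μ : ℝ} (hμ : 0 < μ) {B : ℝ} {e : I ⊕ X}
    (hB : ∀ n, ∀ x ∈ G.dom e, ‖(u n).val e x‖ ^ 2 ≤ B) (n : ℕ) :
    ∫ x, ‖(u n).val e x‖ ^ (2 * μ + 2) ∂(G.edgeMeasure e) ≤
      ∫ x, ‖Ψ.val e x‖ ^ (2 * μ + 2) ∂(G.edgeMeasure e) +
        ∫ x, ‖((u n).sub Ψ).val e x‖ ^ (2 * μ + 2) ∂(G.edgeMeasure e) +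
        (2 * μ + 2) * (2 * (4 * (4 * B)) ^ μ) *
          ∫ x, ‖Ψ.val e x‖ * ‖((u n).sub Ψ).val e x‖ ∂(G.edgeMeasure e) := by
  have hB0 : 0 ≤ B := (sq_nonneg _).trans (hB 0 0 (G.zero_mem_dom e))
  have h1 := Ψ.integrable_rpow hμ (h.norm_sq_le hB)
  have h2 := ((u n).sub Ψ).integrable_rpow hμ (h.sub_norm_sq_le hB n)
  have h3 := (integrable_norm_mul_norm (Ψ.memLp_val e) (((u n).sub Ψ).memLp_val e)).const_mul
    ((2 * μ + 2) * (2 * (4 * (4 * B)) ^ μ))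
  have h12 : Integrable (fun x => ‖Ψ.val e x‖ ^ (2 * μ + 2) +
      ‖((u n).sub Ψ).val e x‖ ^ (2 * μ + 2)) (G.edgeMeasure e) := h1.add h2
  rw [← integral_const_mul, ← integral_add h1 h2, ← integral_add h12 h3]
  refine integral_mono_ae ((u n).integrable_rpow hμ (hB n)) (h12.add h3) ?_
  filter_upwards [G.ae_mem_dom e] with x hx
  have h4 := add_rpow_le hμ (norm_nonneg (Ψ.val e x)) (norm_nonneg (((u n).sub Ψ).val e x))
    (B := 4 * B) (by linarith [h.norm_sq_le hB x hx]) (h.sub_norm_sq_le hB n x hx)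
  refine le_trans ?_ h4
  rw [(u n).val_eq_add_sub Ψ]
  gcongr
  exact norm_add_le _ _

variable [Fintype I] [Fintype X]

theorem TendstoWeakly.mass_sub (h : TendstoWeakly u Ψ) {m : ℝ} (hm : ∀ n, G.mass (u n) = m) :
    Tendsto (fun n => G.mass ((u n).sub Ψ)) atTop (𝓝 (m - G.mass Ψ)) := by
  have hN : ∀ e n, ∫ x, ‖(u n).val e x‖ ^ 2 ∂(G.edgeMeasure e) ≤ m := fun e n => by
    have := G.integral_le_normPow 2 (u n).val e
    simp only [Real.rpow_two] at this
    exact this.trans (hm n).le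
  have h1 : Tendsto (fun n => 2 * ∑ e, ∫ x, ‖Ψ.val e x‖ * ‖((u n).sub Ψ).val e x‖
      ∂(G.edgeMeasure e)) atTop (𝓝 0) := by
    simpa using (tendsto_finsetSum Finset.univ fun e _ => h.cross (hN e)).const_mul 2
  have h2 : Tendsto (fun n => m - G.mass Ψ - G.mass ((u n).sub Ψ)) atTop (𝓝 0) := by
    refine squeeze_zero_norm (fun n => ?_) h1
    rw [← hm n, mass, mass, mass, normPow_two, normPow_two, normPow_two, Real.norm_eq_abs,
      ← Finset.sum_sub_distrib, ← Finset.sum_sub_distrib, Finset.mul_sum]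
    exact (Finset.abs_sum_le_sum_abs _ _).trans
      (Finset.sum_le_sum fun e _ => abs_integral_sub_le (u n) Ψ e)
  simpa using h2.const_sub (m - G.mass Ψ)

/-- The energy of a weakly convergent sequence splits asymptotically into the energy of the limit
and the free energy of the difference. -/
theorem TendstoWeakly.exists_energy_ge [Fintype V] (h : TendstoWeakly u Ψ) {μ : ℝ} (hμ : 0 < μ)
    {α : V → ℝ} {W : I ⊕ X → ℝ → ℝ} (hW : G.IsAdmissiblePotential μ W) {m B : ℝ}
    (hm : ∀ n, G.mass (u n) = m)
    (hB : ∀ n e, ∀ x ∈ G.dom e, ‖(u n).val e x‖ ^ 2 ≤ B) :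
    ∃ r : ℕ → ℝ, Tendsto r atTop (𝓝 0) ∧ ∀ n,
      G.energy α W μ Ψ + (G.kinetic ((u n).sub Ψ) -
        1 / (μ + 1) * G.normPow (2 * μ + 2) ((u n).sub Ψ).val) - r n ≤
      G.energy α W μ (u n) := by
  have hN : ∀ e n, ∫ x, ‖(u n).val e x‖ ^ 2 ∂(G.edgeMeasure e) ≤ m := fun e n => by
    have := G.integral_le_normPow 2 (u n).val e
    simp only [Real.rpow_two] at this
    exact this.trans (hm n).le
  obtain ⟨Wp, Wm, hWe, ⟨Ap, bp, hp⟩, hWm⟩ := IsAdmissiblePotential.exists_isWeight hW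
  have hWm' : ∀ e, ∀ ε > 0, ∃ A, IsWeight (G.edgeMeasure e) (Wm e) A ε := fun e ε hε => by
    obtain ⟨A, hA⟩ := hWm ε hε
    exact ⟨A e, hA e⟩
  choose r hr hrle using fun e =>
    h.potential_edge (hN e) (fun n => hB n e) (hWe e) (hp e) (hWm' e)
  set c := (2 * μ + 2) * (2 * (4 * (4 * B)) ^ μ)
  set k : ℕ → ℝ := fun n => G.kinetic (u n) - G.kinetic Ψ - G.kinetic ((u n).sub Ψ) with hk
  set K : ℕ → ℝ := fun n => ∑ e, ∫ x, ‖Ψ.val e x‖ * ‖((u n).sub Ψ).val e x‖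
      ∂(G.edgeMeasure e) with hKdef
  set v : ℕ → ℝ := fun n => ∑ v, α v * ‖(u n).vert v‖ ^ 2 - ∑ v, α v * ‖Ψ.vert v‖ ^ 2
  have hklim : Tendsto k atTop (𝓝 0) := by
    have h1 := tendsto_finsetSum Finset.univ fun e (_ : e ∈ Finset.univ) => h.kinetic_edge e
    simp only [Finset.sum_const_zero] at h1
    refine h1.congr fun n => ?_
    rw [hk]
    simp only [kinetic, normPow_two, Finset.sum_sub_distrib]
  have hKlim : Tendsto K atTop (𝓝 0) := by
    have h1 := tendsto_finsetSum Finset.univ fun e (_ : e ∈ Finset.univ) => h.cross (hN e)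
    simpa only [Finset.sum_const_zero] using h1
  have hvlim : Tendsto v atTop (𝓝 0) := by
    have := (tendsto_finsetSum Finset.univ fun w _ =>
      ((h.vert w).norm.pow 2).const_mul (α w)).sub_const (∑ v, α v * ‖Ψ.vert v‖ ^ 2)
    rwa [sub_self] at this
  have hrlim : Tendsto (fun n => ∑ e, r e n) atTop (𝓝 0) := by
    simpa using tendsto_finsetSum Finset.univ fun e _ => hr e
  -- The error collects the kinetic, potential, vertex and nonlinear discrepancies, in this order.
  refine ⟨fun n => -k n + ∑ e, r e n - v n + 1 / (μ + 1) * (c * K n), ?_, fun n => ?_⟩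
  · simpa using ((hklim.neg.add hrlim).sub hvlim).add ((hKlim.const_mul c).const_mul (1 / (μ + 1)))
  have hpot := Finset.sum_le_sum fun e (_ : e ∈ Finset.univ) => hrle e n
  rw [Finset.sum_sub_distrib] at hpot
  have hQ : G.normPow (2 * μ + 2) (u n).val ≤ G.normPow (2 * μ + 2) Ψ.val +
      G.normPow (2 * μ + 2) ((u n).sub Ψ).val + c * K n := by
    rw [normPow, normPow, normPow, hKdef, Finset.mul_sum, ← Finset.sum_add_distrib,
      ← Finset.sum_add_distrib]
    exact Finset.sum_le_sum fun e _ => h.rpow_edge hμ (fun n => hB n e) n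
  have hQ' := mul_le_mul_of_nonneg_left hQ (show 0 ≤ 1 / (μ + 1) by positivity)
  rw [mul_add, mul_add] at hQ'
  have hkn : G.kinetic (u n) = G.kinetic Ψ + G.kinetic ((u n).sub Ψ) + k n := by
    rw [hk]
    ring
  have hvn : ∑ v, α v * ‖(u n).vert v‖ ^ 2 = ∑ v, α v * ‖Ψ.vert v‖ ^ 2 + v n := by
    simp [v]
  simp only [energy, linEnergy]
  change G.kinetic Ψ + _ + _ - _ + _ - _ ≤ G.kinetic (u n) + _ + _ - _
  rw [hkn, hvn]
  linarith

/-- The terms of the free energy living on the compact core vanish along the differences. -/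
theorem TendstoWeakly.tendsto_core (h : TendstoWeakly u Ψ) {μ : ℝ} (hμ : 0 < μ) {B : ℝ}
    (hB : ∀ n e, ∀ x ∈ G.dom e, ‖(u n).val e x‖ ^ 2 ≤ B) (b : ℝ) :
    Tendsto (fun n => ∑ i, ∫ x, ‖((u n).sub Ψ).val (Sum.inl i) x‖ ^ (2 * μ + 2)
      ∂(G.edgeMeasure (Sum.inl i)) + b * ∑ x, ‖((u n).sub Ψ).val (Sum.inr x) 0‖ ^ 2) atTop
      (𝓝 0) := by
  have h1 : ∀ i, Tendsto (fun n => ∫ x, ‖((u n).sub Ψ).val (Sum.inl i) x‖ ^ (2 * μ + 2)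
      ∂(G.edgeMeasure (Sum.inl i))) atTop (𝓝 0) := by
    intro i
    have : IsFiniteMeasure (G.edgeMeasure (Sum.inl i)) := by
      unfold edgeMeasure dom
      infer_instance
    suffices h0 : Tendsto (fun n => ∫ x, ‖((u n).sub Ψ).val (Sum.inl i) x‖ ^ (2 * μ + 2)
        ∂(G.edgeMeasure (Sum.inl i))) atTop (𝓝 (∫ _, (0 : ℝ) ∂(G.edgeMeasure (Sum.inl i)))) by
      rwa [integral_zero] at h0
    -- A constant dominates because internal edges have finite length; this fails on half-lines,
    -- where mass may escape.
    refine tendsto_integral_of_dominated_convergence (fun _ => (4 * B) ^ μ * (4 * B))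
      (fun n => (((u n).sub Ψ).integrable_rpow hμ (h.sub_norm_sq_le (fun n => hB n _) n)).1)
      (integrable_const _) (fun n => ?_) ?_
    · filter_upwards [((u n).sub Ψ).ae_norm_sq_le (h.sub_norm_sq_le (fun n => hB n _) n)]
        with x hx
      rw [Real.norm_of_nonneg (by positivity), rpow_two_mul_add_two hμ (norm_nonneg _)]
      have h0 : 0 ≤ 4 * B := hx.1.trans hx.2
      have := hx.2
      gcongr
    · filter_upwards [G.ae_mem_dom (Sum.inl i)] with x hx
      have h2 := (h.sub_val (Sum.inl i) x hx).norm
      rw [norm_zero] at h2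
      have h3 := h2.rpow_const (p := 2 * μ + 2) (Or.inr (by positivity))
      rwa [Real.zero_rpow (by positivity)] at h3
  have h2 : ∀ x, Tendsto (fun n => ‖((u n).sub Ψ).val (Sum.inr x) 0‖ ^ 2) atTop (𝓝 0) := by
    intro x
    simpa using (h.sub_val (Sum.inr x) 0 (G.zero_mem_dom _)).norm.pow 2
  simpa using (tendsto_finsetSum Finset.univ fun i _ => h1 i).add
    ((tendsto_finsetSum Finset.univ fun x _ => h2 x).const_mul b)

end WeakSplitting
end MetricGraph

/-! ### Existence of ground states below the threshold. -/

namespace MetricGraph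
section GroundStates

open MeasureTheory Set Filter Topology

variable {V I X : Type*} [Fintype V] [Fintype I] [Fintype X] {G : MetricGraph V I X}

theorem energyInf_le_energy (α : V → ℝ) (W : I ⊕ X → ℝ → ℝ) (μ : ℝ) {m R : ℝ}
    (hR : G.energyInf α W μ m = R) {Ψ : G.H1} (hΨ : G.mass Ψ = m) : R ≤ G.energy α W μ Ψ := by
  rw [← EReal.coe_le_coe_iff, ← hR]
  exact iInf_le (fun Ψ : {Ψ : G.H1 // G.mass Ψ = m} => (G.energy α W μ Ψ.1 : EReal)) ⟨Ψ, hΨ⟩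

/-- The energy of a function of smaller mass is bounded below by a proportional part of the
infimum. -/
theorem mass_mul_energyInf_le [Nonempty X] (hG : G.Connected) {μ : ℝ} (hμ : 0 < μ) {α : V → ℝ}
    {W : I ⊕ X → ℝ → ℝ} (hW : G.IsAdmissiblePotential μ W) {m R : ℝ} (hm : 0 < m)
    (hR : G.energyInf α W μ m = R) {Ψ : G.H1} (hΨ : G.mass Ψ ≤ m) :
    G.mass Ψ / m * R ≤ G.energy α W μ Ψ := by
  rcases (mass_nonneg Ψ).eq_or_lt with h0 | h0
  -- Mass zero cannot be rescaled to `m`, but then every term except the kinetic one drops out of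
  -- the lower bound.
  · obtain ⟨C, -, hC⟩ := exists_le_linEnergy hG α hW
    obtain ⟨B, -, hB⟩ := Ψ.exists_bound hG
    have h1 := hC Ψ
    have h2 := Ψ.normPow_le hμ hB
    have h3 := G.normPow_nonneg (2 * μ + 2) Ψ.val
    rw [← h0, mul_zero] at h2
    have h4 : G.normPow (2 * μ + 2) Ψ.val = 0 := le_antisymm h2 h3
    have h5 := kinetic_nonneg Ψ
    rw [← h0, Real.sqrt_zero] at h1
    rw [energy, h4, ← h0, zero_div, zero_mul]
    linarith
  · have hc : 1 ≤ √(m / G.mass Ψ) := by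
      rw [Real.one_le_sqrt, one_le_div h0]
      exact hΨ
    have h1 := energyInf_le_energy α W μ hR (Ψ := Ψ.smul √(m / G.mass Ψ)) (by
      rw [mass_smul (Real.sqrt_nonneg _), Real.sq_sqrt (by positivity)]
      field_simp)
    have h2 := h1.trans (energy_smul_le α W hμ hc Ψ)
    rw [Real.sq_sqrt (by positivity), div_mul_eq_mul_div, le_div_iff₀ h0] at h2
    rw [div_mul_eq_mul_div, div_le_iff₀ hm]
    linarith

theorem exists_isGroundState [Nonempty X] (hG : G.Connected) {μ : ℝ} (hμ : 0 < μ) (hμ2 : μ ≤ 2)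
    {α : V → ℝ} {W : I ⊕ X → ℝ → ℝ} (hW : G.IsAdmissiblePotential μ W) {E : ℝ} (hE0 : 0 < E)
    (hE : G.E0 α W = E) {Ψ₁ : G.H1} (hΨ₁ : G.mass Ψ₁ = 1) {m : ℝ} (hm : 0 < m)
    (hmt : m < G.massThreshold α W μ) : ∃ Ψ : G.H1, G.IsGroundState α W μ m Ψ := by
  obtain ⟨R, hR⟩ := exists_energyInf_eq_coe hG hμ hμ2 hW hE hΨ₁ hm hmt
  have hRE : R ≤ -(m * E) := by
    rw [← EReal.coe_le_coe_iff, ← hR]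
    exact energyInf_le hμ hE hm
  have hseq : ∀ n : ℕ, ∃ Ψ : G.H1, G.mass Ψ = m ∧ G.energy α W μ Ψ < R + 1 / ((n : ℝ) + 1) := by
    intro n
    have h1 : G.energyInf α W μ m < ((R + 1 / ((n : ℝ) + 1) : ℝ) : EReal) := by
      rw [hR, EReal.coe_lt_coe_iff]
      have : 0 < 1 / ((n : ℝ) + 1) := by positivity
      linarith
    obtain ⟨Ψ, hΨ⟩ := iInf_lt_iff.1 h1
    exact ⟨Ψ.1, Ψ.2, EReal.coe_lt_coe_iff.1 hΨ⟩
  choose Ψs hmass hen using hseq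
  obtain ⟨T, hT⟩ := exists_kinetic_le hG hμ hμ2 hW hΨ₁ hm hmt (R + 1)
  have hkin : ∀ n, G.kinetic (Ψs n) ≤ T := fun n => by
    refine hT _ (hmass n) ((hen n).le.trans ?_)
    have : 1 / ((n : ℝ) + 1) ≤ 1 := by
      rw [div_le_one (by positivity)]
      linarith [n.cast_nonneg (α := ℝ)]
    linarith
  obtain ⟨C, hC, hsup⟩ := exists_norm_sq_le hG
  set B := C * (√m * √T)
  have hB0 : 0 ≤ B := by positivity
  have hle : ∀ n, C * (√(G.mass (Ψs n)) * √(G.kinetic (Ψs n))) ≤ B := fun n => by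
    have := Real.sqrt_le_sqrt (hkin n)
    rw [hmass]
    exact mul_le_mul_of_nonneg_left (mul_le_mul_of_nonneg_left this (Real.sqrt_nonneg m)) hC
  have hBv : ∀ n v, ‖(Ψs n).vert v‖ ≤ √B := fun n v =>
    Real.le_sqrt_of_sq_le (((hsup _).1 v).trans (hle n))
  have hBe : ∀ n e, ∀ x ∈ G.dom e, ‖(Ψs n).val e x‖ ^ 2 ≤ B := fun n e x hx =>
    ((hsup _).2 e x hx).trans (hle n)
  obtain ⟨Ψ, φ, hφ, hw⟩ := exists_tendstoWeakly Ψs (T := T) (N := m) (B := √B)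
    (fun n e => by
      have := (G.integral_le_normPow 2 (Ψs n).der e).trans (hkin n)
      simpa only [Real.rpow_two] using this)
    (fun n e => by
      have := (G.integral_le_normPow 2 (Ψs n).val e).trans (hmass n).le
      simpa only [Real.rpow_two] using this)
    hBv (fun n e x hx => Real.le_sqrt_of_sq_le (hBe n e x hx))
  have hsub := hw.mass_sub fun n => hmass (φ n)
  have hΨm : 0 ≤ m - G.mass Ψ := ge_of_tendsto' hsub fun n => mass_nonneg _
  obtain ⟨r, hr, hsplit⟩ := hw.exists_energy_ge (α := α) hμ hW (fun n => hmass (φ n))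
    (fun n => hBe (φ n))
  obtain ⟨m', hm', E', hE'0, hE', hfree⟩ :=
    exists_free_energy_ge hG hμ hμ2 hE0 hE hΨ₁ hm hmt
  have hcore := hw.tendsto_core hμ (fun n => hBe (φ n)) √((4 * B) ^ μ)
  -- The escaping mass lowers the energy by at most `E'` per unit, because the core terms of its
  -- free energy tend to zero.
  have hlim : G.energy α W μ Ψ - E' * (m - G.mass Ψ) ≤ R := by
    have h1 : Tendsto (fun n : ℕ => R + 1 / (((φ n : ℕ) : ℝ) + 1)) atTop (𝓝 (R + 0)) :=
      (tendsto_one_div_add_atTop_nhds_zero_nat.comp hφ.tendsto_atTop).const_add R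
    have h2 := (((hsub.const_mul E').const_sub (G.energy α W μ Ψ)).sub hcore).sub hr
    rw [sub_zero, sub_zero] at h2
    rw [add_zero] at h1
    refine le_of_tendsto_of_tendsto h2 h1 ?_
    -- The limit of these masses is at most `m`, with equality when `Ψ` vanishes; hence the need for
    -- `m < m'`.
    have h3 : ∀ᶠ n in atTop, G.mass ((Ψs (φ n)).sub Ψ) < m' :=
      hsub.eventually_lt_const (by linarith [mass_nonneg Ψ])
    filter_upwards [h3] with n hn
    have h4 := hfree (4 * B) ((Ψs (φ n)).sub Ψ) (by positivity)
      (fun e => hw.sub_norm_sq_le (fun n => hBe (φ n) e) n) hn.le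
    have h5 := hsplit n
    have h6 := hen (φ n)
    linarith
  have hscale := mass_mul_energyInf_le hG hμ hW hm hR (Ψ := Ψ) (by linarith)
  have hmΨ : G.mass Ψ = m := by
    have h1 : G.mass Ψ / m * R - R = -((m - G.mass Ψ) / m * R) := by field_simp; ring
    have h2 : (m - G.mass Ψ) / m * R ≤ (m - G.mass Ψ) / m * -(m * E) := by gcongr
    have h3 : (m - G.mass Ψ) / m * -(m * E) = -((m - G.mass Ψ) * E) := by field_simp
    -- Mass kept in place is worth at least `E` per unit since `R ≤ -(m * E)`, whereas escaping mass
    -- is worth at most `E' < E`; so none escapes.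
    have h4 : (m - G.mass Ψ) * (E - E') ≤ 0 := by linarith
    have h5 : m - G.mass Ψ ≤ 0 := nonpos_of_mul_nonpos_left h4 (by linarith)
    linarith
  refine ⟨Ψ, hmΨ, ?_⟩
  rw [hR, EReal.coe_eq_coe_iff]
  refine le_antisymm ?_ (energyInf_le_energy α W μ hR hmΨ)
  -- With full mass the limiting inequality says that the energy of `Ψ` does not exceed the infimum.
  rwa [hmΨ, sub_self, mul_zero, sub_zero] at hlim

end GroundStates
end MetricGraph
theorem theorem1p2 {V I X : Type*} [Fintype V] [Fintype I] [Fintype X] [Nonempty X]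
    (G : MetricGraph V I X) (hG : G.Connected)
    (μ : ℝ) (hμ : 0 < μ) (hμ2 : μ ≤ 2)
    (α : V → ℝ) (W : I ⊕ X → ℝ → ℝ) (hW : G.IsAdmissiblePotential μ W)
    (hE0 : 0 < G.E0 α W) :
    (∀ m : ℝ, 0 < m → G.energyInf α W μ m ≤ -((m : EReal) * G.E0 α W)) ∧
    0 < G.massThreshold α W μ ∧
    ∀ m : ℝ, 0 < m → m < G.massThreshold α W μ → ∃ Ψ : G.H1, G.IsGroundState α W μ m Ψ := by
  obtain ⟨E, hE0', hE, Ψ₁, hΨ₁⟩ := MetricGraph.exists_E0_eq_coe hG hW hE0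
  refine ⟨fun m hm => ?_, MetricGraph.massThreshold_pos hG hμ hE0' hE hΨ₁, fun m hm hmt =>
    MetricGraph.exists_isGroundState hG hμ hμ2 hW hE0' hE hΨ₁ hm hmt⟩
  have h := MetricGraph.energyInf_le (μ := μ) hμ hE hm
  rw [hE]
  exact_mod_cast h
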